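/- Let $N,h,k$ be nonnegative integers with $k>h-\tfrac12$. For $U\in \mathbf U(N)$ with eigenvalues $e^{i\theta_1},\dots,e^{i\theta_N}$, $\theta_n\in[0,2\pi)$, put $$V_U(\theta)=\exp\Bigl(iN\tfrac{\theta+\pi}{2}-i\sum_{n=1}^N\tfrac{\theta_n}{2}\Bigr)\prod_{n=1}^N\bigl(1-e^{i(\theta_n-\theta)}\bigr),\qquad F_N(h,k)=\int_{\mathbf U(N)}|V_U(0)|^{2k-2h}\,|V_U'(0)|^{2h}\,d\mu^{\mathrm{Haar}},$$ where $\mu^{\mathrm{Haar}}$ is the Haar probability measure on $\mathbf U(N)$ (and $0^0=1$). Let $$L^{(\alpha)}_n(s)=\sum_{j=0}^{n}\frac{\Gamma(n+\alpha+1)}{\Gamma(j+\alpha+1)\,(n-j)!}\,\frac{(-s)^j}{j!}\quad(n\ge 0),\qquad L^{(\alpha)}_n=0\quad (n<0),$$ be the generalised Laguerre polynomials, and let $$D_{k}(x)=\det\bigl[L^{(2k-1)}_{N+k-1-(i+j)}(-x)\bigr]_{i,j=0,\dots,k-1},\qquad f_k(x)=(-1)^{k(k-1)/2}\,e^{-Nx/2}\,D_k(x)$$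 (an empty determinant is $1$), and $$K_n(\epsilon,y)=\frac{(-1)^n}{\pi}\frac{\partial^n}{\partial\epsilon^n}\Bigl(\frac{\epsilon}{\epsilon^2+y^2}\Bigr).$$ Then all the integrals below and the integral defining $F_N(h,k)$ converge absolutely, and $$F_N(h,k)=\lim_{\epsilon\to0^+}(-1)^{k(k-1)/2}\,2^{-2h}\int_{-\infty}^{\infty}K_{2h}(\epsilon,y)\,e^{-N|y|}\,D_k(2|y|)\,dy=(-1)^h f_k^{(2h)}(0).$$ Moreover $f_k^{(2h-2j-1)}(0)=0$ for $0\le j\le h-1$. -/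

import Mathlib

noncomputable section

/-- The generalised Laguerre polynomial `L_n^{(α)}`, evaluated at `s`, with the usual convention
that it is zero for a negative index `n`. -/
def laguerreL (α : ℝ) : ℤ → ℝ → ℝ
  | Int.ofNat n, s => ∑ j ∈ Finset.range (n + 1),
      Real.Gamma ((n : ℝ) + α + 1) / (Real.Gamma ((j : ℝ) + α + 1) * ((n - j).factorial : ℝ))
        * ((-s) ^ j / (j.factorial : ℝ))
  | Int.negSucc _, _ => 0

/-- The determinant `det [L^{(2k-1)}_{N+k-1-(i+j)}(-x)]`, where `i, j = 0, …, k-1`. -/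
def laguerreDet (N k : ℕ) (x : ℝ) : ℝ :=
  Matrix.det (Matrix.of fun i j : Fin k =>
    laguerreL (2 * (k : ℝ) - 1) ((N : ℤ) + (k : ℤ) - 1 - (((i : ℕ) : ℤ) + ((j : ℕ) : ℤ))) (-x))

/-- The function `f_k(x)`. -/
def fLag (N k : ℕ) (x : ℝ) : ℝ :=
  (-1) ^ (k * (k - 1) / 2) * Real.exp (-((N : ℝ) / 2) * x) * laguerreDet N k x

/-- The kernel `K_n(ε, y)`. -/
def kernelK (n : ℕ) (ε y : ℝ) : ℝ :=
  (-1) ^ n / Real.pi * iteratedDeriv n (fun e : ℝ => e / (e ^ 2 + y ^ 2)) ε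

instance unitaryGroupMeasurableSpace (N : ℕ) :
    MeasurableSpace (Matrix.unitaryGroup (Fin N) ℂ) := borel _

instance unitaryGroupBorelSpace (N : ℕ) :
    BorelSpace (Matrix.unitaryGroup (Fin N) ℂ) := ⟨rfl⟩

instance unitaryGroupCompactSpace (N : ℕ) :
    CompactSpace (Matrix.unitaryGroup (Fin N) ℂ) := by
  refine (isCompact_iff_compactSpace (s := ((Matrix.unitaryGroup (Fin N) ℂ :
    Submonoid (Matrix (Fin N) (Fin N) ℂ)) : Set (Matrix (Fin N) (Fin N) ℂ)))).mp ?_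
  refine IsCompact.of_isClosed_subset
    (isCompact_univ_pi fun _ : Fin N => isCompact_univ_pi fun _ : Fin N =>
      isCompact_closedBall (0 : ℂ) 1) ?_ ?_
  · have h : ((Matrix.unitaryGroup (Fin N) ℂ : Submonoid (Matrix (Fin N) (Fin N) ℂ)) :
        Set (Matrix (Fin N) (Fin N) ℂ)) = {A | A * star A = 1} := by
      ext A
      exact Matrix.mem_unitaryGroup_iff
    rw [h]
    exact isClosed_eq (continuous_id.mul continuous_star) continuous_const
  · intro A hA i _ j _
    simpa using entry_norm_bound_of_unitary hA i j

/-- Haar measure on the unitary group `U(N)`, normalised to total mass one. -/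
def haarU (N : ℕ) : MeasureTheory.Measure (Matrix.unitaryGroup (Fin N) ℂ) :=
  MeasureTheory.Measure.haarMeasure ⊤

/-- The eigenvalues of `U`, with multiplicity. -/
def eigenvaluesU {N : ℕ} (U : Matrix.unitaryGroup (Fin N) ℂ) : Multiset ℂ :=
  (U : Matrix (Fin N) (Fin N) ℂ).charpoly.roots

/-- The eigenangles `θ₁, …, θ_N ∈ [0, 2π)` of `U`, with multiplicity. -/
def eigenangles {N : ℕ} (U : Matrix.unitaryGroup (Fin N) ℂ) : Multiset ℝ :=
  (eigenvaluesU U).map fun z => toIcoMod Real.two_pi_pos 0 (Complex.arg z)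

/-- The characteristic polynomial `Z_U(θ) = ∏ (1 - e^{i(θ_n - θ)})`. -/
def charZ {N : ℕ} (U : Matrix.unitaryGroup (Fin N) ℂ) (θ : ℝ) : ℂ :=
  ((eigenangles U).map fun t : ℝ => 1 - Complex.exp (Complex.I * ((t : ℂ) - (θ : ℂ)))).prod

/-- `V_U(θ) = exp (iN(θ + π)/2 - i ∑ θ_n/2) Z_U(θ)`. -/
def charV {N : ℕ} (U : Matrix.unitaryGroup (Fin N) ℂ) (θ : ℝ) : ℂ :=
  Complex.exp (Complex.I * (N : ℂ) * (((θ : ℂ) + (Real.pi : ℂ)) / 2)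
    - Complex.I * (((eigenangles U).map fun t : ℝ => (t : ℂ) / 2).sum)) * charZ U θ

/-- The integrand `|V_U(0)|^{2k-2h} |V_U'(0)|^{2h}`. -/
def momentIntegrand (N : ℕ) (h k : ℝ) (U : Matrix.unitaryGroup (Fin N) ℂ) : ℝ :=
  ‖charV U 0‖ ^ (2 * k - 2 * h) * ‖deriv (charV U) 0‖ ^ (2 * h)

/-- The joint moment `F_N(h, k)`, the integral over `U(N)` of `|V_U(0)|^{2k-2h} |V_U'(0)|^{2h}`. -/
def jointMoment (N : ℕ) (h k : ℝ) : ℝ :=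
  ∫ U : Matrix.unitaryGroup (Fin N) ℂ, momentIntegrand N h k U ∂(haarU N)

end

/-! For integers the hypothesis forces `h ≤ k`. Since `V_U` is real, the absolute values can be
dropped from the even powers. With `χ(z) = det(1 - zU)`, the integrand is then a sign times
`det(U)^{-k} χ(1)^{2k-2h} (χ'(1) - (N/2)χ(1))^{2h}`. All such averages are contained in the
polynomial `P(z)`, the average of `det(U)^{-k} ∏ det(1 - z_i U)` in `2k` variables.

The heart of the proof is the evaluation of `P` as a signed rectangular Schur function. Invariance
of Haar measure gives a loop equation (`integral_charProd_loop`). From it, `Δ·P`, with `Δ` the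
Vandermonde polynomial, is an eigenfunction of `∑ X_j∂_j` and of `∑ (X_j∂_j)²`. Monomials
diagonalise both operators, so every monomial of `Δ·P` has a prescribed sum and sum of squares of
its exponents. With antisymmetry and the degree bounds, an extremality argument leaves a single
orbit of exponents (`exists_perm_rectExp`). Hence `Δ·P` is a multiple of one alternant, and
Jacobi–Trudi writes `P` as a Toeplitz determinant of complete homogeneous functions
(`avgPoly_eq_det`).

The moments are read off at `z_i = 1 + y_i` with `y_i² = 0`. Everything there is a polynomial in `x
= ∑ y_i`: `∏ (a + b y_i)` becomes `∑ a^{n-m} b^m x^m / m!`, the complete homogeneous functions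
become Laguerre polynomials in `-x`, and `∏ (1 - (N/2) y_i)` becomes `e^{-Nx/2}`. Comparing
coefficients of `x^m` for `m ≤ 2k` gives the average of `V(0)^{2k-m} V'(0)^m` as `(-i)^m
f_k^{(m)}(0)`. The average is real, so the odd derivatives vanish.

For the regularised integral, `K_n(ε, y) = (n!/π) Re (ε + iy)^{-n-1}`. Integrating by parts `2h`
times on the half-line moves all derivatives onto `f_k(2y)`. The boundary terms vanish because the
odd derivatives do, and what remains is a Poisson kernel, an approximate identity. -/

open MeasureTheory Matrix Filter Topology

noncomputable section

/-! ### Derivatives of determinants, inverses and exponentials of matrices. -/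

section MatrixCalculus

attribute [local instance] Matrix.linftyOpNormedRing Matrix.linftyOpNormedAlgebra

variable {n : Type*} [Fintype n] [DecidableEq n]

theorem Matrix.differentiable_det : Differentiable ℂ (fun A : Matrix n n ℂ => A.det) := by
  simp only [Matrix.det_apply]
  have h : ∀ i j, Differentiable ℂ fun A : Matrix n n ℂ => A i j := fun i j =>
    (LinearMap.toContinuousLinearMap (Matrix.entryLinearMap ℂ ℂ i j)).differentiable
  fun_prop

/-- Jacobi's formula: factoring out `A t` reduces it to the linear term of `det(1 + sB)`. The field
`𝕜` is left free because the formula serves both the real flow on `U(N)` and the complex spectral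
variable. -/
theorem HasDerivAt.matrix_det {𝕜 : Type*} [NontriviallyNormedField 𝕜] [NormedAlgebra 𝕜 ℂ]
    {A : 𝕜 → Matrix n n ℂ} {A' : Matrix n n ℂ} {t : 𝕜}
    (hA : HasDerivAt A A' t) (h0 : IsUnit (A t).det) :
    HasDerivAt (fun s => (A s).det) ((A t).det * ((A t)⁻¹ * A').trace) t := by
  have h1 := (Matrix.differentiable_det (A t)).hasFDerivAt
  have h2 : HasDerivAt (fun s : ℂ => A t + s • A') A' 0 := by
    have h := ((hasDerivAt_id (0 : ℂ)).smul_const A').const_add (A t)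
    rw [one_smul] at h
    exact h
  have h3 : HasDerivAt (fun s : ℂ => (A t + s • A').det)
      ((A t).det * ((A t)⁻¹ * A').trace) 0 := by
    have e : (fun s : ℂ => (A t + s • A').det) =
        fun s : ℂ => (A t).det * (1 + s • ((A t)⁻¹ * A')).det := by
      funext s
      rw [← Matrix.det_mul, mul_add, mul_one, mul_smul_comm, ← mul_assoc,
        Matrix.mul_nonsing_inv _ h0, one_mul]
    rw [e]
    refine HasDerivAt.const_mul _ ?_
    have e2 : (fun s : ℂ => (1 + s • ((A t)⁻¹ * A')).det) =
        fun s : ℂ => (Matrix.det (1 + (Polynomial.X : Polynomial ℂ) •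
          ((A t)⁻¹ * A').map Polynomial.C)).eval s := by
      funext s
      generalize (A t)⁻¹ * A' = B
      rw [← Polynomial.coe_evalRingHom, RingHom.map_det]
      congr 1
      ext i j
      by_cases hij : i = j <;> simp [hij, mul_comm s]
    rw [e2, ← Matrix.derivative_det_one_add_X_smul]
    exact Polynomial.hasDerivAt _ _
  -- The derivative along the line `A t + s A'` identifies the Fréchet derivative in direction `A'`,
  -- and the chain rule then covers arbitrary curves.
  have h4 : HasDerivAt (fun s : ℂ => (A t + s • A').det)
      (fderiv ℂ (fun A : Matrix n n ℂ => A.det) (A t) A') 0 := by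
    have h1' : HasFDerivAt (fun A : Matrix n n ℂ => A.det)
      (fderiv ℂ (fun A : Matrix n n ℂ => A.det) (A t)) (A t + (0 : ℂ) • A') := by simpa using h1
    exact h1'.comp_hasDerivAt 0 h2
  rw [h3.unique h4]
  exact (h1.restrictScalars 𝕜).comp_hasDerivAt t hA

theorem HasDerivAt.matrix_inv {𝕜 : Type*} [NontriviallyNormedField 𝕜] [NormedAlgebra 𝕜 ℂ]
    {A : 𝕜 → Matrix n n ℂ} {A' : Matrix n n ℂ} {t : 𝕜}
    (hA : HasDerivAt A A' t) (h0 : IsUnit (A t).det) :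
    HasDerivAt (fun s => (A s)⁻¹) (-((A t)⁻¹ * A' * (A t)⁻¹)) t := by
  obtain ⟨u, hu⟩ := (Matrix.isUnit_iff_isUnit_det _).mpr h0
  have h1 := hasFDerivAt_ringInverse (𝕜 := ℂ) u
  rw [hu] at h1
  have h2 := (h1.restrictScalars 𝕜).comp_hasDerivAt t hA
  simp only [Matrix.nonsing_inv_eq_ringInverse]
  have h3 : Ring.inverse (A t) = ↑u⁻¹ := by rw [← hu, Ring.inverse_unit]
  rw [h3]
  exact h2

theorem HasDerivAt.matrix_entry {𝕜 : Type*} [NontriviallyNormedField 𝕜] [NormedAlgebra 𝕜 ℂ]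
    {A : 𝕜 → Matrix n n ℂ} {A' : Matrix n n ℂ} {t : 𝕜}
    (hA : HasDerivAt A A' t) (i j : n) : HasDerivAt (fun s => A s i j) (A' i j) t :=
  (((LinearMap.toContinuousLinearMap (Matrix.entryLinearMap ℂ ℂ i j)).hasFDerivAt).restrictScalars
    𝕜).comp_hasDerivAt t hA

theorem HasDerivAt.matrix_trace {𝕜 : Type*} [NontriviallyNormedField 𝕜] [NormedAlgebra 𝕜 ℂ]
    {A : 𝕜 → Matrix n n ℂ} {A' : Matrix n n ℂ} {t : 𝕜}
    (hA : HasDerivAt A A' t) : HasDerivAt (fun s => (A s).trace) A'.trace t := by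
  simp only [Matrix.trace, Matrix.diag]
  exact HasDerivAt.fun_sum fun i _ => hA.matrix_entry i i

theorem Matrix.hasDerivAt_exp_smul_mul (X U : Matrix n n ℂ) (t : ℝ) :
    HasDerivAt (fun s : ℝ => NormedSpace.exp (s • X) * U) (X * (NormedSpace.exp (t • X) * U)) t := by
  rw [← mul_assoc]
  exact (hasDerivAt_exp_smul_const' X t).mul_const U

end MatrixCalculus

/-! ### Haar measure and left translation flows. -/

instance haarU_isProbabilityMeasure (N : ℕ) : IsProbabilityMeasure (haarU N) :=
  ⟨Measure.haarMeasure_self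
    (K₀ := (⊤ : TopologicalSpace.PositiveCompacts (Matrix.unitaryGroup (Fin N) ℂ)))⟩

instance haarU_isMulLeftInvariant (N : ℕ) : (haarU N).IsMulLeftInvariant := by
  unfold haarU; infer_instance

theorem Continuous.integrable_haarU {N : ℕ} {f : Matrix.unitaryGroup (Fin N) ℂ → ℂ}
    (hf : Continuous f) : Integrable f (haarU N) :=
  hf.integrable_of_hasCompactSupport (HasCompactSupport.of_compactSpace f)

/-- The one-parameter group generated by a skew-Hermitian matrix. -/
def expU {N : ℕ} (X : Matrix (Fin N) (Fin N) ℂ) (hX : Xᴴ = -X) (t : ℝ) :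
    Matrix.unitaryGroup (Fin N) ℂ :=
  ⟨NormedSpace.exp (t • X), by
    rw [Matrix.mem_unitaryGroup_iff, Matrix.star_eq_conjTranspose, ← Matrix.exp_conjTranspose,
      Matrix.conjTranspose_smul, hX, star_trivial, smul_neg,
      ← Matrix.exp_add_of_commute (t • X) (-(t • X)) (Commute.neg_right (Commute.refl _)),
      add_neg_cancel, NormedSpace.exp_zero]⟩

theorem expU_add {N : ℕ} (X : Matrix (Fin N) (Fin N) ℂ) (hX : Xᴴ = -X) (s t : ℝ) :
    expU X hX (s + t) = expU X hX s * expU X hX t := by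
  apply Subtype.ext
  change NormedSpace.exp ((s + t) • X) = NormedSpace.exp (s • X) * NormedSpace.exp (t • X)
  rw [add_smul, Matrix.exp_add_of_commute]
  exact ((Commute.refl X).smul_left s).smul_right t

/-- The integral over `U(N)` of a derivative along a left translation flow vanishes. -/
theorem integral_haarU_flow_deriv_eq_zero {N : ℕ} (X : Matrix (Fin N) (Fin N) ℂ) (hX : Xᴴ = -X)
    (ψ ψ' : Matrix.unitaryGroup (Fin N) ℂ → ℂ) (hψ : Continuous ψ) (hψ' : Continuous ψ')
    (hd : ∀ U, HasDerivAt (fun t : ℝ => ψ (expU X hX t * U)) (ψ' U) 0) :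
    ∫ U, ψ' U ∂(haarU N) = 0 := by
  -- The group law carries the derivative at time `0` to every time.
  have hd' : ∀ U t, HasDerivAt (fun t : ℝ => ψ (expU X hX t * U)) (ψ' (expU X hX t * U)) t := by
    intro U t
    have h1 := hd (expU X hX t * U)
    have h2 : HasDerivAt (fun s : ℝ => s - t) 1 t := (hasDerivAt_id t).sub_const t
    have h1' : HasDerivAt (fun s : ℝ => ψ (expU X hX s * (expU X hX t * U)))
      (ψ' (expU X hX t * U)) (t - t) := by simpa using h1
    have h3 := HasDerivAt.scomp (h := fun s : ℝ => s - t) t h1' h2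
    simp only [one_smul] at h3
    refine h3.congr_of_eventuallyEq (Eventually.of_forall fun s => ?_)
    simp only [Function.comp]
    rw [← mul_assoc, ← expU_add, sub_add_cancel]
  obtain ⟨C, hC⟩ := (isCompact_range hψ').isBounded.exists_norm_le
  have hC' : ∀ U, ‖ψ' U‖ ≤ C := fun U => hC _ ⟨U, rfl⟩
  have hz : expU X hX 0 = 1 := by
    apply Subtype.ext
    change NormedSpace.exp ((0 : ℝ) • X) = 1
    simp
  have key := (hasDerivAt_integral_of_dominated_loc_of_deriv_le (μ := haarU N)
    (F := fun t U => ψ (expU X hX t * U)) (F' := fun t U => ψ' (expU X hX t * U))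
    (x₀ := (0 : ℝ)) (s := Set.univ) (bound := fun _ => C) univ_mem
    (Eventually.of_forall fun t =>
      ((hψ.comp (continuous_const.mul continuous_id)).integrable_haarU).aestronglyMeasurable)
    ((hψ.comp (continuous_const.mul continuous_id)).integrable_haarU)
    ((hψ'.comp (continuous_const.mul continuous_id)).integrable_haarU).aestronglyMeasurable
    (Eventually.of_forall fun U t _ => hC' _) (integrable_const C)
    (Eventually.of_forall fun U t _ => hd' U t)).2
  -- By left invariance the integral does not depend on `t`, so its derivative is zero.
  have hconst : (fun t : ℝ => ∫ U, ψ (expU X hX t * U) ∂(haarU N)) =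
      fun _ => ∫ U, ψ U ∂(haarU N) := by
    funext t
    exact integral_mul_left_eq_self ψ (expU X hX t)
  rw [hconst] at key
  have := key.unique (hasDerivAt_const (0 : ℝ) _)
  simpa [hz] using this

/-! ### Eigenvalues of unitary matrices and invertibility of `1 - wU`. -/

section Spectrum

open scoped Matrix.Norms.L2Operator

theorem norm_eq_one_of_mem_eigenvaluesU {N : ℕ} (U : Matrix.unitaryGroup (Fin N) ℂ) {z : ℂ}
    (hz : z ∈ eigenvaluesU U) : ‖z‖ = 1 := by
  refine spectrum.norm_eq_one_of_unitary (𝕜 := ℂ) (u := (U : Matrix (Fin N) (Fin N) ℂ)) U.2 ?_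
  rw [Matrix.mem_spectrum_iff_isRoot_charpoly]
  exact Polynomial.isRoot_of_mem_roots hz

end Spectrum

theorem card_eigenvaluesU {N : ℕ} (U : Matrix.unitaryGroup (Fin N) ℂ) :
    (eigenvaluesU U).card = N := by
  rw [eigenvaluesU, ← (IsAlgClosed.splits _).natDegree_eq_card_roots, Matrix.charpoly_natDegree_eq_dim,
    Fintype.card_fin]

theorem det_one_sub_smul_eq_prod {N : ℕ} (U : Matrix.unitaryGroup (Fin N) ℂ) (w : ℂ) :
    (1 - w • (U : Matrix (Fin N) (Fin N) ℂ)).det =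
      ((eigenvaluesU U).map fun z => 1 - w * z).prod := by
  rcases eq_or_ne w 0 with rfl | hw
  · simp
  have h1 : (1 - w • (U : Matrix (Fin N) (Fin N) ℂ)) =
      w • (Matrix.scalar (Fin N) w⁻¹ - (U : Matrix (Fin N) (Fin N) ℂ)) := by
    rw [smul_sub]
    congr 1
    ext i j
    by_cases h : i = j <;> simp [h, hw, Matrix.scalar_apply, Matrix.one_apply]
  rw [h1, Matrix.det_smul, ← Matrix.eval_charpoly, Fintype.card_fin]
  have h2 := (IsAlgClosed.splits (U : Matrix (Fin N) (Fin N) ℂ).charpoly).eq_prod_roots_of_monic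
    (Matrix.charpoly_monic _)
  rw [h2, Polynomial.eval_multiset_prod, Multiset.map_map]
  have h3 : w ^ N = ((eigenvaluesU U).map fun _ => w).prod := by
    rw [Multiset.map_const', Multiset.prod_replicate, card_eigenvaluesU]
  rw [h3, eigenvaluesU, ← Multiset.prod_map_mul]
  congr 1
  refine Multiset.map_congr rfl fun z _ => ?_
  simp [mul_sub, hw]

/-- The eigenvalues lie on the unit circle. This is why the loop equations are derived for variables
in the open unit disc, where the resolvents are continuous in `U`. -/
theorem isUnit_det_one_sub_smul {N : ℕ} (U : Matrix.unitaryGroup (Fin N) ℂ) {w : ℂ}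
    (hw : ‖w‖ < 1) : IsUnit (1 - w • (U : Matrix (Fin N) (Fin N) ℂ)).det := by
  rw [det_one_sub_smul_eq_prod, isUnit_iff_ne_zero]
  apply Multiset.prod_ne_zero
  intro h
  obtain ⟨z, hz, h0⟩ := Multiset.mem_map.mp h
  have h1 : w * z = 1 := (sub_eq_zero.mp h0).symm
  have h2 : ‖w * z‖ = ‖w‖ := by rw [norm_mul, norm_eq_one_of_mem_eigenvaluesU U hz, mul_one]
  rw [h1, norm_one] at h2
  linarith

theorem isUnit_det_unitaryGroup {N : ℕ} (U : Matrix.unitaryGroup (Fin N) ℂ) :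
    IsUnit (U : Matrix (Fin N) (Fin N) ℂ).det :=
  Matrix.UnitaryGroup.det_isUnit U

/-- Logarithmic derivative of a finite product. -/
theorem HasDerivAt.finset_prod_log {𝕜 ι : Type*} [NontriviallyNormedField 𝕜] [NormedAlgebra 𝕜 ℂ]
    (s : Finset ι) {f : ι → 𝕜 → ℂ} {a : ι → ℂ} {t : 𝕜}
    (hf : ∀ i ∈ s, HasDerivAt (f i) (f i t * a i) t) :
    HasDerivAt (fun x => ∏ i ∈ s, f i x) ((∏ i ∈ s, f i t) * ∑ i ∈ s, a i) t := by
  classical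
  induction s using Finset.induction_on with
  | empty => simpa using hasDerivAt_const t (1 : ℂ)
  | insert i s hi ih =>
    have h1 := (hf i (Finset.mem_insert_self i s)).mul
      (ih fun j hj => hf j (Finset.mem_insert_of_mem hj))
    simp only [Finset.prod_insert hi, Finset.sum_insert hi]
    exact h1.congr_deriv (by ring)

/-! ### Loop equation for averages of characteristic polynomials. -/

section Loop

attribute [local instance] Matrix.linftyOpNormedRing Matrix.linftyOpNormedAlgebra

variable {N n : ℕ}

/-- The product `det(U)^{-k} ∏ det(1 - z_j U)`. -/
def charProd (k : ℕ) (z : Fin n → ℂ) (A : Matrix (Fin N) (Fin N) ℂ) : ℂ :=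
  (A.det)⁻¹ ^ k * ∏ i, (1 - z i • A).det

/-- The resolvent `(1 - wA)⁻¹`. -/
def resolv (w : ℂ) (A : Matrix (Fin N) (Fin N) ℂ) : Matrix (Fin N) (Fin N) ℂ := (1 - w • A)⁻¹

/-- The matrix `wA(1 - wA)⁻¹`. -/
def resolvQ (w : ℂ) (A : Matrix (Fin N) (Fin N) ℂ) : Matrix (Fin N) (Fin N) ℂ :=
  w • (A * resolv w A)

theorem resolvQ_eq {w : ℂ} {A : Matrix (Fin N) (Fin N) ℂ} (h : IsUnit (1 - w • A).det) :
    resolvQ w A = resolv w A - 1 := by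
  have h1 : (1 - w • A) * resolv w A = 1 := Matrix.mul_nonsing_inv _ h
  rw [sub_mul, one_mul, smul_mul_assoc] at h1
  rw [resolvQ, ← h1, sub_sub_cancel]

theorem trace_resolvQ {w : ℂ} {A : Matrix (Fin N) (Fin N) ℂ} (h : IsUnit (1 - w • A).det) :
    (resolv w A).trace = (resolvQ w A).trace + N := by
  rw [resolvQ_eq h, Matrix.trace_sub, Matrix.trace_one, Fintype.card_fin]; ring

/-- The resolvent identity in traced form. It replaces a trace of two resolvents by a difference of
single traces, and is the source of the coefficients `z_i / (z_i - z_j)` later. -/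
theorem trace_resolvQ_mul_resolv {v w : ℂ} {A : Matrix (Fin N) (Fin N) ℂ}
    (hv : IsUnit (1 - v • A).det) (hw : IsUnit (1 - w • A).det) :
    (v - w) * (resolvQ v A * resolv w A).trace =
      v * ((resolvQ v A).trace - (resolvQ w A).trace) := by
  have h : (v - w) • (resolvQ v A * resolv w A) = v • (resolvQ v A - resolvQ w A) := by
    have e1 : resolv v A - resolv w A = (v - w) • (resolv v A * A * resolv w A) := by
      have h1 : resolv v A * (1 - v • A) = 1 := Matrix.nonsing_inv_mul _ hv
      have h2 : (1 - w • A) * resolv w A = 1 := Matrix.mul_nonsing_inv _ hw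
      calc resolv v A - resolv w A
          = resolv v A * ((1 - w • A) * resolv w A) - resolv v A * (1 - v • A) * resolv w A := by
            rw [h1, h2, mul_one, one_mul]
        _ = (v - w) • (resolv v A * A * resolv w A) := by
            simp only [mul_sub, sub_mul, one_mul, mul_one, smul_mul_assoc, mul_smul_comm, mul_assoc,
              sub_smul]
            abel
    have e2 : resolv v A * A = A * resolv v A := by
      have h1 : resolv v A * (1 - v • A) = 1 := Matrix.nonsing_inv_mul _ hv
      have h2 : (1 - v • A) * resolv v A = 1 := Matrix.mul_nonsing_inv _ hv
      have c : A * (1 - v • A) = (1 - v • A) * A := by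
        simp [mul_sub, sub_mul]
      calc resolv v A * A = resolv v A * (A * (1 - v • A)) * resolv v A := by
            rw [mul_assoc, mul_assoc, h2, mul_one]
        _ = A * resolv v A := by rw [c, ← mul_assoc (resolv v A), h1, one_mul]
    rw [resolvQ_eq hv, resolvQ_eq hw, sub_sub_sub_cancel_right, e1, e2, ← resolvQ_eq hv, resolvQ,
      smul_mul_assoc, smul_comm]
  have := congrArg Matrix.trace h
  simpa [Matrix.trace_smul, Matrix.trace_sub] using this

theorem hasDerivAt_charProd {𝕜 : Type*} [NontriviallyNormedField 𝕜] [NormedAlgebra 𝕜 ℂ]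
    (k : ℕ) (z : Fin n → ℂ) {c : 𝕜 → Matrix (Fin N) (Fin N) ℂ} {X A : Matrix (Fin N) (Fin N) ℂ}
    {t : 𝕜} (hc : HasDerivAt c (X * A) t) (h0 : c t = A) (hA : IsUnit A.det)
    (hz : ∀ i, IsUnit (1 - z i • A).det) :
    HasDerivAt (fun s => charProd k z (c s))
      (charProd k z A * -(k * X.trace + ∑ i, (resolvQ (z i) A * X).trace)) t := by
  subst h0
  have h1 : HasDerivAt (fun s => ((c s).det)⁻¹ ^ k) (((c t).det)⁻¹ ^ k * -(k * X.trace)) t := by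
    have h2 : HasDerivAt (fun s => ((c s).det)⁻¹) (((c t).det)⁻¹ * -X.trace) t := by
      have h3 := (hc.matrix_det hA).fun_inv hA.ne_zero
      refine h3.congr_deriv ?_
      rw [Matrix.trace_mul_comm, mul_assoc, Matrix.mul_nonsing_inv _ hA, mul_one]
      have := hA.ne_zero
      field_simp
    have h3 := HasDerivAt.finset_prod_log (Finset.range k) (f := fun _ s => ((c s).det)⁻¹)
      (a := fun _ => -X.trace) (fun _ _ => h2)
    simpa using h3
  have h2 : ∀ i, HasDerivAt (fun s => (1 - z i • c s).det)
      ((1 - z i • c t).det * -(resolvQ (z i) (c t) * X).trace) t := by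
    intro i
    have h3 := ((hc.const_smul (z i)).const_sub 1).matrix_det (hz i)
    refine h3.congr_deriv ?_
    rw [Pi.smul_apply, resolvQ, resolv, mul_neg, Matrix.trace_neg, mul_smul_comm, smul_mul_assoc,
      Matrix.trace_smul, Matrix.trace_smul, ← mul_assoc, Matrix.trace_mul_comm, ← mul_assoc]
  have h3 := h1.fun_mul (HasDerivAt.finset_prod_log Finset.univ fun i _ => h2 i)
  unfold charProd
  refine h3.congr_deriv ?_
  rw [Finset.sum_neg_distrib]
  ring

theorem hasDerivAt_resolv {𝕜 : Type*} [NontriviallyNormedField 𝕜] [NormedAlgebra 𝕜 ℂ]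
    (w : ℂ) {c : 𝕜 → Matrix (Fin N) (Fin N) ℂ} {X A : Matrix (Fin N) (Fin N) ℂ}
    {t : 𝕜} (hc : HasDerivAt c (X * A) t) (h0 : c t = A) (hw : IsUnit (1 - w • A).det) :
    HasDerivAt (fun s => resolv w (c s)) (resolv w A * X * resolvQ w A) t := by
  subst h0
  have h3 := ((hc.const_smul w).const_sub 1).matrix_inv hw
  refine h3.congr_deriv ?_
  rw [Pi.smul_apply, resolvQ, resolv]
  simp [mul_assoc]

theorem continuous_resolv {w : ℂ} (hw : ‖w‖ < 1) :
    Continuous fun U : Matrix.unitaryGroup (Fin N) ℂ =>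
      resolv w (U : Matrix (Fin N) (Fin N) ℂ) := by
  have h : Continuous fun U : Matrix.unitaryGroup (Fin N) ℂ =>
      (1 - w • (U : Matrix (Fin N) (Fin N) ℂ)) := by fun_prop
  simp only [resolv, Matrix.inv_def, Ring.inverse_eq_inv']
  exact (h.matrix_det.inv₀ fun U => (isUnit_det_one_sub_smul U hw).ne_zero).smul h.matrix_adjugate

theorem continuous_charProd (k : ℕ) (z : Fin n → ℂ) :
    Continuous fun U : Matrix.unitaryGroup (Fin N) ℂ =>
      charProd k z (U : Matrix (Fin N) (Fin N) ℂ) := by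
  unfold charProd
  refine (Continuous.pow (Continuous.inv₀ ?_ fun U => (isUnit_det_unitaryGroup U).ne_zero) k).mul
    (continuous_finsetProd _ fun i _ => ?_)
  · exact continuous_subtype_val.matrix_det
  · have h : Continuous fun U : Matrix.unitaryGroup (Fin N) ℂ =>
      (1 - z i • (U : Matrix (Fin N) (Fin N) ℂ)) := by fun_prop
    exact h.matrix_det

/-- Every matrix is a complex combination of the skew-Hermitian matrices `X - Xᴴ` and `i(X + Xᴴ)`. A
complex-linear identity on the Lie algebra therefore extends to all matrices, in particular to the
matrix units. -/
theorem integral_haarU_eq_zero_of_skew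
    (f : Matrix (Fin N) (Fin N) ℂ →ₗ[ℂ] Matrix.unitaryGroup (Fin N) ℂ → ℂ)
    (hc : ∀ X, Continuous (f X)) (h : ∀ X, Xᴴ = -X → ∫ U, f X U ∂(haarU N) = 0)
    (X : Matrix (Fin N) (Fin N) ℂ) : ∫ U, f X U ∂(haarU N) = 0 := by
  have e : X = (1 / 2 : ℂ) • (X - Xᴴ) + (-Complex.I / 2) • (Complex.I • (X + Xᴴ)) := by
    rw [smul_smul, show -Complex.I / 2 * Complex.I = 1 / 2 by
      rw [neg_div, neg_mul, div_mul_eq_mul_div, Complex.I_mul_I]; ring, ← smul_add]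
    rw [show X - Xᴴ + (X + Xᴴ) = (2 : ℂ) • X by rw [two_smul]; abel, smul_smul]
    norm_num
  have h1 : (X - Xᴴ)ᴴ = -(X - Xᴴ) := by simp
  have h2 : (Complex.I • (X + Xᴴ))ᴴ = -(Complex.I • (X + Xᴴ)) := by
    simp [Matrix.conjTranspose_smul, add_comm]
  rw [e, map_add, map_smul, map_smul]
  simp only [Pi.add_apply, Pi.smul_apply, smul_eq_mul]
  rw [integral_add (((hc _).integrable_haarU).const_mul _) (((hc _).integrable_haarU).const_mul _),
    integral_const_mul, integral_const_mul, h _ h1, h _ h2]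
  simp

theorem continuous_resolvQ {w : ℂ} (hw : ‖w‖ < 1) :
    Continuous fun U : Matrix.unitaryGroup (Fin N) ℂ =>
      resolvQ w (U : Matrix (Fin N) (Fin N) ℂ) :=
  (continuous_subtype_val.mul (continuous_resolv hw)).const_smul w

/-- The logarithmic derivative of `charProd` along `X ↦ XA`. -/
def flowLog (k : ℕ) (z : Fin n → ℂ) (A : Matrix (Fin N) (Fin N) ℂ) :
    Matrix (Fin N) (Fin N) ℂ →ₗ[ℂ] ℂ :=
  -((k : ℂ) • Matrix.traceLinearMap (Fin N) ℂ ℂ +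
    ∑ i, Matrix.traceLinearMap (Fin N) ℂ ℂ ∘ₗ LinearMap.mulLeft ℂ (resolvQ (z i) A))

theorem flowLog_apply (k : ℕ) (z : Fin n → ℂ) (A X : Matrix (Fin N) (Fin N) ℂ) :
    flowLog k z A X = -(k * X.trace + ∑ i, (resolvQ (z i) A * X).trace) := by
  simp [flowLog]

theorem continuous_flowLog (k : ℕ) {z : Fin n → ℂ} (hz : ∀ i, ‖z i‖ < 1)
    (X : Matrix (Fin N) (Fin N) ℂ) :
    Continuous fun U : Matrix.unitaryGroup (Fin N) ℂ => flowLog k z U.1 X := by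
  simp only [flowLog_apply]
  exact (continuous_const.add (continuous_finsetSum _ fun i _ =>
      ((continuous_resolvQ (hz i)).mul continuous_const).matrix_trace)).neg

theorem hasDerivAt_expU_mul (X : Matrix (Fin N) (Fin N) ℂ) (hX : Xᴴ = -X)
    (U : Matrix.unitaryGroup (Fin N) ℂ) :
    HasDerivAt (fun t : ℝ => (expU X hX t * U).1) (X * U.1) 0 := by
  have h := Matrix.hasDerivAt_exp_smul_mul X U.1 0
  rw [zero_smul, NormedSpace.exp_zero, one_mul] at h
  exact h

theorem expU_zero_mul (X : Matrix (Fin N) (Fin N) ℂ) (hX : Xᴴ = -X)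
    (U : Matrix.unitaryGroup (Fin N) ℂ) : (expU X hX 0 * U).1 = U.1 := by
  simp [expU]

theorem hasDerivAt_charProd_expU (k : ℕ) {z : Fin n → ℂ} (hz : ∀ i, ‖z i‖ < 1)
    (X : Matrix (Fin N) (Fin N) ℂ) (hX : Xᴴ = -X) (U : Matrix.unitaryGroup (Fin N) ℂ) :
    HasDerivAt (fun t : ℝ => charProd k z (expU X hX t * U).1)
      (charProd k z U.1 * flowLog k z U.1 X) 0 := by
  rw [flowLog_apply]
  exact hasDerivAt_charProd k z (hasDerivAt_expU_mul X hX U) (expU_zero_mul X hX U)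
    (isUnit_det_unitaryGroup U) fun i => isUnit_det_one_sub_smul U (hz i)

theorem integral_charProd_flow (k : ℕ) {z : Fin n → ℂ} (hz : ∀ i, ‖z i‖ < 1)
    (X : Matrix (Fin N) (Fin N) ℂ) :
    ∫ U : Matrix.unitaryGroup (Fin N) ℂ, charProd k z U.1 * flowLog k z U.1 X ∂(haarU N) = 0 := by
  have hcont : ∀ X : Matrix (Fin N) (Fin N) ℂ, Continuous fun U : Matrix.unitaryGroup (Fin N) ℂ =>
      charProd k z U.1 * flowLog k z U.1 X := fun X =>
    (continuous_charProd k z).mul (continuous_flowLog k hz X)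
  exact integral_haarU_eq_zero_of_skew
    (LinearMap.pi fun U => charProd k z U.1 • flowLog k z U.1) hcont
    (fun X hX => integral_haarU_flow_deriv_eq_zero X hX (fun U => charProd k z U.1) _
      (continuous_charProd k z) (hcont X) fun U => hasDerivAt_charProd_expU k hz X hX U) X

theorem integral_charProd_mul_resolv_flow (k : ℕ) {z : Fin n → ℂ} (hz : ∀ i, ‖z i‖ < 1)
    {w : ℂ} (hw : ‖w‖ < 1) (a b : Fin N) (X : Matrix (Fin N) (Fin N) ℂ) :
    ∫ U : Matrix.unitaryGroup (Fin N) ℂ, (charProd k z U.1 * resolv w U.1 a b * flowLog k z U.1 X +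
      charProd k z U.1 * (resolv w U.1 * X * resolvQ w U.1) a b) ∂(haarU N) = 0 := by
  have hcont : ∀ X : Matrix (Fin N) (Fin N) ℂ, Continuous fun U : Matrix.unitaryGroup (Fin N) ℂ =>
      (charProd k z U.1 * resolv w U.1 a b * flowLog k z U.1 X +
      charProd k z U.1 * (resolv w U.1 * X * resolvQ w U.1) a b) := fun X =>
    (((continuous_charProd k z).mul ((continuous_resolv hw).matrix_elem a b)).mul
      (continuous_flowLog k hz X)).add ((continuous_charProd k z).mul
      ((((continuous_resolv hw).mul continuous_const).mul (continuous_resolvQ hw)).matrix_elem a b))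
  refine integral_haarU_eq_zero_of_skew
    (LinearMap.pi fun U => (charProd k z U.1 * resolv w U.1 a b) • flowLog k z U.1 +
      charProd k z U.1 • (Matrix.entryLinearMap ℂ ℂ a b ∘ₗ
        LinearMap.mulRight ℂ (resolvQ w U.1) ∘ₗ LinearMap.mulLeft ℂ (resolv w U.1)))
      hcont (fun X hX => integral_haarU_flow_deriv_eq_zero X hX
      (fun U => charProd k z U.1 * resolv w U.1 a b) _
      ((continuous_charProd k z).mul ((continuous_resolv hw).matrix_elem a b)) (hcont X)
      fun U => ?_) X
  have h3 := (hasDerivAt_charProd_expU k hz X hX U).fun_mul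
    ((hasDerivAt_resolv w (hasDerivAt_expU_mul X hX U) (expU_zero_mul X hX U)
      (isUnit_det_one_sub_smul U hw)).matrix_entry a b)
  refine h3.congr_deriv ?_
  rw [expU_zero_mul]
  change _ = charProd k z U.1 * resolv w U.1 a b * flowLog k z U.1 X +
      charProd k z U.1 * (resolv w U.1 * X * resolvQ w U.1) a b
  ring

/-- With the next lemma, this contracts the flow identities over all matrix units. -/
theorem Matrix.sum_sum_trace_mul_single (Q R : Matrix (Fin N) (Fin N) ℂ) :
    ∑ a : Fin N, ∑ b : Fin N, R a b * (Q * Matrix.single a b (1 : ℂ)).trace = (Q * R).trace := by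
  rw [Matrix.trace_mul_comm Q R]
  simp only [Matrix.trace_mul_comm Q]
  simp [Matrix.trace, Matrix.mul_apply, Matrix.single_apply, ite_and]

theorem Matrix.sum_sum_mul_single_mul (Q R : Matrix (Fin N) (Fin N) ℂ) :
    ∑ a : Fin N, ∑ b : Fin N, (R * Matrix.single a b (1 : ℂ) * Q : Matrix _ _ ℂ) a b = R.trace * Q.trace := by
  simp only [Matrix.trace, Matrix.diag, Finset.sum_mul_sum]
  refine Finset.sum_congr rfl fun i _ => Finset.sum_congr rfl fun j _ => ?_
  simp [Matrix.mul_apply, Matrix.single_apply, Finset.sum_ite_eq, ite_and]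

/-- The loop equation for averages of products of characteristic polynomials. -/
theorem integral_charProd_loop (k : ℕ) {z : Fin n → ℂ} (hz : ∀ i, ‖z i‖ < 1)
    {w : ℂ} (hw : ‖w‖ < 1) :
    ∫ U : Matrix.unitaryGroup (Fin N) ℂ, charProd k z U.1 *
      ((resolv w U.1).trace * (resolvQ w U.1).trace - k * (resolv w U.1).trace -
        ∑ i, (resolvQ (z i) U.1 * resolv w U.1).trace) ∂(haarU N) = 0 := by
  -- The loop equation is the sum over `a, b` of the flow identities for the function `charProd ·
  -- R_{ab}`, with `R` the resolvent, in the direction of the matrix unit `E_{ab}`.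
  have e : ∀ U : Matrix.unitaryGroup (Fin N) ℂ, charProd k z U.1 *
      ((resolv w U.1).trace * (resolvQ w U.1).trace - k * (resolv w U.1).trace -
        ∑ i, (resolvQ (z i) U.1 * resolv w U.1).trace) =
      ∑ a : Fin N, ∑ b : Fin N, (charProd k z U.1 * resolv w U.1 a b * flowLog k z U.1 (Matrix.single a b (1 : ℂ)) +
      charProd k z U.1 * (resolv w U.1 * Matrix.single a b (1 : ℂ) * resolvQ w U.1) a b) := by
    intro U
    simp only [Finset.sum_add_distrib, mul_assoc (charProd k z U.1), ← Finset.mul_sum]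
    rw [← mul_add]
    congr 1
    have h1 := Matrix.sum_sum_mul_single_mul (resolvQ w U.1) (resolv w U.1)
    simp only [mul_assoc] at h1
    simp only [mul_assoc]
    rw [h1]
    have h2 : ∑ a : Fin N, ∑ b : Fin N, resolv w U.1 a b * flowLog k z U.1 (Matrix.single a b (1 : ℂ)) =
        -(k * ∑ a : Fin N, ∑ b : Fin N, resolv w U.1 a b * (1 * Matrix.single a b (1 : ℂ)).trace +
          ∑ i, ∑ a : Fin N, ∑ b : Fin N, resolv w U.1 a b *
            (resolvQ (z i) U.1 * Matrix.single a b (1 : ℂ)).trace) := by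
      rw [Finset.sum_comm (s := (Finset.univ : Finset (Fin n)))]
      simp only [Finset.sum_comm (s := (Finset.univ : Finset (Fin n))), flowLog_apply, one_mul,
        Finset.mul_sum, mul_neg, mul_add, Finset.sum_neg_distrib, Finset.sum_add_distrib]
      congr 2
      exact Finset.sum_congr rfl fun i _ => Finset.sum_congr rfl fun j _ => by ring
    rw [h2]
    simp only [Matrix.sum_sum_trace_mul_single]
    rw [one_mul]
    ring
  simp only [e]
  have hi : ∀ a b, Integrable (fun U : Matrix.unitaryGroup (Fin N) ℂ =>
      charProd k z U.1 * resolv w U.1 a b * flowLog k z U.1 (Matrix.single a b (1 : ℂ)) +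
      charProd k z U.1 * (resolv w U.1 * Matrix.single a b (1 : ℂ) * resolvQ w U.1) a b)
      (haarU N) := fun a b => Continuous.integrable_haarU
    ((((continuous_charProd k z).mul ((continuous_resolv hw).matrix_elem a b)).mul
      (continuous_flowLog k hz _)).add ((continuous_charProd k z).mul
      ((((continuous_resolv hw).mul continuous_const).mul (continuous_resolvQ hw)).matrix_elem a b)))
  rw [integral_finsetSum _ fun a _ => integrable_finsetSum _ fun b _ => hi a b]
  refine Finset.sum_eq_zero fun a _ => ?_
  rw [integral_finsetSum _ fun b _ => hi a b]
  exact Finset.sum_eq_zero fun b _ => integral_charProd_mul_resolv_flow k hz hw a b _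

end Loop

/-! ### Euler derivatives of `det(1 - wA)` as resolvent traces. -/

section EvalDerivatives

attribute [local instance] Matrix.linftyOpNormedRing Matrix.linftyOpNormedAlgebra

variable {N : ℕ}

theorem eval_charpolyRev_eq_det (A : Matrix (Fin N) (Fin N) ℂ) (w : ℂ) :
    A.charpolyRev.eval w = (1 - w • A).det := by
  rw [Matrix.charpolyRev, ← Polynomial.coe_evalRingHom, RingHom.map_det]
  congr 1
  ext i j
  by_cases hij : i = j <;> simp [hij, mul_comm w]

/-- The Euler operator `X d/dX`. -/
def Polynomial.eulerOp (p : Polynomial ℂ) : Polynomial ℂ := Polynomial.X * p.derivative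

theorem hasDerivAt_det_one_sub_smul {A : Matrix (Fin N) (Fin N) ℂ} {w : ℂ}
    (hw : IsUnit (1 - w • A).det) :
    HasDerivAt (fun s : ℂ => (1 - s • A).det) ((1 - w • A).det * -(A * resolv w A).trace) w := by
  have h1 : HasDerivAt (fun s : ℂ => 1 - s • A) (-A) w := by
    have h := ((hasDerivAt_id w).smul_const A).const_sub 1
    rw [one_smul] at h
    exact h
  refine (h1.matrix_det hw).congr_deriv ?_
  rw [mul_neg, Matrix.trace_neg, Matrix.trace_mul_comm, resolv]

/-- This and the second-order version below are the dictionary that turns the traces of the loop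
equation into differential operators. -/
theorem eval_eulerOp_charpolyRev {A : Matrix (Fin N) (Fin N) ℂ} {w : ℂ}
    (hw : IsUnit (1 - w • A).det) :
    A.charpolyRev.eulerOp.eval w = (1 - w • A).det * -(resolvQ w A).trace := by
  have h1 := A.charpolyRev.hasDerivAt w
  have h2 := hasDerivAt_det_one_sub_smul hw
  simp only [eval_charpolyRev_eq_det] at h1
  rw [Polynomial.eulerOp, Polynomial.eval_mul, Polynomial.eval_X, h1.unique h2, resolvQ,
    Matrix.trace_smul, smul_eq_mul]
  ring

theorem eval_eulerOp_eulerOp_charpolyRev {A : Matrix (Fin N) (Fin N) ℂ} {w : ℂ}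
    (hw : IsUnit (1 - w • A).det) :
    A.charpolyRev.eulerOp.eulerOp.eval w = (1 - w • A).det *
      ((resolvQ w A).trace ^ 2 - (resolvQ w A * resolv w A).trace) := by
  have h1 : HasDerivAt (fun s : ℂ => 1 - s • A) (-A) w := by
    have h := ((hasDerivAt_id w).smul_const A).const_sub 1
    rw [one_smul] at h
    exact h
  have h2 := ((h1.matrix_inv hw).const_mul A).matrix_trace
  have h3 := (hasDerivAt_id w).fun_mul h2
  have h4 := (hasDerivAt_det_one_sub_smul hw).fun_mul h3.neg
  have h5 := A.charpolyRev.eulerOp.hasDerivAt w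
  have hev : ∀ᶠ s in 𝓝 w, IsUnit (1 - s • A).det := by
    have hc : Continuous fun s : ℂ => (1 - s • A).det := by
      have : Continuous fun s : ℂ => 1 - s • A := by fun_prop
      exact this.matrix_det
    filter_upwards [hc.continuousAt.eventually_ne hw.ne_zero] with s hs
    exact isUnit_iff_ne_zero.mpr hs
  have h6 := h5.congr_of_eventuallyEq (f₁ := fun s : ℂ => (1 - s • A).det *
      -(s * (A * (1 - s • A)⁻¹).trace)) (by
    filter_upwards [hev] with s hs
    rw [eval_eulerOp_charpolyRev hs, resolvQ, Matrix.trace_smul, resolv, smul_eq_mul])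
  rw [Polynomial.eulerOp, Polynomial.eval_mul, Polynomial.eval_X, h6.unique h4]
  have e : (resolvQ w A * resolv w A).trace =
      w * ((A * resolv w A).trace + w * (A * (resolv w A * A * resolv w A)).trace) := by
    have : resolvQ w A * resolv w A =
      w • (A * resolv w A + w • (A * (resolv w A * A * resolv w A))) := by
      have h : resolv w A = 1 + w • (A * resolv w A) := by
        have := resolvQ_eq hw
        rw [resolvQ] at this
        rw [this]; abel
      calc resolvQ w A * resolv w A = resolvQ w A * (1 + w • (A * resolv w A)) := by rw [← h]
        _ = _ := by rw [mul_add, mul_one, resolvQ]; simp [mul_assoc, smul_add]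
    rw [this]
    simp [Matrix.trace_smul, Matrix.trace_add, mul_add]
  rw [e]
  simp only [resolvQ, resolv, Matrix.trace_smul, smul_eq_mul, Pi.neg_apply, id, mul_neg, neg_mul,
    neg_neg, mul_assoc]
  ring

end EvalDerivatives

/-! ### Continuity and degree of the reversed characteristic polynomial. -/

section Coefficients

variable {N : ℕ}

theorem Polynomial.continuous_coeff_prod {α ι : Type*} [TopologicalSpace α] (s : Finset ι)
    (p : ι → α → Polynomial ℂ) (h : ∀ i ∈ s, ∀ r, Continuous fun a => (p i a).coeff r) :
    ∀ r, Continuous fun a => (∏ i ∈ s, p i a).coeff r := by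
  classical
  induction s using Finset.induction_on with
  | empty => intro r; simpa using continuous_const
  | insert i s hi ih =>
    intro r
    simp only [Finset.prod_insert hi, Polynomial.coeff_mul]
    exact continuous_finsetSum _ fun x _ => (h i (Finset.mem_insert_self i s) _).mul
      (ih (fun j hj => h j (Finset.mem_insert_of_mem hj)) _)

theorem continuous_coeff_charpolyRev (r : ℕ) :
    Continuous fun A : Matrix (Fin N) (Fin N) ℂ => A.charpolyRev.coeff r := by
  simp only [Matrix.charpolyRev, Matrix.det_apply, Polynomial.finsetSum_coeff,
    Polynomial.coeff_smul]
  refine continuous_finsetSum _ fun σ _ => Continuous.const_smul ?_ _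
  refine Polynomial.continuous_coeff_prod Finset.univ (fun i (A : Matrix (Fin N) (Fin N) ℂ) =>
    (1 - (Polynomial.X : Polynomial ℂ) • A.map Polynomial.C) (σ i) i) (fun i _ r => ?_) r
  simp only [Matrix.sub_apply, Matrix.smul_apply, Matrix.map_apply, smul_eq_mul,
    Polynomial.coeff_sub, Polynomial.coeff_mul_C]
  exact continuous_const.sub (continuous_const.mul (continuous_id.matrix_elem _ _))

theorem natDegree_charpolyRev_le (A : Matrix (Fin N) (Fin N) ℂ) :
    A.charpolyRev.natDegree ≤ N := by
  rw [← Matrix.reverse_charpoly]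
  refine (Polynomial.reverse_natDegree_le _).trans ?_
  rw [Matrix.charpoly_natDegree_eq_dim, Fintype.card_fin]

end Coefficients

/-! ### The average as a polynomial in several variables. -/

section MvPoly

variable {N n : ℕ}

/-- The product `∏ g_i(X_i)` of univariate polynomials in separate variables. -/
def sepProd (g : Fin n → Polynomial ℂ) : MvPolynomial (Fin n) ℂ :=
  ∏ i, Polynomial.aeval (MvPolynomial.X i) (g i)

/-- The Euler operator `X_j ∂_j`. -/
def eulerD (j : Fin n) : Derivation ℂ (MvPolynomial (Fin n) ℂ) (MvPolynomial (Fin n) ℂ) :=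
  (MvPolynomial.X j : MvPolynomial (Fin n) ℂ) • MvPolynomial.pderiv j

theorem eulerD_sepProd (g : Fin n → Polynomial ℂ) (j : Fin n) :
    eulerD j (sepProd g) = sepProd (Function.update g j (g j).eulerOp) := by
  have h : ∀ g : Fin n → Polynomial ℂ, sepProd g = Polynomial.aeval (MvPolynomial.X j) (g j) *
      ∏ i ∈ Finset.univ.erase j, Polynomial.aeval (MvPolynomial.X i) (g i) := fun g =>
    (Finset.mul_prod_erase Finset.univ _ (Finset.mem_univ j)).symm
  have h0 : eulerD j (∏ i ∈ Finset.univ.erase j,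
      Polynomial.aeval (MvPolynomial.X i : MvPolynomial (Fin n) ℂ) (g i)) = 0 := by
    refine Finset.prod_induction _ (fun p => eulerD j p = 0) ?_ ?_ ?_
    · intro a b ha hb
      rw [Derivation.leibniz, ha, hb]; simp
    · exact Derivation.map_one_eq_zero _
    · intro i hi
      rw [Derivation.map_aeval]
      simp [eulerD, MvPolynomial.pderiv_X, (Finset.mem_erase.mp hi).1.symm]
  rw [h g, h, Derivation.leibniz, h0, Derivation.map_aeval]
  have e : ∏ i ∈ Finset.univ.erase j, Polynomial.aeval (MvPolynomial.X i : MvPolynomial (Fin n) ℂ)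
      (Function.update g j (g j).eulerOp i) = ∏ i ∈ Finset.univ.erase j,
      Polynomial.aeval (MvPolynomial.X i : MvPolynomial (Fin n) ℂ) (g i) :=
    Finset.prod_congr rfl fun i hi => by
      rw [Function.update_of_ne (Finset.mem_erase.mp hi).1]
  rw [e, Function.update_self, Polynomial.eulerOp]
  simp [eulerD]
  ring

theorem eval_sepProd (g : Fin n → Polynomial ℂ) (z : Fin n → ℂ) :
    MvPolynomial.eval z (sepProd g) = ∏ i, (g i).eval (z i) := by
  rw [sepProd, map_prod]
  refine Finset.prod_congr rfl fun i _ => ?_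
  rw [← MvPolynomial.coe_aeval_eq_eval, RingHom.coe_coe, ← Polynomial.aeval_algHom_apply]
  simp [Polynomial.coe_aeval_eq_eval]

/-- `det(A)^{-k} ∏ det(1 - X_j A)` as a polynomial. -/
def charProdPoly (k n : ℕ) (A : Matrix (Fin N) (Fin N) ℂ) : MvPolynomial (Fin n) ℂ :=
  (A.det)⁻¹ ^ k • sepProd fun _ => A.charpolyRev

theorem eval_charProdPoly (k : ℕ) (A : Matrix (Fin N) (Fin N) ℂ) (z : Fin n → ℂ) :
    MvPolynomial.eval z (charProdPoly k n A) = charProd k z A := by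
  simp [charProdPoly, charProd, MvPolynomial.smul_eval, eval_sepProd, eval_charpolyRev_eq_det]

theorem eval_sepProd_update (g : Fin n → Polynomial ℂ) (j : Fin n) (p : Polynomial ℂ)
    (z : Fin n → ℂ) (c : ℂ) (h : p.eval (z j) = (g j).eval (z j) * c) :
    MvPolynomial.eval z (sepProd (Function.update g j p)) =
      MvPolynomial.eval z (sepProd g) * c := by
  rw [eval_sepProd, eval_sepProd, ← Finset.mul_prod_erase Finset.univ _ (Finset.mem_univ j),
    ← Finset.mul_prod_erase Finset.univ (fun i => (g i).eval (z i)) (Finset.mem_univ j),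
    Function.update_self, h]
  rw [Finset.prod_congr rfl fun i hi => by
      rw [Function.update_of_ne (Finset.mem_erase.mp hi).1]]
  ring

theorem eval_eulerD_charProdPoly (k : ℕ) {A : Matrix (Fin N) (Fin N) ℂ} {z : Fin n → ℂ}
    (j : Fin n) (hz : IsUnit (1 - z j • A).det) :
    MvPolynomial.eval z (eulerD j (charProdPoly k n A)) =
      charProd k z A * -(resolvQ (z j) A).trace := by
  rw [← eval_charProdPoly, charProdPoly, Derivation.map_smul, eulerD_sepProd,
    MvPolynomial.smul_eval, MvPolynomial.smul_eval, eval_sepProd_update _ _ _ _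
      (-(resolvQ (z j) A).trace), mul_assoc]
  rw [eval_eulerOp_charpolyRev hz, eval_charpolyRev_eq_det]

theorem eval_eulerD_eulerD_charProdPoly (k : ℕ) {A : Matrix (Fin N) (Fin N) ℂ} {z : Fin n → ℂ}
    (j : Fin n) (hz : IsUnit (1 - z j • A).det) :
    MvPolynomial.eval z (eulerD j (eulerD j (charProdPoly k n A))) =
      charProd k z A *
        ((resolvQ (z j) A).trace ^ 2 - (resolvQ (z j) A * resolv (z j) A).trace) := by
  rw [← eval_charProdPoly, charProdPoly, Derivation.map_smul, Derivation.map_smul, eulerD_sepProd,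
    eulerD_sepProd, Function.update_idem, Function.update_self,
    MvPolynomial.smul_eval, MvPolynomial.smul_eval, eval_sepProd_update _ _ _ _
      ((resolvQ (z j) A).trace ^ 2 - (resolvQ (z j) A * resolv (z j) A).trace), mul_assoc]
  rw [eval_eulerOp_eulerOp_charpolyRev hz, eval_charpolyRev_eq_det]

/-- The average of `det(U)^{-k} ∏ det(1 - X_j U)` over the unitary group. -/
def avgPoly (N k n : ℕ) : MvPolynomial (Fin n) ℂ :=
  ∑ r ∈ Fintype.piFinset fun _ : Fin n => Finset.range (N + 1),
    (∫ U : Matrix.unitaryGroup (Fin N) ℂ, (U.1.det)⁻¹ ^ k * ∏ i, U.1.charpolyRev.coeff (r i)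
      ∂(haarU N)) • ∏ i, (MvPolynomial.X i : MvPolynomial (Fin n) ℂ) ^ r i

theorem charProdPoly_eq_sum (k : ℕ) (A : Matrix (Fin N) (Fin N) ℂ) :
    charProdPoly k n A = ∑ r ∈ Fintype.piFinset fun _ : Fin n => Finset.range (N + 1),
      ((A.det)⁻¹ ^ k * ∏ i, A.charpolyRev.coeff (r i)) •
        ∏ i, (MvPolynomial.X i : MvPolynomial (Fin n) ℂ) ^ r i := by
  have h : ∀ i : Fin n, Polynomial.aeval (MvPolynomial.X i : MvPolynomial (Fin n) ℂ)
      A.charpolyRev = ∑ r ∈ Finset.range (N + 1),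
        A.charpolyRev.coeff r • (MvPolynomial.X i : MvPolynomial (Fin n) ℂ) ^ r := fun i =>
    Polynomial.aeval_eq_sum_range' (Nat.lt_succ_of_le (natDegree_charpolyRev_le A)) _
  simp only [charProdPoly, sepProd, h, Finset.prod_univ_sum, Finset.smul_sum, mul_smul]
  refine Finset.sum_congr rfl fun r _ => ?_
  rw [Finset.prod_smul]

theorem continuous_charProdPoly_coeff (k : ℕ) (r : Fin n → ℕ) :
    Continuous fun U : Matrix.unitaryGroup (Fin N) ℂ =>
      (U.1.det)⁻¹ ^ k * ∏ i, U.1.charpolyRev.coeff (r i) := by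
  refine (Continuous.pow (Continuous.inv₀ ?_ fun U => (isUnit_det_unitaryGroup U).ne_zero) k).mul
    (continuous_finsetProd _ fun i _ =>
      (continuous_coeff_charpolyRev (r i)).comp continuous_subtype_val)
  exact continuous_subtype_val.matrix_det

/-- The average is taken coefficient by coefficient over a finite set of monomials, so every linear
functional commutes with it. Identities valid for each `U` pass to the average this way, both for
Euler operators and for coefficient extraction later. -/
theorem linearMap_avgPoly (k : ℕ) (l : MvPolynomial (Fin n) ℂ →ₗ[ℂ] ℂ) :
    l (avgPoly N k n) =
      ∫ U : Matrix.unitaryGroup (Fin N) ℂ, l (charProdPoly k n U.1) ∂(haarU N) := by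
  simp only [charProdPoly_eq_sum, avgPoly, map_sum, map_smul, smul_eq_mul]
  rw [integral_finsetSum _ fun r _ => (((continuous_charProdPoly_coeff k r).integrable_haarU).mul_const
    _)]
  exact Finset.sum_congr rfl fun r _ => (integral_mul_const _ _).symm

end MvPoly

/-! ### Eigenfunction equations for Vandermonde times average. -/

section LoopPoly

variable {N n : ℕ}

/-- The flow identity in the direction of the identity matrix, that is, invariance under scalar
phases. It says that the average is homogeneous of degree `kN`. -/
theorem eval_sum_eulerD_avgPoly (k : ℕ) {z : Fin n → ℂ} (hz : ∀ i, ‖z i‖ < 1) :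
    ∑ j, MvPolynomial.eval z (eulerD j (avgPoly N k n)) =
      k * N * MvPolynomial.eval z (avgPoly N k n) := by
  let l : MvPolynomial (Fin n) ℂ →ₗ[ℂ] ℂ :=
    ∑ j, (MvPolynomial.aeval z).toLinearMap ∘ₗ (eulerD j).toLinearMap -
      ((k : ℂ) * N) • (MvPolynomial.aeval z).toLinearMap
  have hl : ∀ p, l p = ∑ j, MvPolynomial.eval z (eulerD j p) - k * N * MvPolynomial.eval z p := by
    intro p
    simp [l, MvPolynomial.aeval_eq_eval]
  rw [← sub_eq_zero, ← hl, linearMap_avgPoly, ← integral_charProd_flow k hz (1 : Matrix (Fin N) (Fin N) ℂ)]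
  refine integral_congr_ae (Eventually.of_forall fun U => ?_)
  simp only [hl, eval_charProdPoly, flowLog_apply,
    fun j => eval_eulerD_charProdPoly k j (isUnit_det_one_sub_smul U (hz j)), ← Finset.mul_sum,
    Finset.sum_neg_distrib, mul_one, Matrix.trace_one, Fintype.card_fin]
  ring

/-- The loop equation at `w = z_j`. The term `i = j` joins the squared trace to form the second
Euler derivative; the resolvent identity handles the others, which needs distinct `z_i`. -/
theorem eval_loop_avgPoly (k : ℕ) {z : Fin n → ℂ} (hz : ∀ i, ‖z i‖ < 1)
    (hinj : Function.Injective z) (j : Fin n) :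
    MvPolynomial.eval z (eulerD j (eulerD j (avgPoly N k n))) =
      ((N : ℂ) - k) * MvPolynomial.eval z (eulerD j (avgPoly N k n)) +
      k * N * MvPolynomial.eval z (avgPoly N k n) -
      ∑ i ∈ {j}ᶜ, z i / (z i - z j) * (MvPolynomial.eval z (eulerD i (avgPoly N k n)) -
        MvPolynomial.eval z (eulerD j (avgPoly N k n))) := by
  let ev : MvPolynomial (Fin n) ℂ →ₗ[ℂ] ℂ := (MvPolynomial.aeval z).toLinearMap
  let d : Fin n → MvPolynomial (Fin n) ℂ →ₗ[ℂ] MvPolynomial (Fin n) ℂ :=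
    fun j => (eulerD j).toLinearMap
  let l : MvPolynomial (Fin n) ℂ →ₗ[ℂ] ℂ :=
    ev ∘ₗ d j ∘ₗ d j - (((N : ℂ) - k) • (ev ∘ₗ d j) + ((k : ℂ) * N) • ev -
      ∑ i ∈ {j}ᶜ, (z i / (z i - z j)) • (ev ∘ₗ d i - ev ∘ₗ d j))
  have hl : ∀ p, l p = MvPolynomial.eval z (eulerD j (eulerD j p)) -
      (((N : ℂ) - k) * MvPolynomial.eval z (eulerD j p) + k * N * MvPolynomial.eval z p -
      ∑ i ∈ {j}ᶜ, z i / (z i - z j) * (MvPolynomial.eval z (eulerD i p) -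
        MvPolynomial.eval z (eulerD j p))) := by
    intro p
    simp [l, ev, d, MvPolynomial.aeval_eq_eval]
  rw [← sub_eq_zero, ← hl, linearMap_avgPoly, ← integral_charProd_loop k hz (hz j)]
  refine integral_congr_ae (Eventually.of_forall fun U => ?_)
  have hu := fun j => isUnit_det_one_sub_smul U (hz j)
  have hQ : ∀ i ∈ ({j}ᶜ : Finset (Fin n)), (resolvQ (z i) U.1 * resolv (z j) U.1).trace =
      z i / (z i - z j) * ((resolvQ (z i) U.1).trace - (resolvQ (z j) U.1).trace) := by
    intro i hi
    have hij : z i - z j ≠ 0 := sub_ne_zero.mpr fun h => by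
      rw [hinj h] at hi; simp at hi
    have := trace_resolvQ_mul_resolv (hu i) (hu j)
    field_simp
    linear_combination this
  have hs : ∑ i, (resolvQ (z i) U.1 * resolv (z j) U.1).trace =
      (resolvQ (z j) U.1 * resolv (z j) U.1).trace + ∑ i ∈ {j}ᶜ,
        z i / (z i - z j) * ((resolvQ (z i) U.1).trace - (resolvQ (z j) U.1).trace) := by
    rw [Fintype.sum_eq_add_sum_compl j, Finset.sum_congr rfl hQ]
  simp only [hl, eval_charProdPoly, eval_eulerD_eulerD_charProdPoly k j (hu j),
    fun j => eval_eulerD_charProdPoly k j (hu j), hs, trace_resolvQ (hu j)]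
  have e : ∑ i ∈ {j}ᶜ, z i / (z i - z j) * (charProd k z U.1 * -(resolvQ (z i) U.1).trace -
      charProd k z U.1 * -(resolvQ (z j) U.1).trace) = -(charProd k z U.1 * ∑ i ∈ {j}ᶜ,
        z i / (z i - z j) * ((resolvQ (z i) U.1).trace - (resolvQ (z j) U.1).trace)) := by
    rw [Finset.mul_sum, ← Finset.sum_neg_distrib]
    exact Finset.sum_congr rfl fun i _ => by ring
  rw [e]
  ring

/-- The Vandermonde polynomial. -/
def vdm (n : ℕ) : MvPolynomial (Fin n) ℂ :=
  (Matrix.vandermonde fun i => (MvPolynomial.X i : MvPolynomial (Fin n) ℂ)).det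

theorem eval_vdm (z : Fin n → ℂ) :
    MvPolynomial.eval z (vdm n) = (Matrix.vandermonde z).det := by
  simp [vdm, Matrix.det_vandermonde, map_prod]

theorem vdm_ne_zero (n : ℕ) : vdm n ≠ 0 :=
  Matrix.det_vandermonde_ne_zero_iff.mpr (MvPolynomial.X_injective)

/-- Multiplying by the Vandermonde polynomial makes the points with coinciding coordinates harmless;
equality on a product of infinite sets then suffices. -/
theorem eq_of_eval_eq_on_ball {p q : MvPolynomial (Fin n) ℂ}
    (h : ∀ z : Fin n → ℂ, (∀ i, ‖z i‖ < 1) → Function.Injective z →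
      MvPolynomial.eval z p = MvPolynomial.eval z q) : p = q := by
  refine mul_right_cancel₀ (vdm_ne_zero n) ?_
  refine MvPolynomial.funext_set (fun _ => Metric.ball (0 : ℂ) 1) (fun _ => ?_) fun z hz => ?_
  · exact infinite_of_mem_nhds (0 : ℂ) (Metric.ball_mem_nhds 0 one_pos)
  · rw [map_mul, map_mul]
    by_cases hi : Function.Injective z
    · rw [h z (fun i => by simpa using hz i trivial) hi]
    · have : MvPolynomial.eval z (vdm n) = 0 := by
        rw [eval_vdm]
        by_contra h0
        exact hi (Matrix.det_vandermonde_ne_zero_iff.mp h0)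
      rw [this, mul_zero, mul_zero]

theorem sum_eulerD_avgPoly (k : ℕ) :
    ∑ j, eulerD j (avgPoly N k n) = ((k : ℂ) * N) • avgPoly N k n := by
  refine eq_of_eval_eq_on_ball fun z hz _ => ?_
  rw [map_sum, eval_sum_eulerD_avgPoly k hz, MvPolynomial.smul_eval]

/-- Monomials are eigenvectors, so eigenfunction equations become conditions on exponents. -/
theorem coeff_eulerD (j : Fin n) (p : MvPolynomial (Fin n) ℂ) (m : Fin n →₀ ℕ) :
    (eulerD j p).coeff m = m j * p.coeff m := by
  classical
  induction p using MvPolynomial.induction_on' with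
  | add p q hp hq => rw [map_add, MvPolynomial.coeff_add, hp, hq, MvPolynomial.coeff_add]; ring
  | monomial u a =>
    have : eulerD j (MvPolynomial.monomial u a) = u j • MvPolynomial.monomial u a :=
      MvPolynomial.X_mul_pderiv_monomial
    rw [this, MvPolynomial.coeff_smul, MvPolynomial.coeff_monomial]
    split_ifs with h
    · simp [h]
    · simp

/-- The alternant `det [X_i ^ l_j]`. -/
def altPoly (l : Fin n → ℕ) : MvPolynomial (Fin n) ℂ :=
  (Matrix.of fun i j => (MvPolynomial.X i : MvPolynomial (Fin n) ℂ) ^ l j).det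

theorem coeff_altPoly (l : Fin n → ℕ) (m : Fin n →₀ ℕ) :
    (altPoly l).coeff m = ∑ σ : Equiv.Perm (Fin n),
      if (∀ i, m i = l (σ i)) then ((Equiv.Perm.sign σ : ℤ) : ℂ) else 0 := by
  classical
  rw [altPoly, ← Matrix.det_transpose, Matrix.det_apply', MvPolynomial.coeff_sum]
  refine Finset.sum_congr rfl fun σ _ => ?_
  have h1 : ∏ i, (Matrix.of fun i j => (MvPolynomial.X i : MvPolynomial (Fin n) ℂ) ^ l j)ᵀ (σ i) i =
      MvPolynomial.monomial (Finsupp.equivFunOnFinite.symm fun i => l (σ i)) (1 : ℂ) := by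
    rw [MvPolynomial.monomial_eq, Finsupp.prod_fintype _ _ (by simp)]
    simp
  have h2 : (Finsupp.equivFunOnFinite.symm fun i => l (σ i)) = m ↔ ∀ i, m i = l (σ i) := by
    rw [DFunLike.ext_iff]
    exact forall_congr' fun i => by simp [eq_comm]
  rw [h1, ← zsmul_eq_mul, MvPolynomial.coeff_smul, MvPolynomial.coeff_monomial]
  simp only [h2]
  split_ifs <;> simp

theorem vdm_eq_altPoly (n : ℕ) : vdm n = altPoly fun j : Fin n => (j : ℕ) := rfl

theorem coeff_altPoly_comp {l : Fin n → ℕ} (hl : Function.Injective l) {m : Fin n →₀ ℕ}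
    {σ : Equiv.Perm (Fin n)} (h : ∀ i, m i = l (σ i)) :
    (altPoly l).coeff m = ((Equiv.Perm.sign σ : ℤ) : ℂ) := by
  rw [coeff_altPoly, Finset.sum_eq_single σ]
  · simp [h]
  · intro τ _ hτ
    rw [if_neg]
    intro h'
    exact hτ (Equiv.ext fun i => hl ((h' i).symm.trans (h i)))
  · simp

theorem exists_perm_of_coeff_vdm_ne_zero {m : Fin n →₀ ℕ} (h : (vdm n).coeff m ≠ 0) :
    ∃ σ : Equiv.Perm (Fin n), ∀ i, m i = ((σ i : Fin n) : ℕ) := by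
  rw [vdm_eq_altPoly, coeff_altPoly] at h
  obtain ⟨σ, -, hσ⟩ := Finset.exists_ne_zero_of_sum_ne_zero h
  exact ⟨σ, by by_contra h'; simp [h'] at hσ⟩

theorem sum_eulerD_vdm (n : ℕ) :
    ∑ j, eulerD j (vdm n) = ((∑ l ∈ Finset.range n, l : ℕ) : ℂ) • vdm n := by
  ext m
  rw [MvPolynomial.coeff_sum, MvPolynomial.coeff_smul, smul_eq_mul]
  simp only [coeff_eulerD]
  rw [← Finset.sum_mul]
  by_cases h : (vdm n).coeff m = 0
  · simp [h]
  · obtain ⟨σ, hσ⟩ := exists_perm_of_coeff_vdm_ne_zero h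
    congr 1
    simp only [hσ]
    rw [Equiv.sum_comp σ fun i : Fin n => (((i : Fin n) : ℕ) : ℂ), Fin.sum_univ_eq_sum_range fun i => (i : ℂ)]
    simp

theorem sum_eulerD_eulerD_vdm (n : ℕ) :
    ∑ j, eulerD j (eulerD j (vdm n)) = ((∑ l ∈ Finset.range n, l ^ 2 : ℕ) : ℂ) • vdm n := by
  ext m
  rw [MvPolynomial.coeff_sum, MvPolynomial.coeff_smul, smul_eq_mul]
  simp only [coeff_eulerD, ← mul_assoc, ← pow_two]
  rw [← Finset.sum_mul]
  by_cases h : (vdm n).coeff m = 0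
  · simp [h]
  · obtain ⟨σ, hσ⟩ := exists_perm_of_coeff_vdm_ne_zero h
    congr 1
    simp only [hσ]
    rw [Equiv.sum_comp σ fun i : Fin n => (((i : Fin n) : ℕ) : ℂ) ^ 2,
      Fin.sum_univ_eq_sum_range fun i => (i : ℂ) ^ 2]
    simp

theorem eval_derivation_prod {ι : Type*} (s : Finset ι) (f : ι → MvPolynomial (Fin n) ℂ)
    (δ : Derivation ℂ (MvPolynomial (Fin n) ℂ) (MvPolynomial (Fin n) ℂ)) (z : Fin n → ℂ)
    (c : ι → ℂ) (h : ∀ i ∈ s, MvPolynomial.eval z (δ (f i)) = MvPolynomial.eval z (f i) * c i) :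
    MvPolynomial.eval z (δ (∏ i ∈ s, f i)) =
      MvPolynomial.eval z (∏ i ∈ s, f i) * ∑ i ∈ s, c i := by
  classical
  induction s using Finset.induction_on with
  | empty => simp
  | insert i s hi ih =>
    rw [Finset.prod_insert hi, Finset.sum_insert hi, Derivation.leibniz, map_add, smul_eq_mul,
      smul_eq_mul, map_mul, map_mul, map_mul, h i (Finset.mem_insert_self i s),
      ih fun j hj => h j (Finset.mem_insert_of_mem hj)]
    ring

/-- The left side is the derivation `∑ (D_j p) D_j` applied to the Vandermonde product, where `D_j =
X_j∂_j`; the right side is its logarithmic derivative, factor by factor. It is the cross term when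
`∑ D_j²` acts on a product. -/
theorem eval_gradient_vdm (p : MvPolynomial (Fin n) ℂ) {z : Fin n → ℂ}
    (hinj : Function.Injective z) :
    ∑ j, MvPolynomial.eval z (eulerD j (vdm n)) * MvPolynomial.eval z (eulerD j p) =
      MvPolynomial.eval z (vdm n) * ∑ i, ∑ j ∈ Finset.Ioi i,
        (z j * MvPolynomial.eval z (eulerD j p) - z i * MvPolynomial.eval z (eulerD i p)) /
          (z j - z i) := by
  let δ : Derivation ℂ (MvPolynomial (Fin n) ℂ) (MvPolynomial (Fin n) ℂ) :=
    ∑ j, eulerD j p • eulerD j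
  have hδ : ∀ q, δ q = ∑ j, eulerD j p * eulerD j q := fun q => by
    have h := congrFun (map_sum (Derivation.coeFnAddMonoidHom (R := ℂ)
      (A := MvPolynomial (Fin n) ℂ) (M := MvPolynomial (Fin n) ℂ))
      (fun j => eulerD j p • eulerD j) Finset.univ) q
    rw [Finset.sum_apply] at h
    exact h
  have hX : ∀ i, δ (MvPolynomial.X i) = eulerD i p * MvPolynomial.X i := fun i => by
    rw [hδ, Finset.sum_eq_single i]
    · simp [eulerD]
    · intro j _ hj
      simp [eulerD, MvPolynomial.pderiv_X_of_ne hj.symm]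
    · simp
  have h1 : ∑ j, MvPolynomial.eval z (eulerD j (vdm n)) * MvPolynomial.eval z (eulerD j p) =
      MvPolynomial.eval z (δ (vdm n)) := by
    rw [hδ, map_sum]
    exact Finset.sum_congr rfl fun j _ => by rw [map_mul, mul_comm]
  rw [h1, vdm, Matrix.det_vandermonde]
  refine eval_derivation_prod _ _ _ _ _ fun i _ => eval_derivation_prod _ _ _ _ _ fun j hj => ?_
  have hij : z j - z i ≠ 0 := sub_ne_zero.mpr fun h =>
    (Finset.mem_Ioi.mp hj).ne' (hinj h)
  rw [map_sub, hX, hX]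
  simp only [map_sub, map_mul, MvPolynomial.eval_X]
  field_simp

theorem sum_eulerD_vdm_mul_avgPoly (k : ℕ) :
    ∑ j, eulerD j (vdm n * avgPoly N k n) =
      ((∑ l ∈ Finset.range n, l : ℕ) + k * N : ℂ) • (vdm n * avgPoly N k n) := by
  have h1 := sum_eulerD_vdm n
  have h2 := sum_eulerD_avgPoly (N := N) (n := n) k
  simp only [Derivation.leibniz, Finset.sum_add_distrib, ← Finset.smul_sum]
  rw [h1, h2]
  simp only [smul_eq_mul, mul_smul_comm, add_smul]
  rw [mul_comm (avgPoly N k n), add_comm]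

/-- The average of products of characteristic polynomials, times the Vandermonde polynomial, is an
eigenfunction of `∑ (X_j ∂_j)²`. -/
theorem sum_eulerD_eulerD_vdm_mul_avgPoly (k : ℕ) :
    ∑ j, eulerD j (eulerD j (vdm n * avgPoly N k n)) =
      ((∑ l ∈ Finset.range n, l ^ 2 : ℕ) + k * N * (N - k + 2 * n - 1) : ℂ) •
        (vdm n * avgPoly N k n) := by
  refine eq_of_eval_eq_on_ball fun z hz hinj => ?_
  set P := avgPoly N k n with hP
  set a : Fin n → ℂ := fun j => MvPolynomial.eval z (eulerD j P) with ha
  set P0 := MvPolynomial.eval z P with hP0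
  set V := MvPolynomial.eval z (vdm n) with hV
  have h1 : ∑ j, a j = k * N * P0 := eval_sum_eulerD_avgPoly k hz
  have h2 := fun j => eval_loop_avgPoly (N := N) k hz hinj j
  have h3 := congrArg (MvPolynomial.eval z) (sum_eulerD_eulerD_vdm n)
  have h4 := eval_gradient_vdm P hinj
  rw [map_sum, MvPolynomial.smul_eval] at h3
  have e1 : ∀ j, MvPolynomial.eval z (eulerD j (eulerD j (vdm n * P))) =
      MvPolynomial.eval z (eulerD j (eulerD j (vdm n))) * P0 +
      2 * (MvPolynomial.eval z (eulerD j (vdm n)) * a j) +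
      V * MvPolynomial.eval z (eulerD j (eulerD j P)) := by
    intro j
    simp only [Derivation.leibniz, map_add, smul_eq_mul, map_mul, ha, hP0, hV]
    ring
  rw [map_sum, Finset.sum_congr rfl fun j _ => e1 j, Finset.sum_add_distrib,
    Finset.sum_add_distrib, ← Finset.sum_mul, ← Finset.mul_sum, ← Finset.mul_sum, h3, h4,
    Finset.sum_congr rfl fun j _ => h2 j, Finset.sum_sub_distrib, Finset.sum_add_distrib,
    ← Finset.mul_sum]
  -- Symmetrising over pairs shows that the interaction term of the loop equations cancels the cross
  -- term, up to a multiple of `∑ a_j`, which homogeneity evaluates.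
  have e2 : ∑ j, ∑ i ∈ {j}ᶜ, z i / (z i - z j) * (a i - a j) =
      2 * ∑ i, ∑ j ∈ Finset.Ioi i, (z j * a j - z i * a i) / (z j - z i) -
        ∑ i, ∑ j ∈ Finset.Ioi i, (a j + a i) := by
    rw [← Finset.sum_sum_Ioi_add_eq_sum_sum_off_diag fun i j => z i / (z i - z j) * (a i - a j),
      Finset.mul_sum, ← Finset.sum_sub_distrib]
    refine Finset.sum_congr rfl fun i _ => ?_
    rw [Finset.mul_sum, ← Finset.sum_sub_distrib]
    refine Finset.sum_congr rfl fun j hj => ?_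
    have hij : z j - z i ≠ 0 := sub_ne_zero.mpr fun h => (Finset.mem_Ioi.mp hj).ne' (hinj h)
    have hij' : z i - z j ≠ 0 := sub_ne_zero.mpr fun h => (Finset.mem_Ioi.mp hj).ne (hinj h)
    rw [show z i - z j = -(z j - z i) by ring]
    field_simp
    ring
  have e3 : ∑ i, ∑ j ∈ Finset.Ioi i, (a j + a i) = (n - 1) * ∑ j, a j := by
    rw [Finset.sum_sum_Ioi_add_eq_sum_sum_off_diag fun i _ => a i]
    have : ∀ i, ∑ j ∈ {i}ᶜ, a j = ∑ j, a j - a i := fun i => by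
      rw [Fintype.sum_eq_add_sum_compl i]; ring
    simp only [this, Finset.sum_sub_distrib, Finset.sum_const, Finset.card_univ, Fintype.card_fin,
      nsmul_eq_mul]
    ring
  simp only [ha] at e2 e3 h1
  rw [e2, e3, h1]
  simp only [Finset.sum_const, Finset.card_univ, Fintype.card_fin, nsmul_eq_mul,
    MvPolynomial.smul_eval, map_mul, ← hV, ← hP0]
  ring

end LoopPoly

/-! ### Identification of the average by its exponents. -/

section Uniqueness

variable {N n : ℕ}

theorem eval_avgPoly (k : ℕ) (z : Fin n → ℂ) : MvPolynomial.eval z (avgPoly N k n) =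
    ∫ U : Matrix.unitaryGroup (Fin N) ℂ, charProd k z U.1 ∂(haarU N) := by
  have h := linearMap_avgPoly (N := N) k (MvPolynomial.aeval z).toLinearMap
  simpa [MvPolynomial.aeval_eq_eval, eval_charProdPoly] using h

theorem rename_avgPoly (k : ℕ) (σ : Equiv.Perm (Fin n)) :
    MvPolynomial.rename σ (avgPoly N k n) = avgPoly N k n := by
  refine MvPolynomial.funext fun z => ?_
  rw [MvPolynomial.eval_rename, eval_avgPoly, eval_avgPoly]
  refine integral_congr_ae (Eventually.of_forall fun U => ?_)
  simp only [charProd, Function.comp]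
  rw [Equiv.prod_comp σ fun i => (1 - z i • U.1).det]

theorem rename_vdm (σ : Equiv.Perm (Fin n)) :
    MvPolynomial.rename σ (vdm n) = ((Equiv.Perm.sign σ : ℤ) : ℂ) • vdm n := by
  refine MvPolynomial.funext fun z => ?_
  rw [MvPolynomial.eval_rename, eval_vdm, MvPolynomial.smul_eval, eval_vdm, ← Matrix.det_permute]
  rfl

theorem coeff_vdm_mul_avgPoly_comp (k : ℕ) (σ : Equiv.Perm (Fin n)) {m m' : Fin n →₀ ℕ}
    (h : ∀ i, m i = m' (σ i)) :
    (vdm n * avgPoly N k n).coeff m =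
      ((Equiv.Perm.sign σ : ℤ) : ℂ) * (vdm n * avgPoly N k n).coeff m' := by
  have h1 : MvPolynomial.rename σ (vdm n * avgPoly N k n) =
      ((Equiv.Perm.sign σ : ℤ) : ℂ) • (vdm n * avgPoly N k n) := by
    rw [map_mul, rename_vdm, rename_avgPoly, smul_mul_assoc]
  have h2 : m' = Finsupp.mapDomain σ m := by
    ext i
    rw [← Finsupp.equivMapDomain_eq_mapDomain, Finsupp.equivMapDomain_apply, h]
    simp
  have h3 := MvPolynomial.coeff_rename_mapDomain σ σ.injective (vdm n * avgPoly N k n) m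
  rw [h1, MvPolynomial.coeff_smul, smul_eq_mul] at h3
  rw [h2, h3]

/-- Swapping two equal exponents fixes the monomial but changes the sign of the coefficient. -/
theorem injective_of_coeff_ne_zero (k : ℕ) {m : Fin n →₀ ℕ}
    (h : (vdm n * avgPoly N k n).coeff m ≠ 0) : Function.Injective m := by
  intro i j hij
  by_contra hne
  apply h
  have h1 := coeff_vdm_mul_avgPoly_comp (N := N) k (Equiv.swap i j) (m := m) (m' := m) (by
    intro a
    rcases eq_or_ne a i with rfl | hi
    · simp [hij]
    rcases eq_or_ne a j with rfl | hj
    · simp [hij]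
    rw [Equiv.swap_apply_of_ne_of_ne hi hj])
  rw [Equiv.Perm.sign_swap hne] at h1
  have h2 : (2 : ℂ) * (vdm n * avgPoly N k n).coeff m = 0 := by
    push_cast at h1
    linear_combination h1
  simpa using h2

theorem coeff_avgPoly (k : ℕ) (m : Fin n →₀ ℕ) : (avgPoly N k n).coeff m =
    if ∀ i, m i ≤ N then
      ∫ U : Matrix.unitaryGroup (Fin N) ℂ, (U.1.det)⁻¹ ^ k * ∏ i, U.1.charpolyRev.coeff (m i)
        ∂(haarU N) else 0 := by
  classical
  have h1 : ∀ r : Fin n → ℕ, ∏ i, (MvPolynomial.X i : MvPolynomial (Fin n) ℂ) ^ r i =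
      MvPolynomial.monomial (Finsupp.equivFunOnFinite.symm r) 1 := fun r => by
    rw [MvPolynomial.monomial_eq, Finsupp.prod_fintype _ _ (by simp)]
    simp
  rw [avgPoly, MvPolynomial.coeff_sum]
  simp only [h1, MvPolynomial.coeff_smul, MvPolynomial.coeff_monomial, smul_eq_mul, mul_ite, mul_one,
    mul_zero]
  have h2 : ∀ r : Fin n → ℕ, Finsupp.equivFunOnFinite.symm r = m ↔ (m : Fin n → ℕ) = r := fun r => by
    rw [Equiv.symm_apply_eq]
    exact eq_comm
  simp only [h2, Finset.sum_ite_eq, Fintype.mem_piFinset, Finset.mem_range, Nat.lt_succ_iff]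

theorem exists_of_coeff_ne_zero (k : ℕ) {m : Fin n →₀ ℕ}
    (h : (vdm n * avgPoly N k n).coeff m ≠ 0) :
    ∃ σ : Equiv.Perm (Fin n), ∀ i, (σ i : ℕ) ≤ m i ∧ m i ≤ σ i + N := by
  classical
  rw [MvPolynomial.coeff_mul] at h
  obtain ⟨⟨a, b⟩, hab, hne⟩ := Finset.exists_ne_zero_of_sum_ne_zero h
  obtain ⟨σ, hσ⟩ := exists_perm_of_coeff_vdm_ne_zero (left_ne_zero_of_mul hne)
  have hb := right_ne_zero_of_mul hne
  rw [coeff_avgPoly] at hb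
  have hb' : ∀ i, b i ≤ N := by
    by_contra h'
    simp [h'] at hb
  refine ⟨σ, fun i => ?_⟩
  have := DFunLike.congr_fun (Finset.HasAntidiagonal.mem_antidiagonal.mp hab) i
  simp only [Finsupp.add_apply] at this
  have : a i = (σ i : ℕ) := hσ i
  have := hb' i
  omega

theorem sum_of_coeff_ne_zero (k : ℕ) {m : Fin n →₀ ℕ}
    (h : (vdm n * avgPoly N k n).coeff m ≠ 0) :
    ∑ i, (m i : ℤ) = ∑ l ∈ Finset.range n, (l : ℤ) + k * N := by
  have h1 := congrArg (MvPolynomial.coeff m) (sum_eulerD_vdm_mul_avgPoly (N := N) (n := n) k)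
  rw [MvPolynomial.coeff_sum, MvPolynomial.coeff_smul, smul_eq_mul] at h1
  simp only [coeff_eulerD] at h1
  rw [← Finset.sum_mul] at h1
  have h2 := mul_right_cancel₀ h h1
  have h3 : ∑ i, m i = ∑ l ∈ Finset.range n, l + k * N := by exact_mod_cast h2
  rw [← Nat.cast_sum, h3]
  push_cast
  ring

theorem sum_sq_of_coeff_ne_zero (k : ℕ) {m : Fin n →₀ ℕ}
    (h : (vdm n * avgPoly N k n).coeff m ≠ 0) :
    ∑ i, (m i : ℤ) ^ 2 = ∑ l ∈ Finset.range n, (l : ℤ) ^ 2 + k * N * (N - k + 2 * n - 1) := by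
  have h1 := congrArg (MvPolynomial.coeff m)
    (sum_eulerD_eulerD_vdm_mul_avgPoly (N := N) (n := n) k)
  rw [MvPolynomial.coeff_sum, MvPolynomial.coeff_smul, smul_eq_mul] at h1
  simp only [coeff_eulerD, ← mul_assoc, ← pow_two] at h1
  rw [← Finset.sum_mul] at h1
  have h2 := mul_right_cancel₀ h h1
  exact_mod_cast h2

/-- The exponents `0, …, k - 1, N + k, …, N + 2k - 1`. -/
def rectExp (N k : ℕ) (j : Fin (k + k)) : ℕ := if (j : ℕ) < k then j else N + j

theorem rectExp_injective (N k : ℕ) : Function.Injective (rectExp N k) := by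
  intro i j h
  unfold rectExp at h
  apply Fin.ext
  split_ifs at h <;> omega

theorem sum_rectExp (N k : ℕ) :
    ∑ i, (rectExp N k i : ℤ) = ∑ l ∈ Finset.range (k + k), (l : ℤ) + k * N := by
  rw [Fin.sum_univ_add, Finset.sum_range_add]
  simp [rectExp, Finset.sum_add_distrib, Finset.sum_range]
  ring

theorem sum_sq_rectExp (N k : ℕ) :
    ∑ i, (rectExp N k i : ℤ) ^ 2 = ∑ l ∈ Finset.range (k + k), (l : ℤ) ^ 2 +
      k * N * (N - k + 2 * (k + k : ℕ) - 1) := by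
  rw [Fin.sum_univ_add, Finset.sum_range_add]
  have h2 : 2 * ∑ i ∈ Finset.range k, (i : ℤ) = k * (k - 1) := by
    induction k with
    | zero => simp
    | succ k ih => rw [Finset.sum_range_succ, mul_add, ih]; push_cast; ring
  have h1 : ∑ i ∈ Finset.range k, ((N + (k + i) : ℕ) : ℤ) ^ 2 =
      ∑ i ∈ Finset.range k, ((k + i : ℕ) : ℤ) ^ 2 + k * N * (N + 2 * k) +
        N * (2 * ∑ i ∈ Finset.range k, (i : ℤ)) := by
    have : ∀ i : ℕ, ((N + (k + i) : ℕ) : ℤ) ^ 2 = ((k + i : ℕ) : ℤ) ^ 2 + (N * (N + 2 * k)) +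
      N * (2 * i) := fun i => by push_cast; ring
    simp only [this, Finset.sum_add_distrib, ← Finset.mul_sum, Finset.sum_const, Finset.card_range,
      nsmul_eq_mul]
    ring
  have h3 : ∑ i : Fin k, (rectExp N k (Fin.castAdd k i) : ℤ) ^ 2 =
      ∑ i ∈ Finset.range k, (i : ℤ) ^ 2 := by
    rw [Finset.sum_range]; simp [rectExp]
  have h4 : ∑ i : Fin k, (rectExp N k (Fin.natAdd k i) : ℤ) ^ 2 =
      ∑ i ∈ Finset.range k, ((N + (k + i) : ℕ) : ℤ) ^ 2 := by
    rw [Finset.sum_range]; simp [rectExp, add_comm]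
  rw [h3, h4, h1, h2]
  push_cast
  ring

/-- The two eigenvalues agree with the first two power sums of `rectExp`, which are extremal: its
values occupy both ends of `0, …, N + 2k - 1`. A quadratic test function that separates the ends
from the gap leaves no other exponents. -/
theorem exists_perm_rectExp {k : ℕ} {m : Fin (k + k) →₀ ℕ}
    (h : (vdm (k + k) * avgPoly N k (k + k)).coeff m ≠ 0) :
    ∃ σ : Equiv.Perm (Fin (k + k)), ∀ i, m i = rectExp N k (σ i) := by
  classical
  set M : ℤ := N + 2 * k - 1 with hM
  -- `M / 2` is the midpoint of `0, …, N + 2k - 1`. As `g` is quadratic, its sum over the exponents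
  -- is fixed by the two power sums. It is positive on `T` and nonpositive on the gap `k ≤ x < N +
  -- k`, which contains `S \ T`.
  let g : ℕ → ℤ := fun x => (2 * x - M) ^ 2 - N ^ 2
  have hinj := injective_of_coeff_ne_zero k h
  set S := Finset.univ.image m with hS
  set T := Finset.univ.image (rectExp N k) with hT
  have hsum : ∑ x ∈ S, g x = ∑ x ∈ T, g x := by
    rw [hS, hT, Finset.sum_image fun a _ b _ hab => hinj hab,
      Finset.sum_image fun a _ b _ hab => rectExp_injective N k hab]
    have e : ∀ f : Fin (k + k) → ℕ, ∑ i, g (f i) = 4 * ∑ i, (f i : ℤ) ^ 2 - 4 * M * ∑ i, (f i : ℤ) +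
        (k + k) * (M ^ 2 - N ^ 2) := by
      intro f
      have : ∀ i, g (f i) = 4 * (f i : ℤ) ^ 2 - 4 * M * (f i : ℤ) + (M ^ 2 - N ^ 2) := fun i => by
        simp only [g]; ring
      simp only [this, Finset.sum_add_distrib, Finset.sum_sub_distrib, ← Finset.mul_sum,
        Finset.sum_const, Finset.card_univ, Fintype.card_fin, nsmul_eq_mul]
      push_cast
      ring
    rw [e, e, sum_of_coeff_ne_zero k h, sum_sq_of_coeff_ne_zero k h, sum_rectExp, sum_sq_rectExp]
  have hTpos : ∀ x ∈ T, 0 < g x := by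
    intro x hx
    obtain ⟨j, -, rfl⟩ := Finset.mem_image.mp hx
    have hj := j.2
    simp only [g, rectExp]
    split_ifs with hjk
    · have : (N : ℤ) + 1 ≤ M - 2 * (j : ℕ) := by omega
      nlinarith
    · have : (N : ℤ) + 1 ≤ 2 * ((N + j : ℕ) : ℤ) - M := by omega
      nlinarith
  have hSneg : ∀ x ∈ S \ T, g x ≤ 0 := by
    intro x hx
    obtain ⟨hxS, hxT⟩ := Finset.mem_sdiff.mp hx
    obtain ⟨j, -, rfl⟩ := Finset.mem_image.mp hxS
    obtain ⟨σ, hσ⟩ := exists_of_coeff_ne_zero k h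
    have h1 := hσ j
    have h2 := (σ j).2
    have h3 : k ≤ m j := by
      by_contra h'
      exact hxT (Finset.mem_image.mpr ⟨⟨m j, by omega⟩, Finset.mem_univ _, by
        simp only [rectExp]; rw [if_pos (by omega)]⟩)
    have h4 : m j < N + k := by
      by_contra h'
      exact hxT (Finset.mem_image.mpr ⟨⟨m j - N, by omega⟩, Finset.mem_univ _, by
        simp only [rectExp]; rw [if_neg (by omega)]; omega⟩)
    have h5 : -(N : ℤ) ≤ 2 * (m j : ℤ) - M := by omega
    have h6 : 2 * (m j : ℤ) - M ≤ N := by omega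
    simp only [g]
    nlinarith
  have hsub : T ⊆ S := by
    rw [← Finset.sum_inter_add_sum_sdiff S T, ← Finset.sum_inter_add_sum_sdiff T S,
      Finset.inter_comm, add_right_inj] at hsum
    have h1 : ∑ x ∈ T \ S, g x ≤ 0 := hsum ▸ Finset.sum_nonpos hSneg
    by_contra hns
    obtain ⟨x, hx, hxS⟩ := Finset.not_subset.mp hns
    have : 0 < ∑ x ∈ T \ S, g x := Finset.sum_pos
      (fun y hy => hTpos y (Finset.mem_sdiff.mp hy).1) ⟨x, Finset.mem_sdiff.mpr ⟨hx, hxS⟩⟩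
    omega
  have hST : T = S := by
    refine Finset.eq_of_subset_of_card_le hsub ?_
    rw [hS, hT, Finset.card_image_of_injective _ hinj,
      Finset.card_image_of_injective _ (rectExp_injective N k)]
  have hex : ∀ i, ∃ j, rectExp N k j = m i := fun i => by
    have : m i ∈ T := hST ▸ Finset.mem_image_of_mem _ (Finset.mem_univ i)
    obtain ⟨j, -, hj⟩ := Finset.mem_image.mp this
    exact ⟨j, hj⟩
  choose f hf using hex
  have hfi : Function.Injective f := fun a b hab => hinj (by rw [← hf a, ← hf b, hab])
  exact ⟨Equiv.ofBijective f (Finite.injective_iff_bijective.mp hfi), fun i => (hf i).symm⟩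

/-- Since `σ` preserves sums and sums of squares, `∑ (σ i - i)² = 2 ∑ (i - k)(i - σ i)`, and each
term on the right is nonpositive. -/
theorem perm_eq_one_of_le_of_ge {k : ℕ} {σ : Equiv.Perm (Fin n)}
    (h1 : ∀ i : Fin n, (i : ℕ) < k → (σ i : ℕ) ≤ i) (h2 : ∀ i : Fin n, k ≤ (i : ℕ) → (i : ℕ) ≤ σ i) :
    σ = 1 := by
  have hs1 : ∑ i, ((σ i : ℕ) : ℤ) = ∑ i : Fin n, ((i : ℕ) : ℤ) :=
    Equiv.sum_comp σ fun i : Fin n => ((i : ℕ) : ℤ)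
  have hs2 : ∑ i, ((σ i : ℕ) : ℤ) ^ 2 = ∑ i : Fin n, ((i : ℕ) : ℤ) ^ 2 :=
    Equiv.sum_comp σ fun i : Fin n => ((i : ℕ) : ℤ) ^ 2
  have hle : ∑ i : Fin n, (((σ i : ℕ) : ℤ) - ((i : ℕ) : ℤ)) ^ 2 ≤ 0 := by
    have e : ∑ i : Fin n, (((σ i : ℕ) : ℤ) - ((i : ℕ) : ℤ)) ^ 2 =
        2 * ∑ i : Fin n, (((i : ℕ) : ℤ) - k) * (((i : ℕ) : ℤ) - ((σ i : ℕ) : ℤ)) := by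
      have : ∀ i : Fin n, (((σ i : ℕ) : ℤ) - ((i : ℕ) : ℤ)) ^ 2 =
          2 * ((((i : ℕ) : ℤ) - k) * (((i : ℕ) : ℤ) - ((σ i : ℕ) : ℤ))) +
          (((σ i : ℕ) : ℤ) ^ 2 - ((i : ℕ) : ℤ) ^ 2) +
          2 * k * (((i : ℕ) : ℤ) - ((σ i : ℕ) : ℤ)) := fun i => by ring
      rw [Finset.sum_congr rfl fun i _ => this i]
      simp only [Finset.sum_add_distrib, ← Finset.mul_sum]
      rw [Finset.sum_sub_distrib, Finset.sum_sub_distrib, hs1, hs2]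
      ring
    rw [e]
    have : ∑ i : Fin n, (((i : ℕ) : ℤ) - k) * (((i : ℕ) : ℤ) - ((σ i : ℕ) : ℤ)) ≤ 0 := by
      refine Finset.sum_nonpos fun i _ => ?_
      rcases lt_or_ge (i : ℕ) k with h | h
      · have := h1 i h
        exact mul_nonpos_of_nonpos_of_nonneg (by omega) (by omega)
      · have := h2 i h
        exact mul_nonpos_of_nonneg_of_nonpos (by omega) (by omega)
    linarith
  have h0 := (Finset.sum_eq_zero_iff_of_nonneg fun i _ => sq_nonneg _).mp
    (le_antisymm hle (Finset.sum_nonneg fun i _ => sq_nonneg _))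
  ext i
  have := pow_eq_zero_iff (two_ne_zero) |>.mp (h0 i (Finset.mem_univ i))
  simp only [Equiv.Perm.one_apply]
  omega

theorem coeff_charpolyRev_top (A : Matrix (Fin N) (Fin N) ℂ) :
    A.charpolyRev.coeff N = (-1) ^ N * A.det := by
  rw [← Matrix.reverse_charpoly, Polynomial.coeff_reverse, Matrix.charpoly_natDegree_eq_dim,
    Fintype.card_fin, Polynomial.revAt_le le_rfl, Nat.sub_self, Matrix.det_eq_sign_charpoly_coeff,
    Fintype.card_fin, ← mul_assoc, ← mul_pow]
  simp

/-- Only one splitting contributes: the identity permutation from the Vandermonde factor and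
exponents `0` or `N` from the average. There, `k` leading coefficients `(-1)^N det U` cancel
`det(U)^{-k}`, so the integrand is constant. -/
theorem coeff_rectExp (N k : ℕ) : (vdm (k + k) * avgPoly N k (k + k)).coeff
    (Finsupp.equivFunOnFinite.symm (rectExp N k)) = (-1) ^ (N * k) := by
  classical
  let a : Fin (k + k) →₀ ℕ := Finsupp.equivFunOnFinite.symm fun i => (i : ℕ)
  let b : Fin (k + k) →₀ ℕ := Finsupp.equivFunOnFinite.symm fun i => if (i : ℕ) < k then 0 else N
  rw [MvPolynomial.coeff_mul, Finset.sum_eq_single (a, b)]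
  · have h1 : (vdm (k + k)).coeff a = 1 := by
      rw [vdm_eq_altPoly, coeff_altPoly_comp (σ := 1) Fin.val_injective fun i => by simp [a]]
      simp
    have h2 : (avgPoly N k (k + k)).coeff b = (-1) ^ (N * k) := by
      rw [coeff_avgPoly, if_pos (fun i => by simp only [b, Finsupp.equivFunOnFinite_symm_apply_apply]; split_ifs <;> simp)]
      have : ∀ U : Matrix.unitaryGroup (Fin N) ℂ,
          (U.1.det)⁻¹ ^ k * ∏ i, U.1.charpolyRev.coeff (b i) = (-1) ^ (N * k) := by
        intro U
        have hd := (isUnit_det_unitaryGroup U).ne_zero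
        have h0 : U.1.charpolyRev.coeff 0 = 1 := by
          rw [Polynomial.coeff_zero_eq_eval_zero, Matrix.eval_charpolyRev]
        rw [Fin.prod_univ_add]
        simp only [b, Finsupp.equivFunOnFinite_symm_apply_apply, Fin.val_castAdd, Fin.is_lt, if_true,
          Fin.val_natAdd, not_lt.mpr (Nat.le_add_right k _), if_false, h0, coeff_charpolyRev_top,
          Finset.prod_const, Finset.card_univ, Fintype.card_fin, one_pow, one_mul]
        rw [mul_pow, ← pow_mul, mul_left_comm, ← mul_pow, inv_mul_cancel₀ hd, one_pow, mul_one]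
      simp only [this]
      simp
    simp only [h1, h2, one_mul]
  · rintro ⟨a', b'⟩ hab hne
    by_contra h0
    obtain ⟨σ, hσ⟩ := exists_perm_of_coeff_vdm_ne_zero (left_ne_zero_of_mul h0)
    have hb := right_ne_zero_of_mul h0
    rw [coeff_avgPoly] at hb
    have hb' : ∀ i, b' i ≤ N := by
      by_contra h'
      simp [h'] at hb
    have hsum : ∀ i, a' i + b' i = rectExp N k i := fun i => by
      have := DFunLike.congr_fun (Finset.HasAntidiagonal.mem_antidiagonal.mp hab) i
      simpa using this
    have hσ1 : σ = 1 := by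
      refine perm_eq_one_of_le_of_ge (k := k) (fun i hi => ?_) fun i hi => ?_
      · have h1 := hsum i
        have h2 : a' i = (σ i : ℕ) := hσ i
        rw [rectExp, if_pos hi] at h1
        omega
      · have h1 := hsum i
        have h2 : a' i = (σ i : ℕ) := hσ i
        have h3 := hb' i
        rw [rectExp, if_neg (by omega)] at h1
        omega
    apply hne
    have ha : a' = a := by
      ext i
      rw [hσ i, hσ1]
      simp [a]
    have hb2 : b' = b := by
      ext i
      have h1 := hsum i
      rw [ha] at h1
      simp only [a, b, Finsupp.equivFunOnFinite_symm_apply_apply, rectExp] at h1 ⊢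
      split_ifs at h1 ⊢ <;> omega
    rw [ha, hb2]
  · intro h
    exfalso
    apply h
    rw [Finset.HasAntidiagonal.mem_antidiagonal]
    ext i
    simp only [a, b, Finsupp.add_apply, Finsupp.equivFunOnFinite_symm_apply_apply, rectExp]
    split_ifs <;> omega

/-- Both sides are antisymmetric and supported on a single orbit of exponents, so one coefficient
decides. -/
theorem vdm_mul_avgPoly (N k : ℕ) : vdm (k + k) * avgPoly N k (k + k) =
    (-1 : ℂ) ^ (N * k) • altPoly (rectExp N k) := by
  ext m
  rw [MvPolynomial.coeff_smul, smul_eq_mul]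
  by_cases h : ∃ σ : Equiv.Perm (Fin (k + k)), ∀ i, m i = rectExp N k (σ i)
  · obtain ⟨σ, hσ⟩ := h
    rw [coeff_altPoly_comp (rectExp_injective N k) hσ,
      coeff_vdm_mul_avgPoly_comp k σ (m' := Finsupp.equivFunOnFinite.symm (rectExp N k))
        (fun i => by simp [hσ]), coeff_rectExp, mul_comm]
  · have h1 : (vdm (k + k) * avgPoly N k (k + k)).coeff m = 0 := by
      by_contra h0
      exact h (exists_perm_rectExp h0)
    rw [h1, coeff_altPoly, Finset.sum_eq_zero, mul_zero]
    intro σ _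
    rw [if_neg fun h' => h ⟨σ, h'⟩]

end Uniqueness

/-! ### Alternants and complete homogeneous symmetric functions. -/

section JacobiTrudi

variable {R : Type*} [CommRing R] {n : ℕ}

/-- The generating series `∏ 1 / (1 - v_i T)` of the complete homogeneous symmetric functions. -/
def hSeries (v : Fin n → R) : PowerSeries R := ∏ i, PowerSeries.mk fun m => v i ^ m

/-- The complete homogeneous symmetric functions, zero for a negative index. -/
def hZ (v : Fin n → R) : ℤ → R
  | Int.ofNat m => PowerSeries.coeff m (hSeries v)
  | Int.negSucc _ => 0

theorem hZ_natCast (v : Fin n → R) (m : ℕ) : hZ v m = PowerSeries.coeff m (hSeries v) := rfl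

theorem hZ_of_neg (v : Fin n → R) {a : ℤ} (ha : a < 0) : hZ v a = 0 := by
  cases a with
  | ofNat m => exact absurd ha (by simp)
  | negSucc m => rfl

theorem hZ_zero (v : Fin n → R) : hZ v 0 = 1 := by
  change PowerSeries.coeff 0 (hSeries v) = 1
  rw [PowerSeries.coeff_zero_eq_constantCoeff_apply, hSeries, map_prod]
  refine Finset.prod_eq_one fun i _ => ?_
  rw [← PowerSeries.coeff_zero_eq_constantCoeff_apply, PowerSeries.coeff_mk, pow_zero]

theorem PowerSeries.mk_pow_mul_one_sub (a : R) :
    (PowerSeries.mk fun m => a ^ m) * (1 - PowerSeries.C a * PowerSeries.X) = 1 := by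
  ext m
  rw [mul_sub, mul_one, mul_left_comm, map_sub, PowerSeries.coeff_C_mul, PowerSeries.coeff_one]
  cases m with
  | zero => simp
  | succ m => simp [PowerSeries.coeff_succ_mul_X, pow_succ']

/-- The polynomial `∏_{j ≠ i} (1 - v_j T)`. -/
def cofactorPoly (v : Fin n → R) (i : Fin n) : Polynomial R :=
  ∏ j ∈ Finset.univ.erase i, (1 - Polynomial.C (v j) * Polynomial.X)

theorem natDegree_cofactorPoly_lt (v : Fin n → R) (i : Fin n) :
    (cofactorPoly v i).natDegree < n := by
  have h1 : (cofactorPoly v i).natDegree ≤ ∑ j ∈ Finset.univ.erase i, 1 := by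
    refine (Polynomial.natDegree_prod_le _ _).trans (Finset.sum_le_sum fun j _ => ?_)
    refine (Polynomial.natDegree_sub_le _ _).trans ?_
    simp only [Polynomial.natDegree_one, zero_le, sup_of_le_right]
    exact (Polynomial.natDegree_C_mul_le _ _).trans Polynomial.natDegree_X_le
  have hn : 0 < n := Fin.pos i
  rw [Finset.sum_const, Finset.card_erase_of_mem (Finset.mem_univ i), Finset.card_univ,
    Fintype.card_fin, smul_eq_mul, mul_one] at h1
  omega

theorem hSeries_mul_cofactorPoly (v : Fin n → R) (i : Fin n) :
    hSeries v * (cofactorPoly v i : PowerSeries R) = PowerSeries.mk fun m => v i ^ m := by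
  have h1 : (cofactorPoly v i : PowerSeries R) =
      ∏ j ∈ Finset.univ.erase i, (1 - PowerSeries.C (v j) * PowerSeries.X) := by
    rw [cofactorPoly, ← Polynomial.coeToPowerSeries.ringHom_apply, map_prod]
    refine Finset.prod_congr rfl fun j _ => ?_
    simp
  rw [h1, hSeries, ← Finset.mul_prod_erase Finset.univ _ (Finset.mem_univ i), mul_assoc,
    ← Finset.prod_mul_distrib]
  rw [Finset.prod_eq_one fun j _ => PowerSeries.mk_pow_mul_one_sub (v j), mul_one]

/-- Compare coefficients in `1/(1 - v_i T) = ∏_j 1/(1 - v_j T) · ∏_{j ≠ i} (1 - v_j T)`. This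
factors the alternant matrix into a part independent of the exponents and a matrix of complete
homogeneous functions. -/
theorem pow_eq_sum_hZ (v : Fin n → R) (i : Fin n) (m : ℕ) :
    v i ^ m = ∑ s : Fin n, (cofactorPoly v i).coeff s * hZ v ((m : ℤ) - (s : ℕ)) := by
  have h1 := congrArg (PowerSeries.coeff m) (hSeries_mul_cofactorPoly v i)
  rw [PowerSeries.coeff_mk, mul_comm, PowerSeries.coeff_mul,
    Finset.Nat.sum_antidiagonal_eq_sum_range_succ fun a b =>
      PowerSeries.coeff a (cofactorPoly v i : PowerSeries R) * PowerSeries.coeff b (hSeries v)] at h1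
  have h2 : ∀ M, m < M → n ≤ M → v i ^ m = ∑ s ∈ Finset.range M,
      (cofactorPoly v i).coeff s * hZ v ((m : ℤ) - (s : ℕ)) := by
    intro M hM _
    rw [← h1]
    refine Eq.trans ?_ (Finset.sum_subset (Finset.range_subset_range.mpr hM) ?_)
    · refine Finset.sum_congr rfl fun s hs => ?_
      have hs' : s ≤ m := Nat.lt_succ_iff.mp (Finset.mem_range.mp hs)
      rw [Polynomial.coeff_coe, ← Nat.cast_sub hs', hZ_natCast]
    · intro s _ hs
      have hs' : m < s := by simpa using hs
      rw [hZ_of_neg v (by omega), mul_zero]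
  rw [h2 (m + 1 + n) (by omega) (by omega), Fin.sum_univ_eq_sum_range fun s =>
    (cofactorPoly v i).coeff s * hZ v ((m : ℤ) - (s : ℕ))]
  symm
  refine Finset.sum_subset (Finset.range_subset_range.mpr (by omega)) fun s _ hs => ?_
  have hs' : n ≤ s := by simpa using hs
  rw [Polynomial.coeff_eq_zero_of_natDegree_lt ((natDegree_cofactorPoly_lt v i).trans_le hs'),
    zero_mul]

theorem det_pow_eq_mul (v : Fin n → R) (l : Fin n → ℕ) :
    (Matrix.of fun i j => v i ^ l j).det =
      (Matrix.of fun i s : Fin n => (cofactorPoly v i).coeff s).det *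
        (Matrix.of fun s j : Fin n => hZ v ((l j : ℤ) - (s : ℕ))).det := by
  rw [← Matrix.det_mul]
  congr 1
  ext i j
  rw [Matrix.of_apply, pow_eq_sum_hZ, Matrix.mul_apply]
  rfl

/-- For the exponents `0, …, n - 1` the second factor is unitriangular, so the first factor has the
Vandermonde determinant. No division is needed. -/
theorem det_pow_eq_vandermonde_mul (v : Fin n → R) (l : Fin n → ℕ) :
    (Matrix.of fun i j => v i ^ l j).det = (Matrix.vandermonde v).det *
      (Matrix.of fun s j : Fin n => hZ v ((l j : ℤ) - (s : ℕ))).det := by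
  have h := det_pow_eq_mul v fun j => (j : ℕ)
  have h1 : (Matrix.of fun s j : Fin n => hZ v (((j : ℕ) : ℤ) - (s : ℕ))).det = 1 := by
    rw [Matrix.det_of_isUpperTriangular]
    · refine Finset.prod_eq_one fun i _ => ?_
      rw [Matrix.of_apply, sub_self, hZ_zero]
    · intro i j hij
      rw [Matrix.of_apply, hZ_of_neg]
      have : (j : ℕ) < i := hij
      omega
  rw [h1, mul_one] at h
  rw [det_pow_eq_mul v l, ← h]
  rfl

/-- The Jacobi–Trudi identity for a rectangular shape. -/
theorem det_rectExp_eq (N k : ℕ) (v : Fin (k + k) → R) :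
    (Matrix.of fun i j => v i ^ rectExp N k j).det = (Matrix.vandermonde v).det *
      (Matrix.of fun i j : Fin k => hZ v ((N : ℤ) + (j : ℕ) - (i : ℕ))).det := by
  rw [det_pow_eq_vandermonde_mul]
  congr 1
  rw [← Matrix.det_submatrix_equiv_self finSumFinEquiv]
  -- The low exponents give a unitriangular block above a zero block of negative indices, so only
  -- the lower right block contributes.
  have h : (Matrix.of fun s j : Fin (k + k) => hZ v ((rectExp N k j : ℤ) - (s : ℕ))).submatrix
      finSumFinEquiv finSumFinEquiv = Matrix.fromBlocks
        (Matrix.of fun i j : Fin k => hZ v (((j : ℕ) : ℤ) - (i : ℕ)))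
        (Matrix.of fun i j : Fin k => hZ v ((N : ℤ) + k + (j : ℕ) - (i : ℕ))) 0
        (Matrix.of fun i j : Fin k => hZ v ((N : ℤ) + (j : ℕ) - (i : ℕ))) := by
    ext (i | i) (j | j)
    · simp [rectExp]
    · simp [rectExp, add_assoc, add_comm (k : ℤ)]
    · simp only [Matrix.submatrix_apply, finSumFinEquiv_apply_left, finSumFinEquiv_apply_right,
        Matrix.of_apply, Matrix.fromBlocks_apply₂₁, Matrix.zero_apply, rectExp, Fin.val_castAdd,
        Fin.is_lt, if_true, Fin.val_natAdd]
      exact hZ_of_neg v (by have := j.2; omega)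
    · simp only [Matrix.submatrix_apply, finSumFinEquiv_apply_right, Matrix.of_apply,
        Matrix.fromBlocks_apply₂₂, rectExp, Fin.val_natAdd, not_lt.mpr (Nat.le_add_right k _),
        if_false]
      congr 1
      push_cast
      ring
  rw [h, Matrix.det_fromBlocks_zero₂₁]
  have h1 : (Matrix.of fun s j : Fin k => hZ v (((j : ℕ) : ℤ) - (s : ℕ))).det = 1 := by
    rw [Matrix.det_of_isUpperTriangular]
    · refine Finset.prod_eq_one fun i _ => ?_
      rw [Matrix.of_apply, sub_self, hZ_zero]
    · intro i j hij
      rw [Matrix.of_apply, hZ_of_neg]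
      have : (j : ℕ) < i := hij
      omega
  rw [h1, one_mul]

theorem hZ_map {S : Type*} [CommRing S] (f : R →+* S) (v : Fin n → R) (a : ℤ) :
    f (hZ v a) = hZ (fun i => f (v i)) a := by
  cases a with
  | negSucc m => exact map_zero f
  | ofNat m =>
    change f (PowerSeries.coeff m (hSeries v)) = PowerSeries.coeff m (hSeries fun i => f (v i))
    rw [← PowerSeries.coeff_map, hSeries, map_prod, hSeries]
    congr 2
    funext i
    ext m
    simp

end JacobiTrudi

/-- The average of products of characteristic polynomials as a Toeplitz determinant. -/
theorem avgPoly_eq_det (N k : ℕ) : avgPoly N k (k + k) = (-1 : ℂ) ^ (N * k) •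
    (Matrix.of fun i j : Fin k =>
      hZ (fun i : Fin (k + k) => (MvPolynomial.X i : MvPolynomial (Fin (k + k)) ℂ))
        ((N : ℤ) + (j : ℕ) - (i : ℕ))).det := by
  refine mul_left_cancel₀ (vdm_ne_zero (k + k)) ?_
  rw [vdm_mul_avgPoly, mul_smul_comm, altPoly, det_rectExp_eq, vdm]

/-! ### Products of linear factors in elements of square zero. -/

section SquareZero

variable {A ι : Type*} [CommRing A]

theorem add_pow_of_sq_eq_zero (x : A) {y : A} (hy : y ^ 2 = 0) (m : ℕ) :
    (x + y) ^ (m + 1) = x ^ (m + 1) + (m + 1 : ℕ) • (y * x ^ m) := by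
  induction m with
  | zero => simp
  | succ m ih =>
    rw [pow_succ, ih, succ_nsmul _ (m + 1)]
    have h : y * y = 0 := by rw [← pow_two, hy]
    simp only [mul_add, add_mul, nsmul_eq_mul]
    linear_combination ((m + 1 : ℕ) : A) * x ^ m * h

theorem sum_pow_card_succ_eq_zero {y : ι → A} (hy : ∀ i, y i ^ 2 = 0) (s : Finset ι) :
    (∑ i ∈ s, y i) ^ (s.card + 1) = 0 := by
  classical
  induction s using Finset.induction_on with
  | empty => simp
  | insert i s hi ih =>
    rw [Finset.sum_insert hi, Finset.card_insert_of_notMem hi, add_comm (y i),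
      add_pow_of_sq_eq_zero _ (hy i), pow_succ, ih]
    simp

/-- A product of linear factors in elements of square zero depends only on the sum of these
elements. -/
theorem prod_add_mul_of_sq_eq_zero [Algebra ℂ A] {y : ι → A} (hy : ∀ i, y i ^ 2 = 0) (a b : A) (s : Finset ι) :
    ∏ i ∈ s, (a + b * y i) = ∑ m ∈ Finset.range (s.card + 1),
      ((m.factorial : ℂ)⁻¹) • (a ^ (s.card - m) * b ^ m * (∑ i ∈ s, y i) ^ m) := by
  classical
  induction s using Finset.induction_on with
  | empty => simp
  | insert i s hi ih =>
    have h0 := sum_pow_card_succ_eq_zero hy s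
    rw [Finset.prod_insert hi, ih, Finset.sum_insert hi, Finset.card_insert_of_notMem hi]
    set x := ∑ i ∈ s, y i
    set c := s.card
    rw [Finset.sum_range_succ' _ (c + 1)]
    have e : ∀ m, ((m + 1).factorial : ℂ)⁻¹ • (a ^ (c + 1 - (m + 1)) * b ^ (m + 1) *
        (y i + x) ^ (m + 1)) = ((m + 1).factorial : ℂ)⁻¹ • (a ^ (c + 1 - (m + 1)) * b ^ (m + 1) *
        x ^ (m + 1)) + (m.factorial : ℂ)⁻¹ • (a ^ (c - m) * b ^ (m + 1) * (y i * x ^ m)) := by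
      intro m
      have hf : (m.factorial : ℂ) ≠ 0 := Nat.cast_ne_zero.mpr m.factorial_ne_zero
      have hm : ((m : ℂ) + 1) ≠ 0 := Nat.cast_add_one_ne_zero m
      rw [add_comm (y i), add_pow_of_sq_eq_zero _ (hy i), mul_add, smul_add, Nat.add_sub_add_right]
      congr 1
      rw [← Nat.cast_smul_eq_nsmul ℂ, mul_smul_comm, smul_smul]
      congr 1
      rw [Nat.factorial_succ]
      push_cast
      field_simp
    rw [Finset.sum_congr rfl fun m _ => e m, Finset.sum_add_distrib, add_right_comm,
      Finset.sum_range_succ (fun m => ((m + 1).factorial : ℂ)⁻¹ • (a ^ (c + 1 - (m + 1)) *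
        b ^ (m + 1) * x ^ (m + 1))) c, h0, mul_zero, smul_zero, add_zero, pow_zero, pow_zero,
      mul_one, ← pow_zero b, ← mul_one (a ^ (c + 1 - 0) * b ^ 0), ← pow_zero x,
      ← Finset.sum_range_succ' (fun m => (m.factorial : ℂ)⁻¹ • (a ^ (c + 1 - m) *
        b ^ m * x ^ m)) c, add_mul, Finset.mul_sum, Finset.mul_sum]
    congr 1
    · refine Finset.sum_congr rfl fun m hm => ?_
      have : m ≤ c := Nat.lt_succ_iff.mp (Finset.mem_range.mp hm)
      rw [mul_smul_comm, Nat.sub_add_comm this, pow_succ]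
      congr 1
      ring
    · refine Finset.sum_congr rfl fun m _ => ?_
      rw [mul_smul_comm]
      congr 1
      ring

end SquareZero

/-! ### Laguerre polynomials from complete homogeneous functions at `1 + y_i`. -/

section LaguerrePolynomials

/-- The polynomial whose value at `x` is `L_a^{(n-1)}(-x)`. -/
def lagPoly (n : ℕ) : ℤ → Polynomial ℝ
  | Int.ofNat a => ∑ j ∈ Finset.range (a + 1),
      Polynomial.C (((a + n - 1).choose (j + n - 1) : ℝ) / (j.factorial : ℝ)) * Polynomial.X ^ j
  | Int.negSucc _ => 0

theorem eval_lagPoly {n : ℕ} (hn : 0 < n) (a : ℤ) (x : ℝ) :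
    (lagPoly n a).eval x = laguerreL ((n : ℝ) - 1) a (-x) := by
  cases a with
  | negSucc a => simp [lagPoly, laguerreL]
  | ofNat a =>
    simp only [lagPoly, laguerreL, Polynomial.eval_finsetSum, neg_neg, Polynomial.eval_mul,
      Polynomial.eval_C, Polynomial.eval_pow, Polynomial.eval_X]
    refine Finset.sum_congr rfl fun j hj => ?_
    have hj' : j ≤ a := Nat.lt_succ_iff.mp (Finset.mem_range.mp hj)
    obtain ⟨n, rfl⟩ := Nat.exists_eq_succ_of_ne_zero hn.ne'
    have e1 : (a : ℝ) + (((n + 1 : ℕ) : ℝ) - 1) + 1 = ((a + n : ℕ) : ℝ) + 1 := by push_cast; ring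
    have e2 : (j : ℝ) + (((n + 1 : ℕ) : ℝ) - 1) + 1 = ((j + n : ℕ) : ℝ) + 1 := by push_cast; ring
    rw [Nat.succ_eq_add_one, e1, e2, Real.Gamma_nat_eq_factorial, Real.Gamma_nat_eq_factorial,
      ← add_assoc, Nat.add_sub_cancel, ← add_assoc, Nat.add_sub_cancel,
      Nat.cast_choose ℝ (by omega), show a + n - (j + n) = a - j by omega]
    ring

variable {A : Type*} [CommRing A] [Algebra ℂ A]

/-- Evaluation of a real polynomial in a complex algebra. -/
def realEval (x : A) : Polynomial ℝ →+* A :=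
  Polynomial.eval₂RingHom ((algebraMap ℂ A).comp Complex.ofRealHom) x

theorem realEval_apply (x : A) (p : Polynomial ℝ) :
    realEval x p = Polynomial.aeval x (p.map Complex.ofRealHom) := by
  simp [realEval, Polynomial.aeval_def, Polynomial.eval₂_map]

theorem coeff_mk_one_pow (R : Type*) [CommRing R] {d : ℕ} (hd : 0 < d) (m : ℕ) :
    PowerSeries.coeff m ((PowerSeries.mk 1 : PowerSeries R) ^ d) = ((d - 1 + m).choose (d - 1) : R) := by
  obtain ⟨d, rfl⟩ := Nat.exists_eq_succ_of_ne_zero hd.ne'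
  rw [Nat.succ_eq_add_one, PowerSeries.mk_one_pow_eq_mk_choose_add, PowerSeries.coeff_mk,
    Nat.add_sub_cancel]

theorem PowerSeries.X_mul_mk_one_sq (R : Type*) [CommRing R] :
    (PowerSeries.X * (PowerSeries.mk 1) ^ 2 : PowerSeries R) = PowerSeries.mk fun m => (m : R) := by
  ext m
  cases m with
  | zero => simp
  | succ m =>
    rw [mul_comm, PowerSeries.coeff_succ_mul_X, coeff_mk_one_pow R two_pos, PowerSeries.coeff_mk]
    simp [add_comm]

/-- As `y² = 0`, `1/(1 - (1 + y)T) = 1/(1 - T) + yT/(1 - T)²`. The product of these factors is `∑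
(x^m / m!) T^m / (1 - T)^{n+m}` with `x = ∑ y_i`, whose coefficients are the binomials of a Laguerre
polynomial. -/
theorem hZ_one_add_of_sq_eq_zero {n : ℕ} (hn : 0 < n) {y : Fin n → A} (hy : ∀ i, y i ^ 2 = 0)
    (a : ℤ) : hZ (fun i => 1 + y i) a = realEval (∑ i, y i) (lagPoly n a) := by
  cases a with
  | negSucc a => simp [hZ, lagPoly]
  | ofNat a =>
    have h1 : hSeries (fun i => 1 + y i) = ∏ i, ((PowerSeries.mk 1 : PowerSeries A) +
        (PowerSeries.X * (PowerSeries.mk 1) ^ 2) * PowerSeries.C (y i)) := by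
      refine Finset.prod_congr rfl fun i _ => ?_
      rw [PowerSeries.X_mul_mk_one_sq]
      ext m
      rw [map_add, PowerSeries.coeff_mk, PowerSeries.coeff_mk, PowerSeries.coeff_mul_C,
        PowerSeries.coeff_mk]
      cases m with
      | zero => simp
      | succ m => rw [add_pow_of_sq_eq_zero _ (hy i)]; simp
    change PowerSeries.coeff a (hSeries fun i => 1 + y i) = _
    have h0 : (∑ i, y i) ^ (n + 1) = 0 := by
      simpa using sum_pow_card_succ_eq_zero hy (Finset.univ : Finset (Fin n))
    rw [h1, prod_add_mul_of_sq_eq_zero (y := fun i => PowerSeries.C (y i))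
      (fun i => by rw [← map_pow, hy, map_zero]), Finset.card_univ, Fintype.card_fin, ← map_sum]
    set x := ∑ i, y i
    have h2 : ∀ m ∈ Finset.range (n + 1), PowerSeries.coeff a ((m.factorial : ℂ)⁻¹ •
        ((PowerSeries.mk 1 : PowerSeries A) ^ (n - m) * (PowerSeries.X * (PowerSeries.mk 1) ^ 2) ^ m *
          (PowerSeries.C x) ^ m)) = if m ≤ a then
        ((((a + n - 1).choose (m + n - 1) : ℝ) / (m.factorial : ℝ) : ℝ) : ℂ) • x ^ m else 0 := by
      intro m hm
      have hm' : m ≤ n := Nat.lt_succ_iff.mp (Finset.mem_range.mp hm)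
      have e : (PowerSeries.mk 1 : PowerSeries A) ^ (n - m) *
          (PowerSeries.X * (PowerSeries.mk 1) ^ 2) ^ m =
          PowerSeries.X ^ m * (PowerSeries.mk 1) ^ (n + m) := by
        rw [mul_pow, ← pow_mul, mul_left_comm, ← pow_add]
        congr 2
        omega
      rw [e, ← map_pow, PowerSeries.coeff_smul, PowerSeries.coeff_mul_C, PowerSeries.coeff_X_pow_mul']
      split_ifs with hma
      · rw [coeff_mk_one_pow A (by omega), show n + m - 1 + (a - m) = a + n - 1 by omega,
          show n + m - 1 = m + n - 1 by omega]
        push_cast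
        rw [div_eq_inv_mul, mul_smul, Nat.cast_smul_eq_nsmul, nsmul_eq_mul]
      · simp
    rw [map_sum, Finset.sum_congr rfl h2]
    have h3 : realEval x (lagPoly n (Int.ofNat a)) = ∑ m ∈ Finset.range (a + 1),
        ((((a + n - 1).choose (m + n - 1) : ℝ) / (m.factorial : ℝ) : ℝ) : ℂ) • x ^ m := by
      rw [realEval_apply, lagPoly, Polynomial.map_sum, map_sum]
      refine Finset.sum_congr rfl fun m _ => ?_
      simp [Algebra.smul_def]
    rw [h3]
    -- The expansion stops at `m = n` and the Laguerre sum at `m = a`; since `x^{n+1} = 0`, the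
    -- ranges can be reconciled.
    have h4 : ∀ M, n ≤ M → ∑ m ∈ Finset.range (n + 1), (if m ≤ a then
        ((((a + n - 1).choose (m + n - 1) : ℝ) / (m.factorial : ℝ) : ℝ) : ℂ) • x ^ m else 0) =
        ∑ m ∈ Finset.range (M + 1), if m ≤ a then
        ((((a + n - 1).choose (m + n - 1) : ℝ) / (m.factorial : ℝ) : ℝ) : ℂ) • x ^ m else 0 := by
      intro M hM
      refine Finset.sum_subset (Finset.range_subset_range.mpr (by omega)) fun m _ hm => ?_
      have hm' : n + 1 ≤ m := by simpa using hm
      rw [← Nat.sub_add_cancel hm', pow_add, h0, mul_zero, smul_zero, ite_self]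
    rw [h4 (n + a) (by omega), ← Finset.sum_filter]
    congr 1
    ext m
    simp only [Finset.mem_filter, Finset.mem_range]
    omega

end LaguerrePolynomials

/-! ### The universal square-zero algebra and coefficient extraction. -/

section SquareZeroAlgebra

/-- The ideal generated by the squares of the variables. -/
def sqIdeal (n : ℕ) : Ideal (MvPolynomial (Fin n) ℂ) :=
  Ideal.span ((fun s => MvPolynomial.monomial s (1 : ℂ)) '' Set.range fun i : Fin n =>
    Finsupp.single i 2)

/-- The algebra `ℂ[y_1, …, y_n] / (y_1², …, y_n²)`. -/
abbrev SqZero (n : ℕ) : Type := MvPolynomial (Fin n) ℂ ⧸ sqIdeal n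

/-- The generators of `SqZero n`. -/
def sqGen {n : ℕ} (i : Fin n) : SqZero n := Ideal.Quotient.mk (sqIdeal n) (MvPolynomial.X i)

variable {n : ℕ}

theorem sqGen_sq (i : Fin n) : sqGen i ^ 2 = 0 := by
  rw [sqGen, ← map_pow, Ideal.Quotient.eq_zero_iff_mem]
  refine Ideal.subset_span ⟨Finsupp.single i 2, ⟨i, rfl⟩, ?_⟩
  rw [MvPolynomial.X_pow_eq_monomial]

theorem prod_sqGen_ne_zero : ∏ i : Fin n, sqGen i ≠ 0 := by
  classical
  simp only [sqGen]
  rw [← map_prod, Ne, Ideal.Quotient.eq_zero_iff_mem, sqIdeal,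
    MvPolynomial.mem_ideal_span_monomial_image]
  have e : ∏ i : Fin n, (MvPolynomial.X i : MvPolynomial (Fin n) ℂ) =
      MvPolynomial.monomial (Finsupp.equivFunOnFinite.symm fun _ => 1) 1 := by
    rw [MvPolynomial.monomial_eq, Finsupp.prod_fintype _ _ (by simp)]
    simp
  intro h
  obtain ⟨-, ⟨i, rfl⟩, hi⟩ := h (Finsupp.equivFunOnFinite.symm fun _ => 1) (by
    rw [e, MvPolynomial.mem_support_iff, MvPolynomial.coeff_monomial]; simp)
  have := hi i
  simp at this

/-- With `a = 0` and `b = 1`, the product expansion says that `x^n / n!` is the product of the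
generators. -/
theorem sum_sqGen_pow_ne_zero : (∑ i : Fin n, sqGen i) ^ n ≠ 0 := by
  intro h
  have h1 := prod_add_mul_of_sq_eq_zero (sqGen_sq (n := n)) 0 1 Finset.univ
  rw [Finset.card_univ, Fintype.card_fin, Finset.sum_range_succ, h, Finset.sum_eq_zero] at h1
  · apply prod_sqGen_ne_zero (n := n)
    simpa using h1
  · intro m hm
    have : n - m ≠ 0 := by have := Finset.mem_range.mp hm; omega
    rw [zero_pow this, zero_mul, zero_mul, smul_zero]

theorem sum_sqGen_pow_succ : (∑ i : Fin n, sqGen i) ^ (n + 1) = 0 := by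
  simpa using sum_pow_card_succ_eq_zero (sqGen_sq (n := n)) Finset.univ

/-- Coefficient extraction for polynomials in the sum of the generators. -/
theorem exists_coeff_functional {m : ℕ} (hm : m ≤ n) : ∃ l : SqZero n →ₗ[ℂ] ℂ,
    ∀ p : Polynomial ℂ, l (Polynomial.aeval (∑ i, sqGen i) p) = p.coeff m := by
  set x : SqZero n := ∑ i, sqGen i with hx
  have hInt : IsIntegral ℂ x := ⟨Polynomial.X ^ (n + 1), Polynomial.monic_X_pow _, by
    simpa [Polynomial.eval₂_pow] using sum_sqGen_pow_succ (n := n)⟩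
  -- The minimal polynomial divides `X^{n+1}` and `x^n ≠ 0`, so `1, x, …, x^n` are independent and
  -- have dual functionals.
  have hdeg : (minpoly ℂ x).natDegree = n + 1 := by
    have h1 : minpoly ℂ x ∣ Polynomial.X ^ (n + 1) :=
      minpoly.dvd ℂ x (by simpa using sum_sqGen_pow_succ (n := n))
    obtain ⟨i, hi, hass⟩ := (dvd_prime_pow Polynomial.prime_X _).mp h1
    have h2 : minpoly ℂ x = Polynomial.X ^ i :=
      Polynomial.eq_of_monic_of_associated (minpoly.monic hInt) (Polynomial.monic_X_pow i) hass
    have h3 : x ^ i = 0 := by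
      have := minpoly.aeval ℂ x
      rw [h2] at this
      simpa using this
    have h4 : ¬ i ≤ n := fun h => sum_sqGen_pow_ne_zero (n := n) (by
      rw [← hx]
      exact pow_eq_zero_of_le h h3)
    rw [h2, Polynomial.natDegree_X_pow]
    omega
  have hli := linearIndependent_pow (K := ℂ) x
  rw [hdeg] at hli
  obtain ⟨g, hg⟩ := LinearMap.exists_leftInverse_of_injective _
    (LinearMap.ker_eq_bot.mpr hli)
  refine ⟨Finsupp.lapply ⟨m, Nat.lt_succ_of_le hm⟩ ∘ₗ g, fun p => ?_⟩
  have hpow : ∀ j : Fin (n + 1), g (x ^ (j : ℕ)) = Finsupp.single j 1 := fun j => by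
    have := LinearMap.congr_fun hg (Finsupp.single j 1)
    simpa using this
  rw [Polynomial.aeval_eq_sum_range, map_sum]
  simp only [LinearMap.comp_apply, map_smul, Finsupp.lapply_apply, smul_eq_mul]
  have h5 : ∀ j, (g (x ^ j)) ⟨m, Nat.lt_succ_of_le hm⟩ = if j = m then 1 else 0 := by
    intro j
    rcases lt_or_ge j (n + 1) with hj | hj
    · rw [hpow ⟨j, hj⟩, Finsupp.single_apply]
      simp
    · rw [← Nat.sub_add_cancel hj, pow_add, hx, sum_sqGen_pow_succ, mul_zero, map_zero,
        if_neg (by omega)]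
      rfl
  simp only [h5, mul_ite, mul_one, mul_zero, Finset.sum_ite_eq', Finset.mem_range]
  split_ifs with h
  · rfl
  · exact (Polynomial.coeff_eq_zero_of_natDegree_lt (by omega)).symm

end SquareZeroAlgebra

/-! ### Moments of `χ(1)` and `χ'(1) - (N/2)χ(1)`. -/

section Moments

/-- The polynomial `det [L_{N+j-i}^{(2k-1)}(-x)]`. -/
def toeplitzPoly (N k : ℕ) : Polynomial ℝ :=
  (Matrix.of fun i j : Fin k => lagPoly (k + k) ((N : ℤ) + (j : ℕ) - (i : ℕ))).det

/-- The Taylor polynomial of order `n` of `exp (cx)`. -/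
def expPoly (n : ℕ) (c : ℝ) : Polynomial ℝ :=
  ∑ m ∈ Finset.range (n + 1), Polynomial.C (c ^ m / m.factorial) * Polynomial.X ^ m

/-- The value `χ(1)` of `χ(z) = det(1 - zA)`. -/
def chiOne {N : ℕ} (A : Matrix (Fin N) (Fin N) ℂ) : ℂ := A.charpolyRev.eval 1

/-- The combination `χ'(1) - (N/2)χ(1)` for `χ(z) = det(1 - zA)`. -/
def chiDer {N : ℕ} (A : Matrix (Fin N) (Fin N) ℂ) : ℂ :=
  A.charpolyRev.derivative.eval 1 - (N / 2 : ℂ) * A.charpolyRev.eval 1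

/-- Here `χ(1 + y) = χ(1) + χ'(1) y`, and the factor `1 - (N/2) y` shifts the linear term to
`chiDer`. The product over `i` then has the mixed powers of `chiOne` and `chiDer` as coefficients of
`x^m / m!`. -/
theorem prod_sub_mul_aeval_charProdPoly {N k n : ℕ} (A : Matrix (Fin N) (Fin N) ℂ) :
    (∏ i : Fin n, (1 + algebraMap ℂ (SqZero n) (-(N / 2 : ℂ)) * sqGen i)) *
      MvPolynomial.aeval (fun i => 1 + sqGen i) (charProdPoly k n A) =
      Polynomial.aeval (∑ i, sqGen i) (∑ m ∈ Finset.range (n + 1), Polynomial.C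
        ((A.det)⁻¹ ^ k * (chiOne A ^ (n - m) * chiDer A ^ m) / m.factorial) * Polynomial.X ^ m) := by
  have h1 : MvPolynomial.aeval (fun i : Fin n => 1 + sqGen i) (charProdPoly k n A) =
      (A.det)⁻¹ ^ k • ∏ i : Fin n, (algebraMap ℂ (SqZero n) (A.charpolyRev.eval 1) +
        algebraMap ℂ (SqZero n) (A.charpolyRev.derivative.eval 1) * sqGen i) := by
    rw [charProdPoly, map_smul, sepProd, map_prod]
    congr 1
    refine Finset.prod_congr rfl fun i _ => ?_
    rw [← Polynomial.aeval_algHom_apply, MvPolynomial.aeval_X,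
      Polynomial.aeval_add_of_sq_eq_zero _ _ _ (sqGen_sq i)]
    have e : ∀ p : Polynomial ℂ, Polynomial.aeval (1 : SqZero n) p =
        algebraMap ℂ (SqZero n) (p.eval 1) := fun p => by
      rw [← map_one (algebraMap ℂ (SqZero n)), Polynomial.aeval_algebraMap_apply,
        Polynomial.coe_aeval_eq_eval]
    rw [e, e]
  have h2 : ∀ i : Fin n, (1 + algebraMap ℂ (SqZero n) (-(N / 2 : ℂ)) * sqGen i) *
      (algebraMap ℂ (SqZero n) (A.charpolyRev.eval 1) +
        algebraMap ℂ (SqZero n) (A.charpolyRev.derivative.eval 1) * sqGen i) =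
      algebraMap ℂ (SqZero n) (chiOne A) + algebraMap ℂ (SqZero n) (chiDer A) * sqGen i := by
    intro i
    have h := sqGen_sq i
    simp only [chiOne, chiDer, map_sub, map_mul, map_neg]
    linear_combination (-(algebraMap ℂ (SqZero n) (N / 2)) *
      algebraMap ℂ (SqZero n) (A.charpolyRev.derivative.eval 1)) * h
  rw [h1, mul_smul_comm, ← Finset.prod_mul_distrib, Finset.prod_congr rfl fun i _ => h2 i,
    prod_add_mul_of_sq_eq_zero sqGen_sq, Finset.card_univ, Fintype.card_fin, Finset.smul_sum, map_sum]
  refine Finset.sum_congr rfl fun m _ => ?_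
  rw [map_mul (Polynomial.aeval _), Polynomial.aeval_C, map_pow (Polynomial.aeval _),
    Polynomial.aeval_X, ← map_pow, ← map_pow, ← map_mul, ← Algebra.smul_def, ← Algebra.smul_def,
    smul_smul, smul_smul]
  congr 1
  rw [div_eq_inv_mul]
  ring

theorem prod_one_add_eq_realEval_expPoly (n : ℕ) (c : ℝ) :
    ∏ i : Fin n, (1 + algebraMap ℂ (SqZero n) (c : ℂ) * sqGen i) =
      realEval (∑ i, sqGen i) (expPoly n c) := by
  rw [prod_add_mul_of_sq_eq_zero sqGen_sq, Finset.card_univ, Fintype.card_fin, realEval_apply,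
    expPoly, Polynomial.map_sum, map_sum]
  refine Finset.sum_congr rfl fun m _ => ?_
  simp only [one_pow, one_mul, Polynomial.map_mul, Polynomial.map_C, Polynomial.map_pow,
    Polynomial.map_X]
  rw [map_mul (Polynomial.aeval _), Polynomial.aeval_C, map_pow (Polynomial.aeval _),
    Polynomial.aeval_X, ← map_pow, ← Algebra.smul_def, ← Algebra.smul_def, smul_smul]
  congr 1
  simp [div_eq_inv_mul]

theorem aeval_avgPoly_eq_realEval (N k : ℕ) :
    MvPolynomial.aeval (fun i : Fin (k + k) => 1 + sqGen i) (avgPoly N k (k + k)) =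
      (-1 : ℂ) ^ (N * k) • realEval (∑ i : Fin (k + k), sqGen i) (toeplitzPoly N k) := by
  rw [avgPoly_eq_det, map_smul]
  congr 1
  rw [AlgHom.map_det, toeplitzPoly, RingHom.map_det]
  congr 1
  ext i j
  have hk : 0 < k + k := by have := i.2; omega
  simp only [AlgHom.mapMatrix_apply, RingHom.mapMatrix_apply, Matrix.map_apply, Matrix.of_apply]
  rw [← hZ_one_add_of_sq_eq_zero hk sqGen_sq]
  have := hZ_map (MvPolynomial.aeval fun i : Fin (k + k) => 1 + sqGen i).toRingHom
    (fun i => (MvPolynomial.X i : MvPolynomial (Fin (k + k)) ℂ)) ((N : ℤ) + (j : ℕ) - (i : ℕ))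
  simpa using this

/-- The moments of `χ(1)` and `χ'(1) - (N/2)χ(1)`. -/
theorem integral_chi_moment (N k : ℕ) {m : ℕ} (hm : m ≤ k + k) :
    ∫ U : Matrix.unitaryGroup (Fin N) ℂ,
      (U.1.det)⁻¹ ^ k * (chiOne U.1 ^ (k + k - m) * chiDer U.1 ^ m) ∂(haarU N) =
    (-1) ^ (N * k) * (m.factorial *
      ((expPoly (k + k) (-(N / 2)) * toeplitzPoly N k).coeff m : ℝ)) := by
  obtain ⟨l, hl⟩ := exists_coeff_functional hm
  let L : MvPolynomial (Fin (k + k)) ℂ →ₗ[ℂ] ℂ := l ∘ₗ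
    LinearMap.mulLeft ℂ (∏ i : Fin (k + k),
      (1 + algebraMap ℂ (SqZero (k + k)) (-(N / 2 : ℂ)) * sqGen i)) ∘ₗ
    (MvPolynomial.aeval fun i : Fin (k + k) => 1 + sqGen i).toLinearMap
  have hL : ∀ p, L p = l ((∏ i : Fin (k + k),
      (1 + algebraMap ℂ (SqZero (k + k)) (-(N / 2 : ℂ)) * sqGen i)) *
      MvPolynomial.aeval (fun i => 1 + sqGen i) p) := fun p => rfl
  -- The functional `L` is computed twice: under the integral it gives the moment, on the Toeplitz
  -- determinant it gives a coefficient.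
  have h1 := linearMap_avgPoly (N := N) k L
  have hf : (m.factorial : ℂ) ≠ 0 := Nat.cast_ne_zero.mpr m.factorial_ne_zero
  have h2 : ∀ U : Matrix.unitaryGroup (Fin N) ℂ, L (charProdPoly k (k + k) U.1) =
      (m.factorial : ℂ)⁻¹ * ((U.1.det)⁻¹ ^ k * (chiOne U.1 ^ (k + k - m) * chiDer U.1 ^ m)) := by
    intro U
    rw [hL, prod_sub_mul_aeval_charProdPoly, hl, Polynomial.finsetSum_coeff]
    simp only [Polynomial.coeff_C_mul_X_pow, Finset.sum_ite_eq, Finset.mem_range]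
    rw [if_pos (by omega), div_eq_inv_mul]
  have h3 : L (avgPoly N k (k + k)) = (-1) ^ (N * k) *
      ((expPoly (k + k) (-(N / 2)) * toeplitzPoly N k).coeff m : ℝ) := by
    rw [hL, aeval_avgPoly_eq_realEval, mul_smul_comm, map_smul, smul_eq_mul]
    congr 1
    have h4 := prod_one_add_eq_realEval_expPoly (k + k) (-(N / 2))
    rw [show ((-(N / 2 : ℝ) : ℝ) : ℂ) = -(N / 2 : ℂ) by push_cast; rfl] at h4
    rw [h4, ← map_mul, realEval_apply, hl, Polynomial.coeff_map]
    rfl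
  simp only [h2] at h1
  rw [integral_const_mul, h3] at h1
  rw [eq_inv_mul_iff_mul_eq₀ hf] at h1
  rw [← h1]
  ring

end Moments

/-! ### The Laguerre determinant and the derivatives of `f_k` at zero. -/

section LaguerreDet

theorem sign_revPerm (k : ℕ) :
    ((Equiv.Perm.sign (Fin.revPerm : Equiv.Perm (Fin k)) : ℤ) : ℝ) = (-1) ^ (k * (k - 1) / 2) := by
  rw [Equiv.Perm.sign_eq_prod_prod_Iio]
  have h : ∀ j : Fin k, ∏ i ∈ Finset.Iio j, (if (Fin.revPerm i : Fin k) < Fin.revPerm j then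
      (1 : ℤˣ) else -1) = (-1) ^ (j : ℕ) := by
    intro j
    rw [Finset.prod_congr rfl (g := fun _ => (-1 : ℤˣ)), Finset.prod_const, Fin.card_Iio]
    intro i hi
    rw [if_neg]
    simp only [Fin.revPerm_apply, Fin.rev_lt_rev, not_lt]
    exact (Finset.mem_Iio.mp hi).le
  rw [Finset.prod_congr rfl fun j _ => h j, Finset.prod_pow_eq_pow_sum,
    Fin.sum_univ_eq_sum_range fun i => i, Finset.sum_range_id]
  push_cast
  rfl

/-- Reversing the columns turns the Hankel index `N + k - 1 - (i + j)` into the Toeplitz index `N +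
j - i`. The sign of the reversal is the sign in `f_k`. -/
theorem laguerreDet_eq (N k : ℕ) (x : ℝ) :
    laguerreDet N k x = (-1) ^ (k * (k - 1) / 2) * (toeplitzPoly N k).eval x := by
  rw [← sign_revPerm, toeplitzPoly, ← Polynomial.coe_evalRingHom, RingHom.map_det,
    ← Matrix.det_permute', laguerreDet]
  congr 1
  ext i j
  have hk : 0 < k + k := by have := i.2; omega
  simp only [Matrix.of_apply, Matrix.submatrix_apply, RingHom.mapMatrix_apply, Matrix.map_apply, id,
    Polynomial.coe_evalRingHom, eval_lagPoly hk, Fin.revPerm_apply, Fin.val_rev]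
  congr 1
  · push_cast; ring
  · have := j.2; omega

theorem fLag_eq (N k : ℕ) :
    fLag N k = fun x => Real.exp (-((N : ℝ) / 2) * x) * (toeplitzPoly N k).eval x := by
  funext x
  have h : ((-1 : ℝ) ^ (k * (k - 1) / 2)) * (-1) ^ (k * (k - 1) / 2) = 1 := by
    rw [← mul_pow]; simp
  rw [fLag, laguerreDet_eq]
  linear_combination (Real.exp (-((N : ℝ) / 2) * x) * (toeplitzPoly N k).eval x) * h

theorem Polynomial.iteratedDeriv_eval (p : Polynomial ℝ) (m : ℕ) :
    iteratedDeriv m (fun x => p.eval x) = fun x => (Polynomial.derivative^[m] p).eval x := by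
  induction m with
  | zero => rfl
  | succ m ih =>
    rw [iteratedDeriv_succ, ih, Function.iterate_succ_apply']
    funext x
    rw [Polynomial.deriv]

theorem iteratedDeriv_fLag (N k : ℕ) {m : ℕ} (hm : m ≤ k + k) :
    iteratedDeriv m (fLag N k) 0 =
      m.factorial * (expPoly (k + k) (-(N / 2)) * toeplitzPoly N k).coeff m := by
  have h1 : ContDiff ℝ m fun x : ℝ => Real.exp (-((N : ℝ) / 2) * x) := by fun_prop
  have h2 : ContDiff ℝ m fun x : ℝ => (toeplitzPoly N k).eval x := by
    simpa using (toeplitzPoly N k).contDiff_aeval (𝕜 := ℝ) m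
  have h := iteratedDeriv_mul (x := (0 : ℝ)) h1.contDiffAt h2.contDiffAt
  rw [fLag_eq]
  refine h.trans ?_
  rw [Polynomial.coeff_mul, Finset.Nat.sum_antidiagonal_eq_sum_range_succ fun a b =>
    (expPoly (k + k) (-(N / 2))).coeff a * (toeplitzPoly N k).coeff b, Finset.mul_sum]
  refine Finset.sum_congr rfl fun i hi => ?_
  have hi' : i ≤ m := Nat.lt_succ_iff.mp (Finset.mem_range.mp hi)
  have e : (expPoly (k + k) (-(N / 2))).coeff i = (-(N / 2)) ^ i / (i.factorial : ℝ) := by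
    rw [expPoly, Polynomial.finsetSum_coeff]
    simp only [Polynomial.coeff_C_mul_X_pow, Finset.sum_ite_eq, Finset.mem_range]
    rw [if_pos (by omega)]
  rw [iteratedDeriv_exp_const_mul, Polynomial.iteratedDeriv_eval, e]
  simp only []
  rw [← Polynomial.coeff_zero_eq_eval_zero, Polynomial.coeff_iterate_derivative, zero_add,
    Nat.descFactorial_self, Nat.cast_choose ℝ hi']
  have h3 : (i.factorial : ℝ) ≠ 0 := Nat.cast_ne_zero.mpr i.factorial_ne_zero
  have h4 : ((m - i).factorial : ℝ) ≠ 0 := Nat.cast_ne_zero.mpr (m - i).factorial_ne_zero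
  simp only [mul_zero, Real.exp_zero, nsmul_eq_mul]
  field_simp

end LaguerreDet

/-! ### Reality of `V_U` and the joint moment. -/

section CharV

variable {N : ℕ}

theorem exp_eigenangle {z : ℂ} (hz : ‖z‖ = 1) :
    Complex.exp (Complex.I * (toIcoMod Real.two_pi_pos 0 (Complex.arg z) : ℝ)) = z := by
  rw [← self_sub_toIcoDiv_zsmul]
  have h : Complex.I * ((Complex.arg z - toIcoDiv Real.two_pi_pos 0 (Complex.arg z) •
      (2 * Real.pi) : ℝ) : ℂ) = (Complex.arg z : ℂ) * Complex.I -
        (toIcoDiv Real.two_pi_pos 0 (Complex.arg z) : ℤ) * (2 * Real.pi * Complex.I) := by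
    push_cast [zsmul_eq_mul]
    ring
  rw [h, Complex.exp_periodic.sub_int_mul_eq]
  have := Complex.norm_mul_exp_arg_mul_I z
  rwa [hz, Complex.ofReal_one, one_mul] at this

theorem card_eigenangles (U : Matrix.unitaryGroup (Fin N) ℂ) : (eigenangles U).card = N := by
  rw [eigenangles, Multiset.card_map, card_eigenvaluesU]

theorem charZ_eq (U : Matrix.unitaryGroup (Fin N) ℂ) (θ : ℝ) :
    charZ U θ = U.1.charpolyRev.eval (Complex.exp (-(Complex.I * θ))) := by
  rw [eval_charpolyRev_eq_det, det_one_sub_smul_eq_prod, charZ, eigenangles, Multiset.map_map]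
  congr 1
  refine Multiset.map_congr rfl fun z hz => ?_
  simp only [Function.comp]
  rw [mul_sub, sub_eq_neg_add _ (Complex.I * (θ : ℂ)), Complex.exp_add,
    exp_eigenangle (norm_eq_one_of_mem_eigenvaluesU U hz)]

/-- The phase `exp(iNπ/2 - i∑θ_n/2)`. -/
def phaseU (U : Matrix.unitaryGroup (Fin N) ℂ) : ℂ :=
  Complex.exp (Complex.I * N * (Real.pi / 2) -
    Complex.I * ((eigenangles U).map fun t : ℝ => (t : ℂ) / 2).sum)

theorem charV_eq (U : Matrix.unitaryGroup (Fin N) ℂ) (θ : ℝ) :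
    charV U θ = phaseU U * (Complex.exp (Complex.I * N / 2 * θ) *
      U.1.charpolyRev.eval (Complex.exp (-(Complex.I * θ)))) := by
  rw [charV, charZ_eq, phaseU, ← mul_assoc, ← Complex.exp_add]
  congr 2
  ring

theorem charV_zero (U : Matrix.unitaryGroup (Fin N) ℂ) : charV U 0 = phaseU U * chiOne U.1 := by
  rw [charV_eq, chiOne]
  simp

/-- Differentiating `e^{iNθ/2} χ(e^{-iθ})` at `0` produces the combination `chiDer`; the half-angle
phase accounts for its `N/2`. -/
theorem hasDerivAt_charV (U : Matrix.unitaryGroup (Fin N) ℂ) :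
    HasDerivAt (charV U) (phaseU U * (-Complex.I * chiDer U.1)) 0 := by
  have h0 : charV U = fun θ : ℝ => phaseU U * (Complex.exp (Complex.I * N / 2 * θ) *
      U.1.charpolyRev.eval (Complex.exp (-(Complex.I * θ)))) := funext fun θ => charV_eq U θ
  rw [h0]
  have h1 : HasDerivAt (fun w : ℂ => Complex.exp (Complex.I * N / 2 * w))
      (Complex.I * N / 2) 0 := by
    have := ((hasDerivAt_id (0 : ℂ)).const_mul (Complex.I * N / 2)).cexp
    simpa using this
  have h2 : HasDerivAt (fun w : ℂ => Complex.exp (-(Complex.I * w))) (-Complex.I) 0 := by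
    have := ((hasDerivAt_id (0 : ℂ)).const_mul Complex.I).neg.cexp
    simpa using this
  have h3 : HasDerivAt (fun w : ℂ => U.1.charpolyRev.eval (Complex.exp (-(Complex.I * w))))
      (U.1.charpolyRev.derivative.eval 1 * -Complex.I) 0 := by
    have h4 := U.1.charpolyRev.hasDerivAt (Complex.exp (-(Complex.I * 0)))
    have h5 := h4.comp (0 : ℂ) h2
    refine h5.congr_deriv ?_
    simp
  have h6 := ((h1.fun_mul h3).const_mul (phaseU U)).comp_ofReal (z := 0)
  refine h6.congr_deriv ?_
  rw [chiDer]
  simp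
  ring

/-- The determinant is the product of the eigenvalues. The `2k`-th power of the phase is thus the
factor `det(U)^{-k}` of `charProd`, up to sign. -/
theorem phaseU_sq (U : Matrix.unitaryGroup (Fin N) ℂ) :
    phaseU U ^ 2 = (-1) ^ N * (U.1.det)⁻¹ := by
  have h1 : U.1.det = ((eigenangles U).map fun t : ℝ => Complex.exp (Complex.I * t)).prod := by
    rw [Matrix.det_eq_prod_roots_charpoly, eigenangles, Multiset.map_map]
    conv_lhs => rw [← Multiset.map_id (U.1.charpoly.roots)]
    congr 1
    refine Multiset.map_congr rfl fun z hz => ?_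
    exact (exp_eigenangle (norm_eq_one_of_mem_eigenvaluesU U hz)).symm
  have h2 : ((eigenangles U).map fun t : ℝ => Complex.exp (Complex.I * t)).prod =
      Complex.exp (2 * (Complex.I * ((eigenangles U).map fun t : ℝ => (t : ℂ) / 2).sum)) := by
    rw [← Multiset.sum_map_mul_left, ← Multiset.sum_map_mul_left, Complex.exp_multiset_sum,
      Multiset.map_map]
    congr 1
    refine Multiset.map_congr rfl fun t _ => ?_
    simp only [Function.comp]
    congr 1
    ring
  rw [h1, h2, phaseU, ← Complex.exp_nat_mul, ← Complex.exp_neg, ← Complex.exp_pi_mul_I,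
    ← Complex.exp_nat_mul, ← Complex.exp_add]
  congr 1
  push_cast
  ring

/-- Distributing the phase over the eigenangles turns each factor into `2 sin((θ_n - θ)/2)`. -/
theorem charV_im (U : Matrix.unitaryGroup (Fin N) ℂ) (θ : ℝ) : (charV U θ).im = 0 := by
  have h1 : charV U θ = (((eigenangles U).map fun t : ℝ => 2 * Real.sin ((t - θ) / 2)).prod : ℝ) := by
    have e1 : Complex.I * N * (((θ : ℂ) + Real.pi) / 2) -
        Complex.I * ((eigenangles U).map fun t : ℝ => (t : ℂ) / 2).sum =
        ((eigenangles U).map fun t : ℝ => Complex.I * (((θ : ℂ) + Real.pi) / 2) -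
          Complex.I * ((t : ℂ) / 2)).sum := by
      rw [Multiset.sum_map_sub, Multiset.map_const', Multiset.sum_replicate, card_eigenangles,
        Multiset.sum_map_mul_left, nsmul_eq_mul]
      ring
    rw [charV, charZ, e1, Complex.exp_multiset_sum, Multiset.map_map, ← Multiset.prod_map_mul,
      ← Complex.ofRealHom_eq_coe (Multiset.prod _), map_multiset_prod, Multiset.map_map]
    congr 1
    refine Multiset.map_congr rfl fun t _ => ?_
    simp only [Function.comp, Complex.ofRealHom_eq_coe]
    push_cast
    rw [Complex.sin, mul_sub, mul_one, ← Complex.exp_add]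
    have e2 : Complex.I * (((θ : ℂ) + Real.pi) / 2) - Complex.I * ((t : ℂ) / 2) =
        -(((t : ℂ) - θ) / 2) * Complex.I + Real.pi / 2 * Complex.I := by ring
    have e3 : Complex.I * (((θ : ℂ) + Real.pi) / 2) - Complex.I * ((t : ℂ) / 2) +
        Complex.I * ((t : ℂ) - θ) = (((t : ℂ) - θ) / 2) * Complex.I + Real.pi / 2 * Complex.I := by
      ring
    rw [e3, e2, Complex.exp_add, Complex.exp_add, Complex.exp_pi_div_two_mul_I]
    ring
  rw [h1, Complex.ofReal_im]

theorem deriv_charV_im (U : Matrix.unitaryGroup (Fin N) ℂ) : (deriv (charV U) 0).im = 0 := by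
  have h1 := (hasDerivAt_charV U).differentiableAt.hasDerivAt
  have h2 := Complex.imCLM.hasFDerivAt.comp_hasDerivAt (0 : ℝ) h1
  have h3 : (Complex.imCLM ∘ charV U) = fun _ => (0 : ℝ) := funext fun θ => charV_im U θ
  rw [h3] at h2
  exact h2.unique (hasDerivAt_const (0 : ℝ) (0 : ℝ))

/-- The product `V(0)^{2k-m} V'(0)^m`. -/
def charVProd (k m : ℕ) (U : Matrix.unitaryGroup (Fin N) ℂ) : ℝ :=
  (charV U 0).re ^ (k + k - m) * (deriv (charV U) 0).re ^ m

theorem charVProd_eq {k m : ℕ} (hm : m ≤ k + k) (U : Matrix.unitaryGroup (Fin N) ℂ) :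
    (charVProd k m U : ℂ) = (-1) ^ (N * k) * (-Complex.I) ^ m *
      ((U.1.det)⁻¹ ^ k * (chiOne U.1 ^ (k + k - m) * chiDer U.1 ^ m)) := by
  have h1 : (((charV U 0).re : ℝ) : ℂ) = charV U 0 := Complex.ext (by simp) (by simp [charV_im])
  have h2 : (((deriv (charV U) 0).re : ℝ) : ℂ) = deriv (charV U) 0 :=
    Complex.ext (by simp) (by simp [deriv_charV_im])
  have h3 : phaseU U ^ (k + k) = (-1) ^ (N * k) * (U.1.det)⁻¹ ^ k := by
    rw [← two_mul, pow_mul, phaseU_sq, mul_pow, ← pow_mul]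
  rw [charVProd]
  push_cast
  rw [h1, h2, charV_zero, (hasDerivAt_charV U).deriv, mul_pow, mul_pow, mul_pow]
  calc _ = phaseU U ^ (k + k - m) * phaseU U ^ m * (-Complex.I) ^ m *
        (chiOne U.1 ^ (k + k - m) * chiDer U.1 ^ m) := by ring
    _ = _ := by
      rw [← pow_add, Nat.sub_add_cancel hm, h3]
      ring

theorem integral_charVProd (N : ℕ) {k m : ℕ} (hm : m ≤ k + k) :
    ((∫ U : Matrix.unitaryGroup (Fin N) ℂ, charVProd k m U ∂(haarU N) : ℝ) : ℂ) =
      (-Complex.I) ^ m * (iteratedDeriv m (fLag N k) 0 : ℝ) := by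
  rw [← integral_complex_ofReal]
  simp only [charVProd_eq hm]
  rw [integral_const_mul, integral_chi_moment N k hm, iteratedDeriv_fLag N k hm]
  have : ((-1 : ℂ) ^ (N * k)) * (-1) ^ (N * k) = 1 := by rw [← mul_pow]; simp
  push_cast
  linear_combination ((-Complex.I) ^ m * ((m.factorial : ℂ) *
    ((expPoly (k + k) (-(N / 2)) * toeplitzPoly N k).coeff m : ℝ))) * this

theorem continuous_chiDer : Continuous fun A : Matrix (Fin N) (Fin N) ℂ => chiDer A := by
  have h1 : ∀ A : Matrix (Fin N) (Fin N) ℂ, chiDer A =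
      ∑ r ∈ Finset.range (N + 1), A.charpolyRev.coeff (r + 1) * (r + 1) -
        (N / 2 : ℂ) * ∑ r ∈ Finset.range (N + 1), A.charpolyRev.coeff r := by
    intro A
    have hd := natDegree_charpolyRev_le A
    have hd' := Polynomial.natDegree_derivative_le A.charpolyRev
    rw [chiDer, Polynomial.eval_eq_sum_range' (p := A.charpolyRev) (n := N + 1) (by omega),
      Polynomial.eval_eq_sum_range' (n := N + 1) (by omega)]
    simp [Polynomial.coeff_derivative]
  simp only [h1]
  exact (continuous_finsetSum _ fun r _ => (continuous_coeff_charpolyRev _).mul continuous_const).sub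
    (continuous_const.mul (continuous_finsetSum _ fun r _ => continuous_coeff_charpolyRev _))

/-- Continuity is read off `charVProd_eq`, in which the phase, defined through a choice of
eigenangles, occurs only as a power of `det U`. -/
theorem integrable_charVProd (N : ℕ) {k m : ℕ} (hm : m ≤ k + k) :
    Integrable (charVProd (N := N) k m) (haarU N) := by
  have h1 : Continuous fun U : Matrix.unitaryGroup (Fin N) ℂ => (charVProd k m U : ℂ) := by
    simp only [charVProd_eq hm]
    have hdet : Continuous fun U : Matrix.unitaryGroup (Fin N) ℂ => (U.1.det)⁻¹ :=
      Continuous.inv₀ continuous_subtype_val.matrix_det fun U => (isUnit_det_unitaryGroup U).ne_zero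
    have hone : Continuous fun U : Matrix.unitaryGroup (Fin N) ℂ => chiOne U.1 := by
      simp only [chiOne, eval_charpolyRev_eq_det]
      have h : Continuous fun U : Matrix.unitaryGroup (Fin N) ℂ =>
        (1 - (1 : ℂ) • (U : Matrix (Fin N) (Fin N) ℂ)) := by fun_prop
      exact h.matrix_det
    exact continuous_const.mul ((hdet.pow k).mul ((hone.pow _).mul
      ((continuous_chiDer.comp continuous_subtype_val).pow m)))
  simpa using h1.integrable_haarU.re

theorem momentIntegrand_eq (N : ℕ) {h k : ℕ} (hk : h ≤ k) :
    momentIntegrand N h k = charVProd (N := N) k (2 * h) := by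
  funext U
  have h1 : ‖charV U 0‖ = |(charV U 0).re| := by
    rw [← Real.norm_eq_abs, ← Complex.norm_real]
    congr 1
    exact Complex.ext (by simp) (by simp [charV_im])
  have h2 : ‖deriv (charV U) 0‖ = |(deriv (charV U) 0).re| := by
    rw [← Real.norm_eq_abs, ← Complex.norm_real]
    congr 1
    exact Complex.ext (by simp) (by simp [deriv_charV_im])
  have e1 : 2 * (k : ℝ) - 2 * (h : ℝ) = ((2 * (k - h) : ℕ) : ℝ) := by
    push_cast [hk]; ring
  have e2 : 2 * (h : ℝ) = ((2 * h : ℕ) : ℝ) := by push_cast; ring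
  rw [momentIntegrand, charVProd, e1, e2, Real.rpow_natCast, Real.rpow_natCast, h1, h2,
    (even_two_mul _).pow_abs, (even_two_mul _).pow_abs, show k + k - 2 * h = 2 * (k - h) by omega]

/-- The average of `charVProd` is real, but for odd `m` it equals `±i` times the real derivative. -/
theorem iteratedDeriv_fLag_odd (N : ℕ) {k m : ℕ} (hm : m ≤ k + k) (hodd : Odd m) :
    iteratedDeriv m (fLag N k) 0 = 0 := by
  have h := congrArg Complex.im (integral_charVProd N hm)
  obtain ⟨r, rfl⟩ := hodd
  rw [pow_succ, pow_mul, neg_sq, Complex.I_sq, Complex.ofReal_im] at h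
  rcases neg_one_pow_eq_or ℂ r with h1 | h1 <;> rw [h1] at h <;> simpa using h.symm

end CharV

/-! ### The kernel `K_n` and its limit as `ε → 0`. -/

section CauchyKernel

open scoped ContDiff

/-- The function `y ↦ (ε + iy)^{-m}`. -/
def cauchyPow (ε : ℝ) (m : ℕ) (y : ℝ) : ℂ := ((ε : ℂ) + y * Complex.I)⁻¹ ^ m

theorem add_mul_I_ne_zero {ε : ℝ} (hε : 0 < ε) (y : ℝ) : (ε : ℂ) + y * Complex.I ≠ 0 := by
  intro h
  have := congrArg Complex.re h
  simp at this
  exact hε.ne' this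

theorem hasDerivAt_inv_pow {E : Type*} [NontriviallyNormedField E] [NormedAlgebra E ℂ] {c : E → ℂ}
    {c' : ℂ} {t : E} (hc : HasDerivAt c c' t) (h0 : c t ≠ 0) (m : ℕ) :
    HasDerivAt (fun s => (c s)⁻¹ ^ m) (-(m * c' * (c t)⁻¹ ^ (m + 1))) t := by
  have h1 : HasDerivAt (fun s => (c s)⁻¹) ((c t)⁻¹ * -(c' * (c t)⁻¹)) t := by
    refine (hc.fun_inv h0).congr_deriv ?_
    field_simp
  have h2 := HasDerivAt.finset_prod_log (Finset.range m) (f := fun _ s => (c s)⁻¹)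
    (a := fun _ => -(c' * (c t)⁻¹)) fun _ _ => h1
  simp only [Finset.prod_const, Finset.card_range, Finset.sum_const, nsmul_eq_mul] at h2
  exact h2.congr_deriv (by ring)

theorem hasDerivAt_cauchyPow {ε : ℝ} (hε : 0 < ε) (m : ℕ) (y : ℝ) :
    HasDerivAt (cauchyPow ε m) (-(m * Complex.I * cauchyPow ε (m + 1) y)) y := by
  have h1 : HasDerivAt (fun y : ℝ => (ε : ℂ) + y * Complex.I) Complex.I y := by
    have h := (((hasDerivAt_id (y : ℂ)).mul_const Complex.I).const_add (ε : ℂ)).comp_ofReal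
    simpa using h
  exact hasDerivAt_inv_pow h1 (add_mul_I_ne_zero hε y) m

theorem hasDerivAt_cauchyPow_re {ε : ℝ} (hε : 0 < ε) (m : ℕ) (y : ℝ) :
    HasDerivAt (fun y => (cauchyPow ε m y).re) (m * (cauchyPow ε (m + 1) y).im) y := by
  have h := Complex.reCLM.hasFDerivAt.comp_hasDerivAt y (hasDerivAt_cauchyPow hε m y)
  exact h.congr_deriv (by simp)

theorem hasDerivAt_cauchyPow_im {ε : ℝ} (hε : 0 < ε) (m : ℕ) (y : ℝ) :
    HasDerivAt (fun y => (cauchyPow ε m y).im) (-(m * (cauchyPow ε (m + 1) y).re)) y := by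
  have h := Complex.imCLM.hasFDerivAt.comp_hasDerivAt y (hasDerivAt_cauchyPow hε m y)
  exact h.congr_deriv (by simp)

theorem cauchyPow_zero_im (ε : ℝ) (m : ℕ) : (cauchyPow ε m 0).im = 0 := by
  have : cauchyPow ε m 0 = ((ε⁻¹ ^ m : ℝ) : ℂ) := by simp [cauchyPow]
  rw [this, Complex.ofReal_im]

theorem cauchyPow_one_re (ε y : ℝ) : (cauchyPow ε 1 y).re = ε / (ε ^ 2 + y ^ 2) := by
  simp [cauchyPow, Complex.inv_re, Complex.normSq_apply, pow_two]

/-- Since `ε/(ε² + y²) = Re (ε + iy)^{-1}`, differentiating in `ε` raises the power. -/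
theorem iteratedDeriv_cauchy (n : ℕ) (y : ℝ) {ε : ℝ} (hε : 0 < ε) :
    iteratedDeriv n (fun e : ℝ => e / (e ^ 2 + y ^ 2)) ε =
      (-1) ^ n * n.factorial * (cauchyPow ε (n + 1) y).re := by
  induction n generalizing ε with
  | zero => simp [cauchyPow_one_re]
  | succ n ih =>
    rw [iteratedDeriv_succ]
    have h1 : iteratedDeriv n (fun e : ℝ => e / (e ^ 2 + y ^ 2)) =ᶠ[𝓝 ε]
        fun e => (-1) ^ n * n.factorial * (cauchyPow e (n + 1) y).re := by
      filter_upwards [lt_mem_nhds hε] with e he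
      exact ih he
    rw [h1.deriv_eq]
    have h2 : HasDerivAt (fun e : ℝ => (e : ℂ) + y * Complex.I) 1 ε := by
      have h := ((hasDerivAt_id (ε : ℂ)).add_const (y * Complex.I)).comp_ofReal
      simpa using h
    have h3 := hasDerivAt_inv_pow h2 (add_mul_I_ne_zero hε y) (n + 1)
    have h4 := (Complex.reCLM.hasFDerivAt.comp_hasDerivAt ε h3).const_mul
      ((-1 : ℝ) ^ n * n.factorial)
    refine (h4.congr_deriv ?_).deriv
    rw [Nat.factorial_succ, mul_one]
    change _ * (-(((n + 1 : ℕ) : ℂ) * cauchyPow ε (n + 1 + 1) y)).re = _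
    rw [Complex.neg_re, ← Complex.ofReal_natCast, Complex.re_ofReal_mul]
    push_cast
    ring

theorem kernelK_eq (n : ℕ) {ε : ℝ} (hε : 0 < ε) (y : ℝ) :
    kernelK n ε y = n.factorial / Real.pi * (cauchyPow ε (n + 1) y).re := by
  rw [kernelK, iteratedDeriv_cauchy n y hε]
  have : ((-1 : ℝ) ^ n) * (-1) ^ n = 1 := by rw [← mul_pow]; simp
  linear_combination (n.factorial / Real.pi * (cauchyPow ε (n + 1) y).re) * this

/-- Continuous functions that decay at least like `1 / (1 + y²)`. -/
def SqDecay (u : ℝ → ℝ) : Prop := Continuous u ∧ ∃ C, ∀ y, |u y| ≤ C * (1 + y ^ 2)⁻¹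

theorem inv_add_sq_le {ε : ℝ} (hε : 0 < ε) (y : ℝ) :
    (ε ^ 2 + y ^ 2)⁻¹ ≤ (1 + (ε ^ 2)⁻¹) * (1 + y ^ 2)⁻¹ := by
  have h1 : 0 < ε ^ 2 := by positivity
  rw [← div_eq_mul_inv, inv_eq_one_div, div_le_div_iff₀ (by positivity) (by positivity)]
  have h2 : (ε ^ 2)⁻¹ * ε ^ 2 = 1 := inv_mul_cancel₀ h1.ne'
  have h3 : 0 ≤ (ε ^ 2)⁻¹ * y ^ 2 := by positivity
  nlinarith [sq_nonneg y]

theorem norm_cauchyPow_le {ε : ℝ} (hε : 0 < ε) (m : ℕ) (y : ℝ) :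
    ‖cauchyPow ε (m + 2) y‖ ≤ ε⁻¹ ^ m * (1 + (ε ^ 2)⁻¹) * (1 + y ^ 2)⁻¹ := by
  have h0 : ‖(ε : ℂ) + y * Complex.I‖ ^ 2 = ε ^ 2 + y ^ 2 := by
    rw [← Complex.normSq_eq_norm_sq, Complex.normSq_add_mul_I]
  have h1 : ε ≤ ‖(ε : ℂ) + y * Complex.I‖ := by
    have := Complex.abs_re_le_norm ((ε : ℂ) + y * Complex.I)
    simp at this
    exact (le_abs_self ε).trans this
  rw [cauchyPow, norm_pow, norm_inv, pow_add, inv_pow _ 2, h0, mul_assoc]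
  exact mul_le_mul (pow_le_pow_left₀ (by positivity) (inv_anti₀ hε h1) m) (inv_add_sq_le hε y)
    (by positivity) (by positivity)

theorem continuous_cauchyPow {ε : ℝ} (hε : 0 < ε) (m : ℕ) : Continuous (cauchyPow ε m) :=
  continuous_iff_continuousAt.mpr fun y => (hasDerivAt_cauchyPow hε m y).continuousAt

theorem sqDecay_cauchyPow_im {ε : ℝ} (hε : 0 < ε) (m : ℕ) :
    SqDecay fun y => (cauchyPow ε (m + 2) y).im :=
  ⟨Complex.continuous_im.comp (continuous_cauchyPow hε _), _, fun y =>
    (Complex.abs_im_le_norm _).trans (norm_cauchyPow_le hε m y)⟩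

theorem sqDecay_cauchyPow_re {ε : ℝ} (hε : 0 < ε) (m : ℕ) :
    SqDecay fun y => (cauchyPow ε (m + 1) y).re := by
  refine ⟨Complex.continuous_re.comp (continuous_cauchyPow hε _), ?_⟩
  cases m with
  -- The first power itself decays only like `1/|y|`; its real part gains a further factor.
  | zero =>
    refine ⟨ε * (1 + (ε ^ 2)⁻¹), fun y => ?_⟩
    change |(cauchyPow ε (0 + 1) y).re| ≤ _
    rw [zero_add, cauchyPow_one_re, abs_of_nonneg (by positivity), div_eq_mul_inv, mul_assoc]
    exact mul_le_mul_of_nonneg_left (inv_add_sq_le hε y) hε.le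
  | succ m =>
    exact ⟨_, fun y => (Complex.abs_re_le_norm _).trans (norm_cauchyPow_le hε m y)⟩

theorem SqDecay.integrableOn_mul {u F : ℝ → ℝ} (hu : SqDecay u) (hF : Continuous F)
    {B : ℝ} (hB : ∀ y, 0 ≤ y → |F y| ≤ B) : IntegrableOn (fun y => u y * F y) (Set.Ioi 0) := by
  obtain ⟨hc, C, hC⟩ := hu
  have h1 : IntegrableOn (fun y : ℝ => C * B * (1 + y ^ 2)⁻¹) (Set.Ioi 0) :=
    (integrable_inv_one_add_sq.const_mul _).integrableOn
  refine Integrable.mono' h1 (hc.mul hF).aestronglyMeasurable ?_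
  filter_upwards [ae_restrict_mem measurableSet_Ioi] with y hy
  rw [Real.norm_eq_abs, abs_mul]
  calc |u y| * |F y| ≤ (C * (1 + y ^ 2)⁻¹) * B := mul_le_mul (hC y) (hB y (le_of_lt hy))
        (abs_nonneg _) ((abs_nonneg _).trans (hC y))
    _ = _ := by ring

theorem SqDecay.tendsto_mul {u F : ℝ → ℝ} (hu : SqDecay u)
    {B : ℝ} (hB : ∀ y, 0 ≤ y → |F y| ≤ B) : Tendsto (u * F) atTop (𝓝 0) := by
  obtain ⟨hc, C, hC⟩ := hu
  have h1 : Tendsto (fun y : ℝ => C * B * (1 + y ^ 2)⁻¹) atTop (𝓝 0) := by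
    have h2 : Tendsto (fun y : ℝ => 1 + y ^ 2) atTop atTop :=
      tendsto_atTop_add_const_left _ _ (tendsto_pow_atTop two_ne_zero)
    simpa using h2.inv_tendsto_atTop.const_mul (C * B)
  refine squeeze_zero_norm' ?_ h1
  filter_upwards [eventually_ge_atTop 0] with y hy
  rw [Pi.mul_apply, Real.norm_eq_abs, abs_mul]
  calc |u y| * |F y| ≤ (C * (1 + y ^ 2)⁻¹) * B := mul_le_mul (hC y) (hB y hy)
        (abs_nonneg _) ((abs_nonneg _).trans (hC y))
    _ = _ := by ring

theorem SqDecay.integral_deriv_mul {u u' F F' : ℝ → ℝ} (hu : SqDecay u) (hu' : SqDecay u')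
    (hdu : ∀ y, HasDerivAt u (u' y) y) (hdF : ∀ y, HasDerivAt F (F' y) y) (hF' : Continuous F')
    {B B' : ℝ} (hB : ∀ y, 0 ≤ y → |F y| ≤ B) (hB' : ∀ y, 0 ≤ y → |F' y| ≤ B')
    (h0 : u 0 * F 0 = 0) :
    ∫ y in Set.Ioi 0, u' y * F y = -∫ y in Set.Ioi 0, u y * F' y := by
  have hF : Continuous F := continuous_iff_continuousAt.mpr fun y => (hdF y).continuousAt
  have hz : Tendsto (u * F) (𝓝[>] 0) (𝓝 0) := by
    have : Continuous (u * F) := hu.1.mul hF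
    have h := (this.tendsto 0).mono_left (nhdsWithin_le_nhds (s := Set.Ioi 0))
    rwa [Pi.mul_apply, h0] at h
  have h := integral_Ioi_mul_deriv_eq_deriv_mul (fun y _ => hdu y) (fun y _ => hdF y)
    (hu.integrableOn_mul hF' hB') (hu'.integrableOn_mul hF hB) hz (hu.tendsto_mul hB)
  rw [h]
  ring

/-- Smooth functions all of whose derivatives are bounded on `[0, ∞)`. -/
def SmoothBdd (F : ℝ → ℝ) : Prop :=
  ContDiff ℝ ∞ F ∧ ∀ j, ∃ B, ∀ y, 0 ≤ y → |iteratedDeriv j F y| ≤ B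

theorem SmoothBdd.deriv {F : ℝ → ℝ} (hF : SmoothBdd F) : SmoothBdd (deriv F) := by
  refine ⟨?_, fun j => ?_⟩
  · exact (contDiff_infty_iff_deriv.mp hF.1).2
  · rw [← iteratedDeriv_succ']
    exact hF.2 (j + 1)

theorem SmoothBdd.hasDerivAt {F : ℝ → ℝ} (hF : SmoothBdd F) (y : ℝ) :
    HasDerivAt F (_root_.deriv F y) y :=
  (hF.1.differentiable (by simp) y).hasDerivAt

theorem SmoothBdd.bounded {F : ℝ → ℝ} (hF : SmoothBdd F) : ∃ B, ∀ y, 0 ≤ y → |F y| ≤ B := by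
  simpa using hF.2 0

/-- Integration by parts, two steps at a time. At `0` the boundary terms vanish alternately because
the imaginary part of the kernel vanishes and because an odd derivative of `F` does. -/
theorem integral_cauchyPow_mul {ε : ℝ} (hε : 0 < ε) (h : ℕ) {F : ℝ → ℝ} (hF : SmoothBdd F)
    (hodd : ∀ j, j < h → iteratedDeriv (2 * j + 1) F 0 = 0) :
    ((2 * h).factorial : ℝ) * ∫ y in Set.Ioi 0, (cauchyPow ε (2 * h + 1) y).re * F y =
      (-1) ^ h * ∫ y in Set.Ioi 0, (cauchyPow ε 1 y).re * iteratedDeriv (2 * h) F y := by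
  induction h generalizing F with
  | zero => simp
  | succ h ih =>
    have hF1 := hF.deriv
    have hF2 := hF1.deriv
    obtain ⟨B, hB⟩ := hF.bounded
    obtain ⟨B1, hB1⟩ := hF1.bounded
    obtain ⟨B2, hB2⟩ := hF2.bounded
    have hd : ∀ j, iteratedDeriv j (deriv (deriv F)) = iteratedDeriv (j + 2) F := fun j => by
      rw [← iteratedDeriv_succ', ← iteratedDeriv_succ']
    have key := ih hF2 (fun j hj => by
      rw [hd]
      exact hodd (j + 1) (by omega))
    have h1 := (sqDecay_cauchyPow_im hε (2 * h)).integral_deriv_mul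
      (u' := fun y => -(((2 * h + 2 : ℕ) : ℝ) * (cauchyPow ε (2 * h + 2 + 1) y).re))
      (by
        obtain ⟨hc, C, hC⟩ := sqDecay_cauchyPow_re hε (2 * h + 2)
        refine ⟨(hc.const_mul _).neg, ((2 * h + 2 : ℕ) : ℝ) * C, fun y => ?_⟩
        rw [abs_neg, abs_mul, Nat.abs_cast, mul_assoc]
        exact mul_le_mul_of_nonneg_left (hC y) (Nat.cast_nonneg _))
      (hasDerivAt_cauchyPow_im hε (2 * h + 2)) hF.hasDerivAt hF1.1.continuous hB hB1
      (by rw [cauchyPow_zero_im, zero_mul])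
    have h2 := (sqDecay_cauchyPow_re hε (2 * h)).integral_deriv_mul
      (u' := fun y => ((2 * h + 1 : ℕ) : ℝ) * (cauchyPow ε (2 * h + 1 + 1) y).im)
      (by
        obtain ⟨hc, C, hC⟩ := sqDecay_cauchyPow_im hε (2 * h)
        refine ⟨hc.const_mul _, ((2 * h + 1 : ℕ) : ℝ) * C, fun y => ?_⟩
        rw [abs_mul, Nat.abs_cast, mul_assoc]
        exact mul_le_mul_of_nonneg_left (hC y) (Nat.cast_nonneg _))
      (hasDerivAt_cauchyPow_re hε (2 * h + 1)) hF1.hasDerivAt hF2.1.continuous hB1 hB2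
      (by
        have := hodd 0 (by omega)
        rw [mul_zero, zero_add, iteratedDeriv_one] at this
        rw [this, mul_zero])
    simp only [neg_mul, mul_assoc, integral_neg, neg_inj] at h1
    simp only [mul_assoc] at h2
    rw [integral_const_mul] at h1 h2
    rw [hd] at key
    rw [show 2 * (h + 1) = 2 * h + 2 by ring, Nat.factorial_succ, Nat.factorial_succ, pow_succ]
    push_cast at h1 h2 ⊢
    rw [mul_neg_one, neg_mul, ← key]
    linear_combination (2 * h + 1 : ℝ) * (2 * h).factorial * h1 + ((2 * h).factorial : ℝ) * h2

/-- Substituting `y = εu` moves `ε` into the argument of `G`. Dominated convergence applies, and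
`π/2` is the mass of `1/(1 + u²)` on the half-line. -/
theorem tendsto_integral_cauchy {G : ℝ → ℝ} (hG : Continuous G) {B : ℝ}
    (hB : ∀ y, 0 ≤ y → |G y| ≤ B) :
    Tendsto (fun ε : ℝ => ∫ y in Set.Ioi 0, (cauchyPow ε 1 y).re * G y) (𝓝[>] 0)
      (𝓝 (Real.pi / 2 * G 0)) := by
  have h1 : ∀ ε : ℝ, 0 < ε → ∫ y in Set.Ioi 0, (cauchyPow ε 1 y).re * G y =
      ∫ u in Set.Ioi 0, (1 + u ^ 2)⁻¹ * G (ε * u) := by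
    intro ε hε
    have h2 := integral_comp_mul_left_Ioi (fun y => (cauchyPow ε 1 y).re * G y) 0 hε
    rw [mul_zero, smul_eq_mul, eq_inv_mul_iff_mul_eq₀ hε.ne'] at h2
    rw [← h2, ← integral_const_mul]
    congr 1
    funext u
    rw [cauchyPow_one_re]
    have : 0 < 1 + u ^ 2 := by positivity
    field_simp
  have h3 : Tendsto (fun ε : ℝ => ∫ u in Set.Ioi 0, (1 + u ^ 2)⁻¹ * G (ε * u)) (𝓝[>] 0)
      (𝓝 (∫ u in Set.Ioi (0 : ℝ), (1 + u ^ 2)⁻¹ * G 0)) := by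
    have hc : Continuous fun u : ℝ => (1 + u ^ 2)⁻¹ :=
      Continuous.inv₀ (by fun_prop) fun u => by positivity
    refine tendsto_integral_filter_of_dominated_convergence (fun u => (1 + u ^ 2)⁻¹ * B) ?_ ?_ ?_ ?_
    · exact Eventually.of_forall fun ε => (hc.mul (hG.comp (by fun_prop))).aestronglyMeasurable
    · filter_upwards [self_mem_nhdsWithin] with ε hε
      filter_upwards [ae_restrict_mem measurableSet_Ioi] with u hu
      rw [Real.norm_eq_abs, abs_mul, abs_of_nonneg (by positivity : 0 ≤ (1 + u ^ 2)⁻¹)]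
      exact mul_le_mul_of_nonneg_left (hB _ (mul_nonneg (le_of_lt hε) (le_of_lt hu)))
        (by positivity)
    · exact (integrable_inv_one_add_sq.mul_const B).integrableOn
    · refine Eventually.of_forall fun u => Tendsto.const_mul _ ?_
      have h4 : Continuous fun ε : ℝ => G (ε * u) := hG.comp (by fun_prop)
      have h5 := (h4.tendsto 0).mono_left (nhdsWithin_le_nhds (s := Set.Ioi 0))
      simpa using h5
  rw [integral_mul_const, integral_Ioi_inv_one_add_sq, Real.arctan_zero, sub_zero] at h3
  refine h3.congr' ?_
  filter_upwards [self_mem_nhdsWithin] with ε hε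
  exact (h1 ε hε).symm

theorem integrable_kernelK_mul_comp_abs {ε : ℝ} (hε : 0 < ε) (h : ℕ) {F : ℝ → ℝ}
    (hF : SmoothBdd F) : Integrable fun y => kernelK (2 * h) ε y * F |y| := by
  obtain ⟨B, hB⟩ := hF.bounded
  obtain ⟨hc, C, hC⟩ := sqDecay_cauchyPow_re hε (2 * h)
  have h1 : Continuous fun y => kernelK (2 * h) ε y * F |y| := by
    simp only [kernelK_eq _ hε]
    exact (hc.const_mul _).mul (hF.1.continuous.comp continuous_abs)
  refine Integrable.mono' (integrable_inv_one_add_sq.const_mul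
    (((2 * h).factorial : ℝ) / Real.pi * C * B)) h1.aestronglyMeasurable
    (Eventually.of_forall fun y => ?_)
  rw [kernelK_eq _ hε, Real.norm_eq_abs, abs_mul, abs_mul,
    abs_of_nonneg (by positivity : 0 ≤ ((2 * h).factorial : ℝ) / Real.pi)]
  calc _ ≤ ((2 * h).factorial : ℝ) / Real.pi * (C * (1 + y ^ 2)⁻¹) * B :=
        mul_le_mul (mul_le_mul_of_nonneg_left (hC y) (by positivity)) (hB _ (abs_nonneg y))
          (abs_nonneg _) (mul_nonneg (by positivity) ((abs_nonneg _).trans (hC y)))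
    _ = _ := by ring

theorem tendsto_integral_kernelK (h : ℕ) {F : ℝ → ℝ} (hF : SmoothBdd F)
    (hodd : ∀ j, j < h → iteratedDeriv (2 * j + 1) F 0 = 0) :
    Tendsto (fun ε : ℝ => ∫ y : ℝ, kernelK (2 * h) ε y * F |y|) (𝓝[>] 0)
      (𝓝 ((-1) ^ h * iteratedDeriv (2 * h) F 0)) := by
  obtain ⟨B, hB⟩ := hF.2 (2 * h)
  have hc : Continuous (iteratedDeriv (2 * h) F) :=
    (contDiff_infty.mp hF.1 (2 * h)).continuous_iteratedDeriv _ le_rfl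
  have h1 := (tendsto_integral_cauchy hc hB).const_mul ((-1) ^ h * (2 / Real.pi))
  have h2 : (-1) ^ h * (2 / Real.pi) * (Real.pi / 2 * iteratedDeriv (2 * h) F 0) =
      (-1) ^ h * iteratedDeriv (2 * h) F 0 := by
    have := Real.pi_ne_zero
    field_simp
  rw [h2] at h1
  refine h1.congr' ?_
  filter_upwards [self_mem_nhdsWithin] with ε hε
  have h3 : (fun y => kernelK (2 * h) ε y * F |y|) = fun y =>
      (fun y => kernelK (2 * h) ε y * F y) |y| := by
    funext y
    simp only [kernelK, sq_abs]
  rw [h3, integral_comp_abs (f := fun y => kernelK (2 * h) ε y * F y)]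
  have h4 : ∫ y in Set.Ioi 0, kernelK (2 * h) ε y * F y = 1 / Real.pi *
      (((2 * h).factorial : ℝ) * ∫ y in Set.Ioi 0, (cauchyPow ε (2 * h + 1) y).re * F y) := by
    rw [← integral_const_mul, ← integral_const_mul]
    congr 1
    funext y
    rw [kernelK_eq _ hε]
    ring
  rw [h4, integral_cauchyPow_mul hε h hF hodd]
  ring

end CauchyKernel

/-! ### Smoothness and boundedness of `f_k(2y)` on the half-line. -/

section Conclusion

open scoped ContDiff

theorem iteratedDeriv_exp_mul_eval (c : ℝ) (p : Polynomial ℝ) (j : ℕ) : ∃ q : Polynomial ℝ,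
    iteratedDeriv j (fun y => Real.exp (-(c * y)) * p.eval y) =
      fun y => Real.exp (-(c * y)) * q.eval y := by
  induction j with
  | zero => exact ⟨p, by simp⟩
  | succ j ih =>
    obtain ⟨q, hq⟩ := ih
    refine ⟨Polynomial.derivative q - Polynomial.C c * q, ?_⟩
    rw [iteratedDeriv_succ, hq]
    funext y
    have h1 : HasDerivAt (fun y : ℝ => Real.exp (-(c * y))) (Real.exp (-(c * y)) * -c) y := by
      have := ((hasDerivAt_id y).const_mul c).neg.exp
      simpa using this
    rw [(h1.fun_mul (q.hasDerivAt y)).deriv]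
    simp
    ring

theorem smoothBdd_exp_mul_eval {c : ℝ} (hc : 0 < c) (p : Polynomial ℝ) :
    SmoothBdd fun y => Real.exp (-(c * y)) * p.eval y := by
  refine ⟨?_, fun j => ?_⟩
  · have h1 : ContDiff ℝ ∞ fun x : ℝ => p.eval x := by
      simpa using p.contDiff_aeval (𝕜 := ℝ) ∞
    exact ContDiff.mul (by fun_prop) h1
  · obtain ⟨q, hq⟩ := iteratedDeriv_exp_mul_eval c p j
    rw [hq]
    have hcont : Continuous fun y => Real.exp (-(c * y)) * q.eval y :=
      Continuous.mul (by fun_prop) q.continuous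
    have hlim : Tendsto (fun y => Real.exp (-(c * y)) * q.eval y) atTop (𝓝 0) := by
      have h1 := (q.comp (Polynomial.C c⁻¹ * Polynomial.X)).tendsto_div_exp_atTop.comp
        (tendsto_id.const_mul_atTop hc)
      refine h1.congr fun y => ?_
      simp only [Function.comp, id, Polynomial.eval_comp, Polynomial.eval_mul, Polynomial.eval_C,
        Polynomial.eval_X]
      rw [inv_mul_cancel_left₀ hc.ne', Real.exp_neg, div_eq_inv_mul]
    obtain ⟨M, hM⟩ := (hlim.abs.eventually (gt_mem_nhds (by simp : |(0 : ℝ)| < 1))).exists_forall_of_atTop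
    obtain ⟨B, hB⟩ := (isCompact_Icc (a := (0 : ℝ)) (b := M)).exists_bound_of_continuousOn
      hcont.continuousOn
    refine ⟨max B 1, fun y hy => ?_⟩
    rcases le_total y M with hyM | hyM
    · exact (hB y ⟨hy, hyM⟩).trans (le_max_left _ _)
    · exact (hM y hyM).le.trans (le_max_right _ _)

/-- Needed because for `N = 0` there is no exponential decay to control a polynomial. -/
theorem toeplitzPoly_zero (k : ℕ) : toeplitzPoly 0 k = 1 := by
  rw [toeplitzPoly, Matrix.det_of_isUpperTriangular]
  · refine Finset.prod_eq_one fun i _ => ?_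
    rw [Matrix.of_apply, show ((0 : ℕ) : ℤ) + (i : ℕ) - (i : ℕ) = Int.ofNat 0 by simp, lagPoly]
    simp
  · intro i j hij
    have hij' : (j : ℕ) < i := hij
    rw [Matrix.of_apply]
    obtain ⟨m, hm⟩ := Int.eq_negSucc_of_lt_zero
      (show ((0 : ℕ) : ℤ) + (j : ℕ) - (i : ℕ) < 0 by omega)
    rw [hm, lagPoly]

theorem smoothBdd_fLag (N k : ℕ) : SmoothBdd fun y => fLag N k (2 * y) := by
  rw [fLag_eq]
  rcases Nat.eq_zero_or_pos N with rfl | hN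
  · simp only [toeplitzPoly_zero]
    refine ⟨?_, fun j => ⟨1, fun y _ => ?_⟩⟩
    · simpa using contDiff_const
    · simp only [CharP.cast_eq_zero, zero_div, neg_zero, zero_mul, Real.exp_zero, Polynomial.eval_one,
        mul_one, iteratedDeriv_const]
      split_ifs <;> simp
  · have h := smoothBdd_exp_mul_eval (Nat.cast_pos.mpr hN : (0 : ℝ) < N)
      ((toeplitzPoly N k).comp (Polynomial.C 2 * Polynomial.X))
    convert h using 2 with y
    simp only [Polynomial.eval_comp, Polynomial.eval_mul, Polynomial.eval_C, Polynomial.eval_X]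
    rw [show -((N : ℝ) / 2) * (2 * y) = -(N * y) by ring]

theorem contDiff_fLag (N k : ℕ) (m : ℕ) : ContDiff ℝ m (fLag N k) := by
  rw [fLag_eq]
  have h1 : ContDiff ℝ m fun x : ℝ => (toeplitzPoly N k).eval x := by
    simpa using (toeplitzPoly N k).contDiff_aeval (𝕜 := ℝ) m
  exact ContDiff.mul (by fun_prop) h1

end Conclusion

end

theorem lemma3 (N h k : ℕ) (hk : (h : ℝ) - 1 / 2 < (k : ℝ)) :
    -- the joint moment is a convergent integral, with the stated value
    (MeasureTheory.Integrable (momentIntegrand N (h : ℝ) (k : ℝ)) (haarU N) ∧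
      jointMoment N (h : ℝ) (k : ℝ) = (-1) ^ h * iteratedDeriv (2 * h) (fLag N k) 0) ∧
    -- the regularised integral that represents the joint moment has this limit
    ((∀ ε : ℝ, 0 < ε → MeasureTheory.Integrable (fun y : ℝ =>
        kernelK (2 * h) ε y * Real.exp (-(N : ℝ) * |y|) * laguerreDet N k (2 * |y|))) ∧
      Filter.Tendsto (fun ε : ℝ => (-1) ^ (k * (k - 1) / 2) * ((2 : ℝ) ^ (2 * h))⁻¹ *
          ∫ y : ℝ, kernelK (2 * h) ε y * Real.exp (-(N : ℝ) * |y|) * laguerreDet N k (2 * |y|))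
        (nhdsWithin 0 (Set.Ioi 0))
        (nhds ((-1) ^ h * iteratedDeriv (2 * h) (fLag N k) 0))) ∧
    -- the odd derivatives at zero vanish
    (∀ j : ℕ, j < h → iteratedDeriv (2 * h - 2 * j - 1) (fLag N k) 0 = 0) := by
  -- For integers, `k > h - 1/2` means `h ≤ k`; hence `2k - 2h` is a natural number and `2h ≤ 2k`.
  have hhk : h ≤ k := by
    have h1 : (h : ℝ) < (k + 1 : ℕ) := by push_cast; linarith
    exact Nat.lt_succ_iff.mp (Nat.cast_lt.mp h1)
  have hs : ((-1 : ℝ) ^ (k * (k - 1) / 2)) * (-1) ^ (k * (k - 1) / 2) = 1 := by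
    rw [← mul_pow]; simp
  have hInt : ∀ ε y : ℝ,
      kernelK (2 * h) ε y * Real.exp (-(N : ℝ) * |y|) * laguerreDet N k (2 * |y|) =
      (-1) ^ (k * (k - 1) / 2) * (kernelK (2 * h) ε y * fLag N k (2 * |y|)) := by
    intro ε y
    rw [fLag, show -((N : ℝ) / 2) * (2 * |y|) = -(N : ℝ) * |y| by ring]
    linear_combination (-(kernelK (2 * h) ε y * Real.exp (-(N : ℝ) * |y|) *
      laguerreDet N k (2 * |y|))) * hs
  have hcomp := fun m => iteratedDeriv_comp_const_mul (contDiff_fLag N k m) 2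
  refine ⟨⟨?_, ?_⟩, ⟨fun ε hε => ?_, ?_⟩, fun j hj => ?_⟩
  · rw [momentIntegrand_eq N hhk]
    exact integrable_charVProd N (by omega)
  · have h1 := integral_charVProd N (k := k) (m := 2 * h) (by omega)
    rw [jointMoment, momentIntegrand_eq N hhk]
    rw [pow_mul, neg_sq, Complex.I_sq] at h1
    exact_mod_cast h1
  · simp only [hInt]
    exact (integrable_kernelK_mul_comp_abs hε h (smoothBdd_fLag N k)).const_mul _
  · have h1 := (tendsto_integral_kernelK h (smoothBdd_fLag N k) fun j hj => by
      rw [hcomp]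
      simp only [mul_zero]
      rw [iteratedDeriv_fLag_odd N (by omega) ⟨j, rfl⟩, mul_zero]).const_mul ((2 : ℝ) ^ (2 * h))⁻¹
    rw [hcomp] at h1
    simp only [mul_zero] at h1
    -- The prefactor `2^{-2h}` cancels the chain-rule factor that comes from the argument `2|y|`.
    have h2 : ((2 : ℝ) ^ (2 * h))⁻¹ * ((-1) ^ h * (2 ^ (2 * h) * iteratedDeriv (2 * h) (fLag N k) 0)) =
        (-1) ^ h * iteratedDeriv (2 * h) (fLag N k) 0 := by
      field_simp
    rw [h2] at h1
    refine h1.congr fun ε => ?_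
    simp only [hInt, MeasureTheory.integral_const_mul]
    linear_combination (-(((2 : ℝ) ^ (2 * h))⁻¹ *
      ∫ y : ℝ, kernelK (2 * h) ε y * fLag N k (2 * |y|))) * hs
  · exact iteratedDeriv_fLag_odd N (by omega) ⟨h - j - 1, by omega⟩
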